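/- **Theorem 2 (observer convergence).** Let $\varepsilon>0$, $\nu\in C^1([-1,1])$, and let $\bar\lambda$ be such that $\lambda:=\bar\lambda-\tfrac12\nu'-\tfrac{1}{4\varepsilon}\nu^2\in C^1([-1,1])$ (for $\nu=0$ this says $\lambda=\bar\lambda\in C^1([-1,1])$). Consider the reaction–advection–diffusion system $$\partial_t\bar u=\varepsilon\,\partial_y^2\bar u+\nu(y)\,\partial_y\bar u+\bar\lambda(y)\,\bar u,\quad y\in(-1,1),\qquad \bar u(-1,t)=\bar{\mathcal U}_1(t),\quad \bar u(1,t)=\bar{\mathcal U}_2(t),$$ and set $u(y,t):=\exp\big(\int_{-1}^y\frac{\nu(z)}{2\varepsilon}dz\big)\bar u(y,t)$, so that $\partial_t u=\varepsilon\,\partial_y^2u+\lambda u$, $u(-1,t)=\mathcal U_1(t):=\bar{\mathcal U}_1(t)$ and $u(1,t)=\mathcal U_2(t):=\exp\big(\int_{-1}^1\frac{\nu(z)}{2\varepsilon}dz\big)\bar{\mathcal U}_2(t)$. Let $\hat y_0\in(-1,1)$, and suppose that $u(\hat y_0,t)$ and $\partial_yu(\hat y_0,t)$ are measured. Put $s_1:=-(1+\hat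 y_0)$, $s_2:=1-\hat y_0$, and, for $i\in\{1,2\}$, $\check\varepsilon_i:=\varepsilon/s_i^2$ and $\check\lambda_i(x):=\lambda(\hat y_0+s_ix)$ for $x\in[0,1]$; let $\check c_1,\check c_2>0$. (a) For each $i$ the kernel equations $$\partial_x^2\Phi_i-\partial_y^2\Phi_i=-\frac{\check\lambda_i(x)+\check c_i}{\check\varepsilon_i}\Phi_i,\qquad \Phi_i(1,y)=0,\qquad \Phi_i(x,x)=-\int_x^1\frac{\check\lambda_i(z)+\check c_i}{2\check\varepsilon_i}\,dz$$ have a solution $\Phi_i\in C^2(\mathcal T)$ on the closed triangle $\mathcal T=\{0\le y\le x\le1\}$. (b) For any such $\Phi_1,\Phi_2$ put $\phi_i(x):=-\check\varepsilon_i\Phi_i(x,0)$. Then there are constants $\check{\bar\Pi},\check\gamma_{\min}>0$ with the following property. Let $t_0\in\mathbb R$, let $\bar u$ be a solution of the system for $t>t_0$ with some inputs $\bar{\mathcal U}_1,\bar{\mathcal U}_2$, and let $\hat u_1,\hat u_2$ be solutions for $t>t_0$ of the two decoupled estimators, $x\in(0,1)$, $$\partial_t\hat u_i=\check\varepsilon_i\,\partial_x^2\hat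 u_i+\check\lambda_i(x)\,\hat u_i+\phi_i(x)\big(s_i\,\partial_yu(\hat y_0,t)-\partial_x\hat u_i(0,t)\big),\qquad \hat u_i(0,t)=u(\hat y_0,t),\qquad \hat u_i(1,t)=\mathcal U_i(t).$$ Define $$\hat u(y,t):=\begin{cases}\hat u_1\big(\frac{\hat y_0-y}{1+\hat y_0},t\big)& y\le\hat y_0\\[2pt] \hat u_2\big(\frac{y-\hat y_0}{1-\hat y_0},t\big)& y>\hat y_0\end{cases}\qquad\text{and}\qquad \hat{\bar u}(y,t):=\exp\Big(-\int_{-1}^y\frac{\nu(z)}{2\varepsilon}dz\Big)\hat u(y,t).$$ Then for all $t\ge t_0$ $$\|\bar u(\cdot,t)-\hat{\bar u}(\cdot,t)\|_{L^2(-1,1)}\le\check{\bar\Pi}\,e^{-\check\gamma_{\min}(t-t_0)}\,\|\bar u(\cdot,t_0)-\hat{\bar u}(\cdot,t_0)\|_{L^2(-1,1)}.$$ Here solutions are classical for $t>t_0$: of class $C^{2,1}$ (in space, time) in the open space interval and continuous up to its end points, with $\partial_x\hat u_i$ continuous up to $x=0$; their initial values at $t_0$ are in $L^2$ and are attained in the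 sense of $L^2$. -/

import Mathlib

open Set MeasureTheory Filter Topology

/-! Functions of space and time are written `f y t`, space variable first. -/

/-- `∂ₓ f`. -/
noncomputable def pdX (f : ℝ → ℝ → ℝ) (x t : ℝ) : ℝ := deriv (fun z => f z t) x

/-- `∂ₓ² f`. -/
noncomputable def pdXX (f : ℝ → ℝ → ℝ) (x t : ℝ) : ℝ := deriv (fun z => pdX f z t) x

/-- `∂ₜ f`. -/
noncomputable def pdT (f : ℝ → ℝ → ℝ) (x t : ℝ) : ℝ := deriv (fun s => f x s) t

/-- `f` is of class `C^{2,1}` (twice in space, once in time) on `I × (t₀, ∞)`, for an open `I`. -/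
structure IsC21On (f : ℝ → ℝ → ℝ) (I : Set ℝ) (t₀ : ℝ) : Prop where
  diff_x : ∀ x ∈ I, ∀ t > t₀, DifferentiableAt ℝ (fun z => f z t) x
  diff_xx : ∀ x ∈ I, ∀ t > t₀, DifferentiableAt ℝ (fun z => pdX f z t) x
  diff_t : ∀ x ∈ I, ∀ t > t₀, DifferentiableAt ℝ (fun s => f x s) t
  cont_x : ContinuousOn (fun p : ℝ × ℝ => pdX f p.1 p.2) (I ×ˢ Ioi t₀)
  cont_xx : ContinuousOn (fun p : ℝ × ℝ => pdXX f p.1 p.2) (I ×ˢ Ioi t₀)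
  cont_t : ContinuousOn (fun p : ℝ × ℝ => pdT f p.1 p.2) (I ×ˢ Ioi t₀)

/-- The initial value `f(·, t₀)` is in `L²(a, b)` and is attained in `L²(a, b)`. -/
structure HasL2InitialValue (f : ℝ → ℝ → ℝ) (a b t₀ : ℝ) : Prop where
  memLp : MemLp (fun x => f x t₀) 2 (volume.restrict (Ioo a b))
  tendsto : Tendsto (fun t => eLpNorm (fun x => f x t - f x t₀) 2 (volume.restrict (Ioo a b)))
    (𝓝[>] t₀) (𝓝 0)

/-- The exponent `∫_{-1}^y ν(z) / (2ε) dz` of the transformation that removes the advection. -/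
noncomputable def gaugeExp (ε : ℝ) (ν : ℝ → ℝ) (y : ℝ) : ℝ := ∫ z in (-1 : ℝ)..y, ν z / (2 * ε)

/-- The reaction coefficient `λ = λ̄ - ν'/2 - ν²/(4ε)` left after the advection is removed. -/
noncomputable def reaction (ε : ℝ) (ν lamBar : ℝ → ℝ) (y : ℝ) : ℝ :=
  lamBar y - derivWithin ν (Icc (-1) 1) y / 2 - ν y ^ 2 / (4 * ε)

/-- `u(y,t) = exp(∫_{-1}^y ν/(2ε)) ū(y,t)`. -/
noncomputable def gauged (ε : ℝ) (ν : ℝ → ℝ) (ubar : ℝ → ℝ → ℝ) (y t : ℝ) : ℝ :=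
  Real.exp (gaugeExp ε ν y) * ubar y t

/-- `ū` is a classical solution, for times after `t₀`, of
`∂ₜ ū = ε ∂_y² ū + ν ∂_y ū + λ̄ ū` on `(-1,1)`, `ū(-1,t) = Ū₁(t)`, `ū(1,t) = Ū₂(t)`,
with an initial value in `L²(-1,1)`. -/
structure IsPlantSolution (ε : ℝ) (ν lamBar : ℝ → ℝ) (Ubar : Fin 2 → ℝ → ℝ) (t₀ : ℝ)
    (ubar : ℝ → ℝ → ℝ) : Prop where
  regular : IsC21On ubar (Ioo (-1) 1) t₀
  cont : ContinuousOn (fun p : ℝ × ℝ => ubar p.1 p.2) (Icc (-1) 1 ×ˢ Ioi t₀)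
  initial : HasL2InitialValue ubar (-1) 1 t₀
  pde : ∀ y ∈ Ioo (-1 : ℝ) 1, ∀ t > t₀,
    pdT ubar y t = ε * pdXX ubar y t + ν y * pdX ubar y t + lamBar y * ubar y t
  left : ∀ t > t₀, ubar (-1) t = Ubar 0 t
  right : ∀ t > t₀, ubar 1 t = Ubar 1 t

/-- The slopes of the two folding maps `x ↦ y₀ + slope * x` from `[0,1]` onto `[-1,y₀]`
and `[y₀,1]`. Index `0` is the left piece, index `1` the right one. -/
def foldSlope (y₀ : ℝ) (i : Fin 2) : ℝ := ![-(1 + y₀), 1 - y₀] i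

/-- Folded diffusion coefficients `ε/(1+y₀)²` and `ε/(1-y₀)²`. -/
noncomputable def foldDiff (ε y₀ : ℝ) (i : Fin 2) : ℝ := ε / foldSlope y₀ i ^ 2

/-- Folded reaction coefficients `λ(y₀ - (1+y₀)x)` and `λ(y₀ + (1-y₀)x)`. -/
def foldReaction (lam : ℝ → ℝ) (y₀ : ℝ) (i : Fin 2) (x : ℝ) : ℝ := lam (y₀ + foldSlope y₀ i * x)

/-- The triangle `0 ≤ y ≤ x ≤ 1`. -/
def triangle : Set (ℝ × ℝ) := {p | 0 ≤ p.2 ∧ p.2 ≤ p.1 ∧ p.1 ≤ 1}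

/-- `Φ` is a `C²` solution on the closed triangle of the Klein-Gordon kernel equations
`Φ_xx - Φ_yy = -((λ(x)+c)/ε) Φ`, `Φ(1,y) = 0`, `Φ(x,x) = -∫_x^1 (λ(z)+c)/(2ε) dz`. -/
structure IsObserverKernel (ε : ℝ) (lam : ℝ → ℝ) (c : ℝ) (Φ : ℝ → ℝ → ℝ) : Prop where
  regular : ContDiffOn ℝ 2 (fun p : ℝ × ℝ => Φ p.1 p.2) triangle
  pde : ∀ x y : ℝ, 0 < y → y < x → x < 1 →
    deriv (fun z => deriv (fun z' => Φ z' y) z) x - deriv (fun z => deriv (fun z' => Φ x z') z) y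
      = -((lam x + c) / ε) * Φ x y
  side : ∀ y ∈ Icc (0 : ℝ) 1, Φ 1 y = 0
  diag : ∀ x ∈ Icc (0 : ℝ) 1, Φ x x = -∫ z in x..1, (lam z + c) / (2 * ε)

/-- The output injection gain `φ(x) = -ε Φ(x,0)`. -/
def observerGain (ε : ℝ) (Φ : ℝ → ℝ → ℝ) (x : ℝ) : ℝ := -ε * Φ x 0

/-- `v` is a classical solution, for times after `t₀`, of one estimator on `[0,1]`:
`∂ₜ v = ε ∂ₓ² v + λ(x) v + φ(x) (Y₁(t) - ∂ₓ v(0,t))`, `v(0,t) = Y₀(t)`, `v(1,t) = B(t)`,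
with an initial value in `L²(0,1)`. The slope `∂ₓ v(0,t)` is one-sided, and `∂ₓ v` is continuous
up to `x = 0`. -/
structure IsEstimatorSolution (ε : ℝ) (lam φ Y₀ Y₁ B : ℝ → ℝ) (t₀ : ℝ) (v : ℝ → ℝ → ℝ) :
    Prop where
  regular : IsC21On v (Ioo 0 1) t₀
  cont : ContinuousOn (fun p : ℝ × ℝ => v p.1 p.2) (Icc 0 1 ×ˢ Ioi t₀)
  diff_zero : ∀ t > t₀, DifferentiableWithinAt ℝ (fun z => v z t) (Icc 0 1) 0
  cont_slope : ContinuousOn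
    (fun p : ℝ × ℝ => derivWithin (fun z => v z p.2) (Icc 0 1) p.1) (Ico 0 1 ×ˢ Ioi t₀)
  initial : HasL2InitialValue v 0 1 t₀
  pde : ∀ x ∈ Ioo (0 : ℝ) 1, ∀ t > t₀,
    pdT v x t = ε * pdXX v x t + lam x * v x t
      + φ x * (Y₁ t - derivWithin (fun z => v z t) (Icc 0 1) 0)
  left : ∀ t > t₀, v 0 t = Y₀ t
  right : ∀ t > t₀, v 1 t = B t

/-- The boundary inputs after the transformation: `𝒰₁ = Ū₁` and
`𝒰₂ = exp(∫_{-1}^1 ν/(2ε)) Ū₂`. -/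
noncomputable def gaugedInput (ε : ℝ) (ν : ℝ → ℝ) (Ubar : Fin 2 → ℝ → ℝ) (i : Fin 2) (t : ℝ) : ℝ :=
  Real.exp (gaugeExp ε ν (![-1, 1] i)) * Ubar i t

/-- The pair of decoupled estimators with gains from the kernels `Φ`. They see the true state only
through the measurements `u(y₀,t)` and `∂_y u(y₀,t)`, and the boundary inputs. -/
def IsObserverSolution (ε : ℝ) (ν lamBar : ℝ → ℝ) (y₀ : ℝ) (Φ : Fin 2 → ℝ → ℝ → ℝ)
    (Ubar : Fin 2 → ℝ → ℝ) (ubar : ℝ → ℝ → ℝ) (t₀ : ℝ) (uhat : Fin 2 → ℝ → ℝ → ℝ) : Prop :=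
  ∀ i : Fin 2, IsEstimatorSolution (foldDiff ε y₀ i) (foldReaction (reaction ε ν lamBar) y₀ i)
    (observerGain (foldDiff ε y₀ i) (Φ i))
    (fun t => gauged ε ν ubar y₀ t)
    (fun t => foldSlope y₀ i * pdX (gauged ε ν ubar) y₀ t)
    (gaugedInput ε ν Ubar i) t₀ (uhat i)

/-- The state estimate `û` on `[-1,1]`, reassembled from the two estimators. -/
noncomputable def unfolded (y₀ : ℝ) (uhat : Fin 2 → ℝ → ℝ → ℝ) (y t : ℝ) : ℝ :=
  if y ≤ y₀ then uhat 0 ((y₀ - y) / (1 + y₀)) t else uhat 1 ((y - y₀) / (1 - y₀)) t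

/-- The estimate `exp(-∫_{-1}^y ν/(2ε)) û(y,t)` of `ū`. -/
noncomputable def stateEstimate (ε : ℝ) (ν : ℝ → ℝ) (y₀ : ℝ) (uhat : Fin 2 → ℝ → ℝ → ℝ)
    (y t : ℝ) : ℝ :=
  Real.exp (-gaugeExp ε ν y) * unfolded y₀ uhat y t

/-!
On each side of the sensor, the folded and gauge transformed estimation error solves
`eₜ = ε eₓₓ + λ e - φ(x) eₓ(0,t)`, `e(0,t) = e(1,t) = 0`. The kernel equations say that
`T p = p - ∫_x^1 Φ(y,x) p(y) dy` carries the adjoint of the spatial operator to `ε ∂² - c`, so the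
preimages `pₙ` of the functions `sin(nπx)` under `T` are adjoint eigenfunctions with eigenvalues
`-(ε n²π² + c)`. Testing the error system against `pₙ` shows that `∫ e pₙ` decays exactly
exponentially. These integrals are the sine coefficients of the image of `e` under the inverse of
the transpose of `T`, so Parseval's identity gives the decay of `e` in `L²`. As `e` need not be
regular up to `x = 1`, the test functions are shifted to `pₙ(x) - pₙ(b)` on `[a,b] ⊂ (0,1)`, which
removes the flux at `b` before `a → 0` and `b → 1`.
-/

open Function (uncurry)

/-! ### Integrals depending on parameters -/

section ParametricIntegral

variable {E : Type*} [NormedAddCommGroup E] [NormedSpace ℝ E]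

theorem hasFDerivAt_of_continuous_partials {f f₁ f₂ : ℝ → ℝ → E}
    (h₁ : ∀ x y, HasDerivAt (fun z => f z y) (f₁ x y) x)
    (h₂ : ∀ x y, HasDerivAt (fun z => f x z) (f₂ x y) y)
    (c₁ : Continuous (uncurry f₁)) (c₂ : Continuous (uncurry f₂)) (p : ℝ × ℝ) :
    HasFDerivAt (uncurry f)
      ((ContinuousLinearMap.toSpanSingleton ℝ (f₁ p.1 p.2)).coprod
        (ContinuousLinearMap.toSpanSingleton ℝ (f₂ p.1 p.2))) p :=
  (hasStrictFDerivAt_uncurry_coprod (𝕜 := ℝ) (u := p) (f := f)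
    (f₁ := fun x y => ContinuousLinearMap.toSpanSingleton ℝ (f₁ x y))
    (f₂ := fun x y => ContinuousLinearMap.toSpanSingleton ℝ (f₂ x y))
    (.of_forall fun v => (h₁ v.1 v.2).hasFDerivAt) (.of_forall fun v => (h₂ v.1 v.2).hasFDerivAt)
    (ContinuousLinearMap.toSpanSingletonCLE.continuous.comp c₁).continuousAt
    (ContinuousLinearMap.toSpanSingletonCLE.continuous.comp c₂).continuousAt).hasFDerivAt

theorem contDiff_succ_of_partials {n : ℕ} {f f₁ f₂ : ℝ → ℝ → E}
    (h₁ : ∀ x y, HasDerivAt (fun z => f z y) (f₁ x y) x)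
    (h₂ : ∀ x y, HasDerivAt (fun z => f x z) (f₂ x y) y)
    (c₁ : ContDiff ℝ n (uncurry f₁)) (c₂ : ContDiff ℝ n (uncurry f₂)) :
    ContDiff ℝ (n + 1) (uncurry f) := by
  refine (contDiff_succ_iff_hasFDerivAt (n := n)).2
    ⟨_, ?_, hasFDerivAt_of_continuous_partials h₁ h₂ c₁.continuous c₂.continuous⟩
  have comp_eq : ∀ p : ℝ × ℝ, (ContinuousLinearMap.toSpanSingleton ℝ (f₁ p.1 p.2)).coprod
        (ContinuousLinearMap.toSpanSingleton ℝ (f₂ p.1 p.2))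
      = (ContinuousLinearMap.fst ℝ ℝ ℝ).smulRight (uncurry f₁ p)
        + (ContinuousLinearMap.snd ℝ ℝ ℝ).smulRight (uncurry f₂ p) := fun p => by
    ext <;> simp [uncurry]
  simp_rw [comp_eq]
  exact (contDiff_const.smulRight c₁).add (contDiff_const.smulRight c₂)

theorem hasDerivAt_fst_of_differentiableAt {f : ℝ → ℝ → E} {x y : ℝ}
    (hf : DifferentiableAt ℝ (uncurry f) (x, y)) :
    HasDerivAt (fun z => f z y) (fderiv ℝ (uncurry f) (x, y) (1, 0)) x :=
  hf.hasFDerivAt.comp_hasDerivAt (f := fun z : ℝ => (z, y)) x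
    ((hasDerivAt_id' x).prodMk (hasDerivAt_const x y))

theorem continuous_integral_of_continuous_ends {X : Type*} [TopologicalSpace X] {h : X → ℝ → E}
    (ch : Continuous (uncurry h)) {a b : X → ℝ} (ca : Continuous a) (cb : Continuous b) :
    Continuous fun x => ∫ s in a x..b x, h x s := by
  have int : ∀ x u v, IntervalIntegrable (h x) volume u v := fun x u v =>
    (ch.uncurry_left x).intervalIntegrable u v
  have split : ∀ x, ∫ s in a x..b x, h x s = (∫ s in 0..b x, h x s) - ∫ s in 0..a x, h x s :=
    fun x => (intervalIntegral.integral_interval_sub_left (int x _ _) (int x _ _)).symm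
  simp_rw [split]
  exact (intervalIntegral.continuous_parametric_intervalIntegral_of_continuous ch cb).sub
    (intervalIntegral.continuous_parametric_intervalIntegral_of_continuous ch ca)

theorem intervalIntegral_swap_of_continuous {F : ℝ → ℝ → E} (hF : Continuous (uncurry F))
    (a b c d : ℝ) : ∫ x in a..b, ∫ y in c..d, F x y = ∫ y in c..d, ∫ x in a..b, F x y :=
  intervalIntegral_intervalIntegral_swap <|
    (hF.continuousOn.integrableOn_compact (isCompact_uIcc.prod isCompact_uIcc)).mono_set
      (prod_mono uIoc_subset_uIcc uIoc_subset_uIcc)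

variable [CompleteSpace E]

theorem hasDerivAt_integral_upper {f : ℝ → E} (hf : Continuous f) (a x : ℝ) :
    HasDerivAt (fun z => ∫ s in a..z, f s) (f x) x :=
  (hf.integral_hasStrictDerivAt a x).hasDerivAt

theorem hasDerivAt_integral_of_continuous {h h' : ℝ → ℝ → E}
    (hd : ∀ x s, HasDerivAt (fun z => h z s) (h' x s) x)
    (ch : Continuous (uncurry h)) (ch' : Continuous (uncurry h')) (a b x : ℝ) :
    HasDerivAt (fun z => ∫ s in a..b, h z s) (∫ s in a..b, h' x s) x := by
  have ftc : ∀ z s, ∫ y in (0 : ℝ)..z, h' y s = h z s - h 0 s := fun z s =>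
    intervalIntegral.integral_eq_sub_of_hasDerivAt (fun y _ => hd y s)
      ((ch'.uncurry_right s).intervalIntegrable _ _)
  have primitive : ∀ z, ∫ s in a..b, h z s
      = (∫ s in a..b, h 0 s) + ∫ y in (0 : ℝ)..z, ∫ s in a..b, h' y s := fun z => by
    rw [intervalIntegral_swap_of_continuous ch']
    simp_rw [ftc]
    rw [intervalIntegral.integral_sub ((ch.uncurry_left z).intervalIntegrable _ _)
      ((ch.uncurry_left 0).intervalIntegrable _ _), add_sub_cancel]
  exact ((hasDerivAt_integral_upper (continuous_integral_of_continuous_ends ch' continuous_const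
    continuous_const) 0 x).const_add _).congr_of_eventuallyEq (.of_forall primitive)

theorem hasDerivAt_integral_of_hasDerivAt_ends {h h' : ℝ → ℝ → E}
    (hd : ∀ x s, HasDerivAt (fun z => h z s) (h' x s) x)
    (ch : Continuous (uncurry h)) (ch' : Continuous (uncurry h')) {u v : ℝ → ℝ} {u' v' x : ℝ}
    (hu : HasDerivAt u u' x) (hv : HasDerivAt v v' x) :
    HasDerivAt (fun z => ∫ s in u z..v z, h z s)
      (v' • h x (v x) - u' • h x (u x) + ∫ s in u x..v x, h' x s) x := by
  have upper : ∀ {w : ℝ → ℝ} {w' : ℝ}, HasDerivAt w w' x →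
      HasDerivAt (fun z => ∫ s in (0 : ℝ)..w z, h z s)
        ((∫ s in (0 : ℝ)..w x, h' x s) + w' • h x (w x)) x := fun {w w'} hw => by
    have key := hasFDerivAt_of_continuous_partials (f := fun y b => ∫ s in (0 : ℝ)..b, h y s)
      (f₁ := fun y b => ∫ s in (0 : ℝ)..b, h' y s)
      (fun y b => hasDerivAt_integral_of_continuous hd ch ch' 0 b y)
      (fun y b => hasDerivAt_integral_upper (ch.uncurry_left y) 0 b)
      (continuous_integral_of_continuous_ends (X := ℝ × ℝ) (h := fun p => h' p.1) (by fun_prop)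
        continuous_const continuous_snd) ch (x, w x)
    refine (key.comp_hasDerivAt (f := fun z => (z, w z)) x
      ((hasDerivAt_id' x).prodMk hw)).congr_deriv ?_
    simp
  have split : ∀ {g : ℝ → ℝ → E}, Continuous (uncurry g) → ∀ z,
      ∫ s in u z..v z, g z s = (∫ s in 0..v z, g z s) - ∫ s in 0..u z, g z s := fun cg z =>
    (intervalIntegral.integral_interval_sub_left ((cg.uncurry_left z).intervalIntegrable _ _)
      ((cg.uncurry_left z).intervalIntegrable _ _)).symm
  refine (((upper hv).sub (upper hu)).congr_of_eventuallyEq (.of_forall (split ch))).congr_deriv ?_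
  rw [split ch']
  abel

theorem contDiff_integral_upper {n : ℕ} {h : ℝ → ℝ → E} (ch : ContDiff ℝ n (uncurry h)) (a : ℝ) :
    ContDiff ℝ n (uncurry fun x y => ∫ s in a..y, h x s) := by
  induction n generalizing h with
  | zero =>
    exact contDiff_zero.2 (continuous_integral_of_continuous_ends (X := ℝ × ℝ)
      (h := fun p => h p.1) (by have := ch.continuous; fun_prop) continuous_const continuous_snd)
  | succ n ih =>
    have hdiff := ch.differentiable (by simp)
    have c' : ContDiff ℝ n (uncurry fun x s => fderiv ℝ (uncurry h) (x, s) (1, 0)) :=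
      (ch.fderiv_right le_rfl).clm_apply contDiff_const
    exact contDiff_succ_of_partials
      (fun x y => hasDerivAt_integral_of_continuous
        (fun x s => hasDerivAt_fst_of_differentiableAt (hdiff (x, s))) ch.continuous
        c'.continuous a y x)
      (fun x y => hasDerivAt_integral_upper (ch.continuous.uncurry_left x) a y)
      (ih c') (ch.of_le (by exact_mod_cast n.le_succ))

theorem integral_integral_triangle_swap {k : ℝ → ℝ → E} (ck : Continuous (uncurry k)) (a b : ℝ) :
    ∫ x in a..b, ∫ y in x..b, k x y = ∫ y in a..b, ∫ x in a..y, k x y := by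
  have cinner : Continuous (uncurry fun z x => ∫ y in x..z, k x y) :=
    continuous_integral_of_continuous_ends (X := ℝ × ℝ) (h := fun p => k p.2) (by fun_prop)
      continuous_snd continuous_fst
  have ccol : Continuous fun z => ∫ x in a..z, k x z :=
    continuous_integral_of_continuous_ends (by fun_prop) continuous_const continuous_id
  have leibniz : ∀ z, HasDerivAt (fun z => ∫ x in a..z, ∫ y in x..z, k x y)
      (∫ x in a..z, k x z) z := fun z => by
    simpa using hasDerivAt_integral_of_hasDerivAt_ends
      (fun z x => hasDerivAt_integral_upper (ck.uncurry_left x) x z) cinner (by fun_prop)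
      (hasDerivAt_const z a) (hasDerivAt_id z)
  simpa using (intervalIntegral.integral_eq_sub_of_hasDerivAt (fun z _ => leibniz z)
    (ccol.intervalIntegrable a b)).symm

end ParametricIntegral

/-! ### Volterra equations -/

section Volterra

theorem exists_fixed_of_weighted_contraction {X : Type*} [TopologicalSpace X] [CompactSpace X]
    (ω : C(X, ℝ)) (hω : ∀ x, 0 < ω x) (A : C(X, ℝ) → C(X, ℝ))
    (hA : ∀ f g : C(X, ℝ), ∀ M : ℝ, 0 ≤ M → (∀ x, |f x - g x| ≤ M * ω x) →
      ∀ x, |A f x - A g x| ≤ M / 2 * ω x) : ∃ f, A f = f := by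
  let ω' : C(X, ℝ) := ⟨fun x => (ω x)⁻¹, ω.continuous.inv₀ fun x => (hω x).ne'⟩
  let T : C(X, ℝ) → C(X, ℝ) := fun h => ω' * A (ω * h)
  have weighted_dist : ∀ f g : C(X, ℝ), ∀ x, |(ω * f) x - (ω * g) x| ≤ dist f g * ω x :=
    fun f g x => by
      have pointwise : dist (f x) (g x) ≤ dist f g := ContinuousMap.dist_apply_le_dist x
      rw [ContinuousMap.mul_apply, ContinuousMap.mul_apply, ← mul_sub, abs_mul,
        abs_of_pos (hω x), mul_comm]
      exact mul_le_mul_of_nonneg_right pointwise (hω x).le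
  have hT : ContractingWith (1 / 2) T := by
    refine ⟨by norm_num, LipschitzWith.of_dist_le_mul fun f g => ?_⟩
    refine (ContinuousMap.dist_le (by positivity)).2 fun x => ?_
    have dist_eq : dist (T f x) (T g x) = (ω x)⁻¹ * |A (ω * f) x - A (ω * g) x| := by
      simp only [T, ω', ContinuousMap.mul_apply, ContinuousMap.coe_mk]
      rw [Real.dist_eq, ← mul_sub, abs_mul, abs_of_pos (inv_pos.2 (hω x))]
    rw [dist_eq, inv_mul_le_iff₀ (hω x)]
    refine (hA _ _ _ dist_nonneg (weighted_dist f g) x).trans_eq ?_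
    rw [NNReal.coe_div, NNReal.coe_one, NNReal.coe_ofNat]
    ring
  refine ⟨ω * ContractingWith.fixedPoint T hT, ?_⟩
  conv_rhs => rw [← hT.fixedPoint_isFixedPt.eq]
  ext x
  simp [T, ω', (hω x).ne']

theorem abs_integral_le_of_le_exp {u : ℝ → ℝ} (hu : Continuous u) {a C K x : ℝ} (hK : 0 < K)
    (hx : a ≤ x) (hC : 0 ≤ C) (h : ∀ y ∈ Icc a x, |u y| ≤ C * Real.exp (K * y)) :
    |∫ y in a..x, u y| ≤ C / K * Real.exp (K * x) := by
  have ce : Continuous fun y => C * Real.exp (K * y) := by fun_prop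
  have primitive : ∀ y, HasDerivAt (fun y => C / K * Real.exp (K * y)) (C * Real.exp (K * y)) y :=
    fun y => (((hasDerivAt_id y).const_mul K).exp.const_mul (C / K)).congr_deriv
      (by simp only [id]; field_simp)
  calc |∫ y in a..x, u y| ≤ ∫ y in a..x, |u y| := intervalIntegral.abs_integral_le_integral_abs hx
    _ ≤ ∫ y in a..x, C * Real.exp (K * y) := intervalIntegral.integral_mono_on hx
        (hu.abs.intervalIntegrable _ _) (ce.intervalIntegrable _ _) h
    _ = C / K * Real.exp (K * x) - C / K * Real.exp (K * a) :=
        intervalIntegral.integral_eq_sub_of_hasDerivAt (fun y _ => primitive y)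
          (ce.intervalIntegrable _ _)
    _ ≤ C / K * Real.exp (K * x) := sub_le_self _ (by positivity)

variable {a b : ℝ} {k : ℝ → ℝ → ℝ}

theorem exists_abs_le_of_continuous (ck : Continuous (uncurry k)) (a b c d : ℝ) :
    ∃ M, 0 ≤ M ∧ ∀ x ∈ Icc a b, ∀ y ∈ Icc c d, |k x y| ≤ M := by
  obtain ⟨M, hM⟩ := (isCompact_Icc (a := a) (b := b)).prod (isCompact_Icc (a := c) (b := d))
    |>.exists_bound_of_continuousOn ck.continuousOn
  exact ⟨|M|, abs_nonneg M, fun x hx y hy => (hM (x, y) ⟨hx, hy⟩).trans (le_abs_self M)⟩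

theorem exists_volterra_solution (ck : Continuous (uncurry k)) {g : ℝ → ℝ} (hab : a ≤ b)
    (cg : ContinuousOn g (Icc a b)) :
    ∃ f : ℝ → ℝ, Continuous f ∧ ∀ x ∈ Icc a b, f x = g x + ∫ y in a..x, k x y * f y := by
  obtain ⟨M, hM0, hM⟩ := exists_abs_le_of_continuous ck a b a b
  let E : C(Icc a b, ℝ) → ℝ → ℝ := fun f y => f (projIcc a b hab y)
  have cE : ∀ f, Continuous (E f) := fun f => f.continuous.comp continuous_projIcc
  have ckE : ∀ f, Continuous (uncurry fun x y => k x y * E f y) := fun f =>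
    ck.mul ((cE f).comp continuous_snd)
  let A : C(Icc a b, ℝ) → C(Icc a b, ℝ) := fun f =>
    ⟨fun x => g x + ∫ y in a..x, k x y * E f y,
      (cg.comp_continuous continuous_subtype_val fun x => x.2).add
        ((continuous_integral_of_continuous_ends (ckE f) continuous_const continuous_id).comp
          continuous_subtype_val)⟩
  set K := 2 * (M + 1)
  have hK : 0 < K := by positivity
  have contraction : ∀ f g : C(Icc a b, ℝ), ∀ L : ℝ, 0 ≤ L →
      (∀ x : Icc a b, |f x - g x| ≤ L * Real.exp (K * x)) →
      ∀ x : Icc a b, |A f x - A g x| ≤ L / 2 * Real.exp (K * x) := fun f g L hL h x => by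
    have sub_eq : A f x - A g x = ∫ y in a..x, k x y * (E f y - E g y) := by
      simp only [A, ContinuousMap.coe_mk, add_sub_add_left_eq_sub, mul_sub]
      exact (intervalIntegral.integral_sub (((ckE f).uncurry_left x.1).intervalIntegrable _ _)
        (((ckE g).uncurry_left x.1).intervalIntegrable _ _)).symm
    rw [sub_eq]
    refine (abs_integral_le_of_le_exp (C := M * L) ((ck.uncurry_left x.1).mul ((cE f).sub (cE g)))
      hK x.2.1 (by positivity) fun y hy => ?_).trans ?_
    · have hy' : y ∈ Icc a b := ⟨hy.1, hy.2.trans x.2.2⟩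
      rw [Pi.mul_apply, abs_mul, mul_assoc]
      simp only [E, Pi.sub_apply, projIcc_of_mem hab hy']
      exact mul_le_mul (hM x x.2 y hy') (h ⟨y, hy'⟩) (abs_nonneg _) hM0
    · refine mul_le_mul_of_nonneg_right ?_ (Real.exp_pos _).le
      rw [div_le_iff₀ hK]
      linarith [show L / 2 * K = M * L + L by simp only [K]; ring]
  obtain ⟨f, hf⟩ := exists_fixed_of_weighted_contraction
    ⟨fun x : Icc a b => Real.exp (K * x), by fun_prop⟩ (fun _ => Real.exp_pos _) A contraction
  refine ⟨E f, cE f, fun x hx => ?_⟩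
  have fixed : g x + ∫ y in a..x, k x y * E f y = f ⟨x, hx⟩ := congrArg (fun h => h ⟨x, hx⟩) hf
  rw [fixed]
  simp only [E, projIcc_of_mem hab hx]

theorem sq_integral_abs_le {f : ℝ → ℝ} (hf : Continuous f) (hab : a ≤ b) :
    (∫ y in a..b, |f y|) ^ 2 ≤ (b - a) * ∫ y in a..b, f y ^ 2 := by
  set m := ∫ y in a..b, |f y|
  have nonneg : 0 ≤ ∫ y in a..b, ((b - a) * |f y| - m) ^ 2 :=
    intervalIntegral.integral_nonneg hab fun y _ => sq_nonneg _
  have expand : ∫ y in a..b, ((b - a) * |f y| - m) ^ 2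
      = (b - a) * ((b - a) * (∫ y in a..b, f y ^ 2) - m ^ 2) := by
    have : ∀ y, ((b - a) * |f y| - m) ^ 2
        = (b - a) ^ 2 * f y ^ 2 - 2 * (b - a) * m * |f y| + m ^ 2 := fun y => by
      rw [sub_sq, mul_pow, sq_abs]; ring
    simp_rw [this]
    rw [intervalIntegral.integral_add, intervalIntegral.integral_sub,
      intervalIntegral.integral_const_mul, intervalIntegral.integral_const_mul,
      intervalIntegral.integral_const]
    · simp only [smul_eq_mul, m]; ring
    all_goals exact Continuous.intervalIntegrable (by fun_prop) _ _
  rcases hab.eq_or_lt with rfl | hlt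
  · simp [m]
  · rw [expand, mul_nonneg_iff_of_pos_left (sub_pos.2 hlt)] at nonneg
    linarith

theorem abs_integral_mul_le (ck : Continuous (uncurry k)) {f : ℝ → ℝ} (cf : Continuous f) {M : ℝ}
    (hM : ∀ x ∈ Icc a b, ∀ y ∈ Icc a b, |k x y| ≤ M) {x : ℝ} (hx : x ∈ Icc a b) :
    |∫ y in a..x, k x y * f y| ≤ M * ∫ y in a..x, |f y| := by
  have ckf : Continuous fun y => k x y * f y := (ck.uncurry_left x).mul cf
  rw [← intervalIntegral.integral_const_mul]
  refine (intervalIntegral.abs_integral_le_integral_abs hx.1).trans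
    (intervalIntegral.integral_mono_on hx.1 (ckf.abs.intervalIntegrable _ _)
      ((cf.abs.const_mul M).intervalIntegrable _ _) fun y hy => ?_)
  rw [abs_mul]
  exact mul_le_mul_of_nonneg_right (hM x hx y ⟨hy.1, hy.2.trans hx.2⟩) (abs_nonneg _)

theorem abs_le_of_volterra (ck : Continuous (uncurry k)) {f g : ℝ → ℝ} (cf : Continuous f) {M : ℝ}
    (hM : ∀ x ∈ Icc a b, ∀ y ∈ Icc a b, |k x y| ≤ M) {x : ℝ} (hx : x ∈ Icc a b)
    (h : f x = g x + ∫ y in a..x, k x y * f y) : |f x| ≤ |g x| + M * ∫ y in a..x, |f y| :=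
  calc |f x| ≤ |g x| + |∫ y in a..x, k x y * f y| := h ▸ abs_add_le _ _
    _ ≤ |g x| + M * ∫ y in a..x, |f y| := by gcongr; exact abs_integral_mul_le ck cf hM hx

theorem integral_le_exp_mul_integral_of_gronwall {f g : ℝ → ℝ} (hf : Continuous f)
    (hg : Continuous g) {K : ℝ} (hK : 0 ≤ K) (hab : a ≤ b) (hg0 : ∀ x ∈ Icc a b, 0 ≤ g x)
    (h : ∀ x ∈ Icc a b, f x ≤ g x + K * ∫ y in a..x, f y) :
    ∫ x in a..b, f x ≤ Real.exp (K * (b - a)) * ∫ x in a..b, g x := by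
  let D : ℝ → ℝ := fun x => (∫ y in a..x, g y) - (∫ y in a..x, f y) * Real.exp (-K * (x - a))
  have hD : ∀ x, HasDerivAt D (g x
      - (f x - K * ∫ y in a..x, f y) * Real.exp (-K * (x - a))) x := fun x =>
    ((hasDerivAt_integral_upper hg a x).sub ((hasDerivAt_integral_upper hf a x).mul
      (((hasDerivAt_id x).sub_const a).const_mul (-K)).exp)).congr_deriv (by simp only [id]; ring)
  have hmono : MonotoneOn D (Icc a b) := by
    refine monotoneOn_of_deriv_nonneg (convex_Icc a b)
      (fun x _ => (hD x).continuousAt.continuousWithinAt)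
      (fun x _ => (hD x).differentiableAt.differentiableWithinAt) fun x hx => ?_
    have hx' : x ∈ Icc a b := interior_subset hx
    rw [(hD x).deriv, sub_nonneg]
    refine (mul_le_mul_of_nonneg_right (sub_le_iff_le_add.2 (h x hx'))
      (Real.exp_pos _).le).trans (mul_le_of_le_one_right (hg0 x hx') ?_)
    exact Real.exp_le_one_iff.2 (by nlinarith [hx'.1])
  have hDb : 0 ≤ D b := by
    simpa [D] using hmono (left_mem_Icc.2 hab) (right_mem_Icc.2 hab) hab
  calc ∫ x in a..b, f x
      = Real.exp (K * (b - a)) * ((∫ x in a..b, f x) * Real.exp (-K * (b - a))) := by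
        rw [mul_left_comm, ← Real.exp_add]; simp
    _ ≤ Real.exp (K * (b - a)) * ∫ x in a..b, g x :=
        mul_le_mul_of_nonneg_left (sub_nonneg.1 hDb) (Real.exp_pos _).le

theorem integral_sq_le_of_volterra {f g : ℝ → ℝ} (hf : Continuous f) (hg : Continuous g) {M : ℝ}
    (hab : a ≤ b) (h : ∀ x ∈ Icc a b, |f x| ≤ |g x| + M * ∫ y in a..x, |f y|) :
    ∫ x in a..b, f x ^ 2
      ≤ 2 * Real.exp (2 * M ^ 2 * (b - a) ^ 2) * ∫ x in a..b, g x ^ 2 := by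
  set K := 2 * M ^ 2 * (b - a) with hK
  have sq_le : ∀ x ∈ Icc a b, f x ^ 2 ≤ 2 * g x ^ 2 + K * ∫ y in a..x, f y ^ 2 := fun x hx => by
    have sq_int : (∫ y in a..x, |f y|) ^ 2 ≤ (b - a) * ∫ y in a..x, f y ^ 2 :=
      (sq_integral_abs_le hf hx.1).trans (mul_le_mul_of_nonneg_right (by linarith [hx.2])
        (intervalIntegral.integral_nonneg hx.1 fun y _ => sq_nonneg _))
    calc f x ^ 2 = |f x| ^ 2 := (sq_abs _).symm
      _ ≤ (|g x| + M * ∫ y in a..x, |f y|) ^ 2 := pow_le_pow_left₀ (abs_nonneg _) (h x hx) 2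
      _ ≤ 2 * (|g x| ^ 2 + (M * ∫ y in a..x, |f y|) ^ 2) := add_sq_le
      _ = 2 * g x ^ 2 + 2 * M ^ 2 * (∫ y in a..x, |f y|) ^ 2 := by rw [sq_abs]; ring
      _ ≤ 2 * g x ^ 2 + K * ∫ y in a..x, f y ^ 2 := by
        rw [hK, mul_assoc (2 * M ^ 2)]
        exact add_le_add_right (mul_le_mul_of_nonneg_left sq_int (by positivity)) _
  refine (integral_le_exp_mul_integral_of_gronwall (hf.pow 2) ((hg.pow 2).const_mul 2)
    (mul_nonneg (by positivity) (sub_nonneg.2 hab)) hab (fun x _ => ?_) sq_le).trans_eq ?_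
  · simp only [Pi.pow_apply]; positivity
  · simp only [Pi.pow_apply]
    rw [intervalIntegral.integral_const_mul, show K * (b - a) = 2 * M ^ 2 * (b - a) ^ 2 by ring]
    ring

theorem integral_sq_le_integral_sq_volterra_solution (ck : Continuous (uncurry k)) {f g : ℝ → ℝ}
    (cf : Continuous f) (cg : Continuous g) {M : ℝ} (hab : a ≤ b)
    (hM : ∀ x ∈ Icc a b, ∀ y ∈ Icc a b, |k x y| ≤ M)
    (h : ∀ x ∈ Icc a b, f x = g x + ∫ y in a..x, k x y * f y) :
    ∫ x in a..b, g x ^ 2 ≤ (2 + 2 * M ^ 2 * (b - a) ^ 2) * ∫ x in a..b, f x ^ 2 := by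
  set I := ∫ y in a..b, f y ^ 2
  have sq_le : ∀ x ∈ Icc a b, g x ^ 2 ≤ 2 * f x ^ 2 + 2 * M ^ 2 * (b - a) * I := fun x hx => by
    have sq_int : (∫ y in a..x, |f y|) ^ 2 ≤ (b - a) * I :=
      (sq_integral_abs_le cf hx.1).trans (mul_le_mul (sub_le_sub_right hx.2 a)
        (intervalIntegral.integral_mono_interval le_rfl hx.1 hx.2
          (.of_forall fun y => sq_nonneg _) ((cf.pow 2).intervalIntegrable _ _))
        (intervalIntegral.integral_nonneg hx.1 fun y _ => sq_nonneg _) (sub_nonneg.2 hab))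
    calc g x ^ 2 = (f x + -∫ y in a..x, k x y * f y) ^ 2 := by rw [h x hx]; ring
      _ ≤ 2 * (f x ^ 2 + (-∫ y in a..x, k x y * f y) ^ 2) := add_sq_le
      _ = 2 * f x ^ 2 + 2 * |∫ y in a..x, k x y * f y| ^ 2 := by rw [sq_abs]; ring
      _ ≤ 2 * f x ^ 2 + 2 * (M * ∫ y in a..x, |f y|) ^ 2 := by
        gcongr; exact abs_integral_mul_le ck cf hM hx
      _ ≤ 2 * f x ^ 2 + 2 * M ^ 2 * (b - a) * I := by
        rw [mul_pow, mul_assoc (2 * M ^ 2), mul_assoc 2]; gcongr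
  refine (intervalIntegral.integral_mono_on hab ((cg.pow 2).intervalIntegrable _ _)
    (Continuous.intervalIntegrable (by fun_prop) _ _) sq_le).trans_eq ?_
  rw [intervalIntegral.integral_add (Continuous.intervalIntegrable (by fun_prop) _ _)
    intervalIntegrable_const, intervalIntegral.integral_const_mul, intervalIntegral.integral_const,
    smul_eq_mul]
  ring

theorem eq_zero_of_volterra (ck : Continuous (uncurry k)) {f : ℝ → ℝ} (cf : Continuous f)
    (h : ∀ x ∈ Icc a b, f x = ∫ y in a..x, k x y * f y) : ∀ x ∈ Icc a b, f x = 0 := fun x hx => by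
  obtain ⟨M, -, hM⟩ := exists_abs_le_of_continuous ck a b a b
  have bound : ∀ z ∈ Icc a b, |f z| ≤ |(0 : ℝ)| + M * ∫ y in a..z, |f y| := fun z hz =>
    abs_le_of_volterra (g := 0) ck cf hM hz (by simpa using h z hz)
  have sq_nonpos : ∫ y in a..x, f y ^ 2 ≤ 0 := by
    simpa using integral_sq_le_of_volterra (g := fun _ => 0) cf continuous_const hx.1
      fun z hz => bound z ⟨hz.1, hz.2.trans hx.2⟩
  have integral_abs : ∫ y in a..x, |f y| = 0 := pow_eq_zero_iff two_ne_zero |>.1 <|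
    le_antisymm ((sq_integral_abs_le cf hx.1).trans
      (mul_nonpos_of_nonneg_of_nonpos (sub_nonneg.2 hx.1) sq_nonpos)) (sq_nonneg _)
  simpa [integral_abs] using bound x hx

theorem exists_backward_volterra_solution (ck : Continuous (uncurry k)) {g : ℝ → ℝ} (hab : a ≤ b)
    (cg : ContinuousOn g (Icc a b)) :
    ∃ f : ℝ → ℝ, Continuous f ∧ ∀ x ∈ Icc a b, f x = g x + ∫ y in x..b, k x y * f y := by
  have reflect : ∀ {x}, x ∈ Icc a b → a + b - x ∈ Icc a b := fun hx =>
    ⟨by linarith [hx.2], by linarith [hx.1]⟩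
  obtain ⟨f, cf, hf⟩ := exists_volterra_solution (k := fun x y => k (a + b - x) (a + b - y))
    (ck.comp (by fun_prop : Continuous fun p : ℝ × ℝ => (a + b - p.1, a + b - p.2))) hab
    (g := fun x => g (a + b - x)) (cg.comp (by fun_prop) fun x hx => reflect hx)
  refine ⟨fun x => f (a + b - x), cf.comp (by fun_prop), fun x hx => ?_⟩
  simpa [hf _ (reflect hx)] using (intervalIntegral.integral_comp_sub_left (a := x) (b := b)
    (fun y => k x (a + b - y) * f y) (a + b)).symm

theorem eq_zero_of_backward_volterra (ck : Continuous (uncurry k)) {f : ℝ → ℝ} (cf : Continuous f)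
    (h : ∀ x ∈ Icc a b, f x = ∫ y in x..b, k x y * f y) : ∀ x ∈ Icc a b, f x = 0 := by
  have reflect : ∀ {x}, x ∈ Icc a b → a + b - x ∈ Icc a b := fun hx =>
    ⟨by linarith [hx.2], by linarith [hx.1]⟩
  have reflected : ∀ x ∈ Icc a b, f (a + b - x) = 0 :=
    eq_zero_of_volterra (f := fun x => f (a + b - x)) (k := fun x y => k (a + b - x) (a + b - y))
      (ck.comp (by fun_prop : Continuous fun p : ℝ × ℝ => (a + b - p.1, a + b - p.2)))
      (cf.comp (by fun_prop)) fun x hx => by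
        simpa [h _ (reflect hx)] using (intervalIntegral.integral_comp_sub_left (a := a) (b := x)
          (fun y => k (a + b - x) y * f y) (a + b)).symm
  exact fun x hx => by simpa using reflected _ (reflect hx)

end Volterra

theorem exists_contDiff_extension_Icc {a b : ℝ} (hab : a < b) {f : ℝ → ℝ}
    (hf : ContDiffOn ℝ 1 f (Icc a b)) : ∃ g : ℝ → ℝ, ContDiff ℝ 1 g ∧ EqOn g f (Icc a b) := by
  set d := IccExtend hab.le ((Icc a b).domRestrict (derivWithin f (Icc a b)))
  have cd : Continuous d := continuousOn_iff_continuous_domRestrict.1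
    (hf.continuousOn_derivWithin (uniqueDiffOn_Icc hab) le_rfl) |>.Icc_extend'
  have hd : ∀ x ∈ Icc a b, d x = derivWithin f (Icc a b) x := fun x hx => by
    simp [d, IccExtend_of_mem, hx, Set.domRestrict]
  have hg : ∀ x, HasDerivAt (fun x => f a + ∫ y in a..x, d y) (d x) x := fun x =>
    (hasDerivAt_integral_upper cd a x).const_add _
  refine ⟨fun x => f a + ∫ y in a..x, d y, ?_, fun x hx => ?_⟩
  · refine contDiff_one_iff_deriv.2 ⟨fun x => (hg x).differentiableAt, ?_⟩
    rwa [funext fun x => (hg x).deriv]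
  · have ftc : ∫ y in a..x, d y = f x - f a := by
      refine intervalIntegral.integral_eq_sub_of_hasDerivAt_of_le hx.1
        (hf.continuousOn.mono (Icc_subset_Icc_right hx.2)) (fun y hy => ?_)
        (cd.intervalIntegrable _ _)
      have hy' : y ∈ Icc a b := ⟨hy.1.le, hy.2.le.trans hx.2⟩
      rw [hd y hy']
      exact (hf.differentiableOn one_ne_zero y hy').hasDerivWithinAt.hasDerivAt
        (Icc_mem_nhds hy.1 (hy.2.trans_le hx.2))
    simp [ftc]

/-! ### The Goursat problem -/

section Goursat

/-- A continuous retraction of the plane onto the triangle. -/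
noncomputable def triangleRetract (p : ℝ × ℝ) : ℝ × ℝ :=
  (max 0 (min p.1 1), max 0 (min p.2 (max 0 (min p.1 1))))

theorem continuous_triangleRetract : Continuous triangleRetract := by
  unfold triangleRetract; fun_prop

theorem triangleRetract_mem (p : ℝ × ℝ) : triangleRetract p ∈ triangle :=
  ⟨le_max_left _ _, max_le (le_max_left _ _) (min_le_right _ _),
    max_le zero_le_one (min_le_right _ _)⟩

theorem triangleRetract_of_mem {p : ℝ × ℝ} (hp : p ∈ triangle) : triangleRetract p = p := by
  obtain ⟨h0, h12, h1⟩ := hp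
  have fst_eq : max 0 (min p.1 1) = p.1 := by rw [min_eq_left h1, max_eq_right (h0.trans h12)]
  simp only [triangleRetract, fst_eq, min_eq_left h12, max_eq_right h0]

theorem continuous_comp_triangleRetract {f : ℝ × ℝ → ℝ} (hf : ContinuousOn f triangle) :
    Continuous (f ∘ triangleRetract) :=
  hf.comp_continuous continuous_triangleRetract triangleRetract_mem

theorem isCompact_triangle : IsCompact triangle := by
  have image : triangle = triangleRetract '' Icc 0 1 ×ˢ Icc 0 1 :=
    Subset.antisymm (fun p hp => ⟨p, ⟨⟨hp.1.trans hp.2.1, hp.2.2⟩, hp.1, hp.2.1.trans hp.2.2⟩,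
      triangleRetract_of_mem hp⟩) (image_subset_iff.2 fun p _ => triangleRetract_mem p)
  rw [image]
  exact (isCompact_Icc.prod isCompact_Icc).image continuous_triangleRetract

/-- The solution `u` of the Goursat problem `∂_ξ ∂_η u = h`, `u(ξ,ξ) = 0`, `u(ξ,0) = 0`: the
integral of `h` over the rectangle `[η,ξ] × [0,η]`. -/
noncomputable def goursatIntegral (h : ℝ → ℝ → ℝ) (ξ η : ℝ) : ℝ :=
  ∫ τ in η..ξ, ∫ s in 0..η, h τ s

variable {h h' : ℝ → ℝ → ℝ} {ξ η : ℝ}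

theorem mem_triangle_of_mem_Icc (hp : (ξ, η) ∈ triangle) {τ s : ℝ} (hτ : τ ∈ Icc η ξ)
    (hs : s ∈ Icc 0 η) : (τ, s) ∈ triangle :=
  ⟨hs.1, hs.2.trans hτ.1, hτ.2.trans hp.2.2⟩

theorem goursatIntegral_self (h : ℝ → ℝ → ℝ) (ξ : ℝ) : goursatIntegral h ξ ξ = 0 :=
  intervalIntegral.integral_same

theorem goursatIntegral_zero_right (h : ℝ → ℝ → ℝ) (ξ : ℝ) : goursatIntegral h ξ 0 = 0 := by
  simp [goursatIntegral]

theorem goursatIntegral_congr (hp : (ξ, η) ∈ triangle)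
    (heq : ∀ p ∈ triangle, h p.1 p.2 = h' p.1 p.2) :
    goursatIntegral h ξ η = goursatIntegral h' ξ η := by
  refine intervalIntegral.integral_congr fun τ hτ => intervalIntegral.integral_congr fun s hs => ?_
  rw [uIcc_of_le hp.2.1] at hτ
  rw [uIcc_of_le hp.1] at hs
  exact heq (τ, s) (mem_triangle_of_mem_Icc hp hτ hs)

theorem continuous_goursatIntegral (ch : Continuous (uncurry h)) :
    Continuous (uncurry (goursatIntegral h)) :=
  continuous_integral_of_continuous_ends (X := ℝ × ℝ) (h := fun p τ => ∫ s in 0..p.2, h τ s)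
    (continuous_integral_of_continuous_ends (X := (ℝ × ℝ) × ℝ) (h := fun q s => h q.2 s)
      (by fun_prop) continuous_const (by fun_prop)) continuous_snd continuous_fst

theorem goursatIntegral_sub (ch : Continuous (uncurry h)) (ch' : Continuous (uncurry h')) :
    goursatIntegral (h - h') ξ η = goursatIntegral h ξ η - goursatIntegral h' ξ η := by
  have int : ∀ {f : ℝ → ℝ → ℝ}, Continuous (uncurry f) →
      IntervalIntegrable (fun τ => ∫ s in 0..η, f τ s) volume η ξ := fun cf =>
    (continuous_integral_of_continuous_ends cf continuous_const
      continuous_const).intervalIntegrable _ _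
  simp only [goursatIntegral, Pi.sub_apply]
  rw [← intervalIntegral.integral_sub (int ch) (int ch')]
  congr with τ
  exact intervalIntegral.integral_sub ((ch.uncurry_left τ).intervalIntegrable _ _)
    ((ch'.uncurry_left τ).intervalIntegrable _ _)

theorem abs_goursatIntegral_le_of_le_exp (ch : Continuous (uncurry h)) {C K : ℝ} (hK : 0 < K)
    (hC : 0 ≤ C) (hh : ∀ p ∈ triangle, |h p.1 p.2| ≤ C * Real.exp (K * (p.1 + p.2)))
    (hp : (ξ, η) ∈ triangle) :
    |goursatIntegral h ξ η| ≤ C / K ^ 2 * Real.exp (K * (ξ + η)) := by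
  have inner : ∀ τ ∈ Icc η ξ, |∫ s in 0..η, h τ s|
      ≤ C / K * Real.exp (K * η) * Real.exp (K * τ) := fun τ hτ => by
    refine (abs_integral_le_of_le_exp (C := C * Real.exp (K * τ)) (ch.uncurry_left τ) hK hp.1
      (by positivity) fun s hs => ?_).trans_eq (by ring)
    rw [mul_assoc, ← Real.exp_add, ← mul_add]
    exact hh (τ, s) (mem_triangle_of_mem_Icc hp hτ hs)
  refine (abs_integral_le_of_le_exp (continuous_integral_of_continuous_ends ch continuous_const
    continuous_const) hK hp.2.1 (by positivity) inner).trans_eq ?_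
  rw [mul_add, Real.exp_add]
  field_simp

theorem hasDerivAt_goursatIntegral_fst (ch : Continuous (uncurry h)) (ξ η : ℝ) :
    HasDerivAt (fun z => goursatIntegral h z η) (∫ s in 0..η, h ξ s) ξ :=
  hasDerivAt_integral_upper
    (continuous_integral_of_continuous_ends ch continuous_const continuous_const) η ξ

theorem hasDerivAt_goursatIntegral_snd (ch : Continuous (uncurry h)) (ξ η : ℝ) :
    HasDerivAt (goursatIntegral h ξ) ((∫ τ in η..ξ, h τ η) - ∫ s in 0..η, h η s) η :=
  (hasDerivAt_integral_of_hasDerivAt_ends (h := fun z τ => ∫ s in 0..z, h τ s)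
    (h' := fun z τ => h τ z) (fun z τ => hasDerivAt_integral_upper (ch.uncurry_left τ) 0 z)
    (continuous_integral_of_continuous_ends (X := ℝ × ℝ) (h := fun p => h p.2) (by fun_prop)
      continuous_const continuous_fst)
    (by fun_prop) (hasDerivAt_id η) (hasDerivAt_const η ξ)).congr_deriv (by simp; ring)

theorem contDiff_goursatIntegral {n : ℕ} (ch : ContDiff ℝ n (uncurry h)) :
    ContDiff ℝ (n + 1) (uncurry (goursatIntegral h)) := by
  have cc := ch.continuous
  have cswap : ContDiff ℝ n (uncurry fun s τ => h τ s) := ch.comp (contDiff_snd.prodMk contDiff_fst)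
  have column : ContDiff ℝ n (uncurry fun ξ η => ∫ τ in η..ξ, h τ η) := by
    have split : ∀ p : ℝ × ℝ, ∫ τ in p.2..p.1, h τ p.2
        = (∫ τ in 0..p.1, h τ p.2) - ∫ τ in 0..p.2, h τ p.2 := fun p =>
      (intervalIntegral.integral_interval_sub_left ((cc.uncurry_right p.2).intervalIntegrable _ _)
        ((cc.uncurry_right p.2).intervalIntegrable _ _)).symm
    rw [show (uncurry fun ξ η => ∫ τ in η..ξ, h τ η) = _ from funext split]
    exact ((contDiff_integral_upper cswap 0).comp (contDiff_snd.prodMk contDiff_fst)).sub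
      ((contDiff_integral_upper cswap 0).comp (contDiff_snd.prodMk contDiff_snd))
  exact contDiff_succ_of_partials (hasDerivAt_goursatIntegral_fst cc)
    (hasDerivAt_goursatIntegral_snd cc) (contDiff_integral_upper ch 0)
    (column.sub ((contDiff_integral_upper ch 0).comp (contDiff_snd.prodMk contDiff_snd)))

theorem abs_goursatIntegral_mul_sub_le {m u v : ℝ → ℝ → ℝ} (cm : Continuous (uncurry m))
    (cu : Continuous (uncurry u)) (cv : Continuous (uncurry v)) {K L M : ℝ} (hK : 0 < K)
    (hL : 0 ≤ L) (hM : 0 ≤ M) (hm : ∀ p ∈ triangle, |m p.1 p.2| ≤ M)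
    (huv : ∀ p ∈ triangle, |u p.1 p.2 - v p.1 p.2| ≤ L * Real.exp (K * (p.1 + p.2)))
    (hp : (ξ, η) ∈ triangle) :
    |goursatIntegral (m * u) ξ η - goursatIntegral (m * v) ξ η|
      ≤ M * L / K ^ 2 * Real.exp (K * (ξ + η)) := by
  have cmu : Continuous (uncurry (m * u)) := cm.mul cu
  have cmv : Continuous (uncurry (m * v)) := cm.mul cv
  rw [← goursatIntegral_sub cmu cmv]
  refine abs_goursatIntegral_le_of_le_exp (h := m * u - m * v) (cmu.sub cmv) hK (by positivity)
    (fun q hq => ?_) hp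
  rw [← mul_sub, Pi.mul_apply, Pi.mul_apply, abs_mul, mul_assoc]
  exact mul_le_mul (hm q hq) (huv q hq) (abs_nonneg _) hM

variable {m g : ℝ → ℝ → ℝ}

theorem exists_goursat_solution (cm : Continuous (uncurry m)) (cg : Continuous (uncurry g)) :
    ∃ u : ℝ → ℝ → ℝ, Continuous (uncurry u) ∧
      ∀ p ∈ triangle, u p.1 p.2 = g p.1 p.2 + goursatIntegral (m * u) p.1 p.2 := by
  have : CompactSpace triangle := isCompact_iff_compactSpace.1 isCompact_triangle
  obtain ⟨M, hM⟩ := isCompact_triangle.exists_bound_of_continuousOn cm.continuousOn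
  have hM0 : 0 ≤ M := (norm_nonneg _).trans (hM 0 (by simp [triangle]))
  let E : C(triangle, ℝ) → ℝ → ℝ → ℝ := fun f ξ η => f ⟨_, triangleRetract_mem (ξ, η)⟩
  have cE : ∀ f, Continuous (uncurry (E f)) := fun f =>
    f.continuous.comp (continuous_triangleRetract.subtype_mk _)
  have hE : ∀ f (p : triangle), E f p.1.1 p.1.2 = f p := fun f p =>
    congrArg f (Subtype.ext (triangleRetract_of_mem p.2))
  let A : C(triangle, ℝ) → C(triangle, ℝ) := fun f =>
    ⟨fun p => uncurry (g + goursatIntegral (m * E f)) p,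
      (cg.add (continuous_goursatIntegral (h := m * E f) (cm.mul (cE f)))).comp
        continuous_subtype_val⟩
  set K := M + 2
  have hK : 0 < K := by positivity
  have contraction : ∀ f₁ f₂ : C(triangle, ℝ), ∀ L : ℝ, 0 ≤ L →
      (∀ p : triangle, |f₁ p - f₂ p| ≤ L * Real.exp (K * (p.1.1 + p.1.2))) →
      ∀ p : triangle, |A f₁ p - A f₂ p| ≤ L / 2 * Real.exp (K * (p.1.1 + p.1.2)) := by
    intro f₁ f₂ L hL hle p
    have sub_eq : A f₁ p - A f₂ p = goursatIntegral (m * E f₁) p.1.1 p.1.2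
        - goursatIntegral (m * E f₂) p.1.1 p.1.2 := add_sub_add_left_eq_sub _ _ _
    rw [sub_eq]
    refine (abs_goursatIntegral_mul_sub_le cm (cE f₁) (cE f₂) hK hL hM0 hM (fun q hq => ?_)
      p.2).trans (mul_le_mul_of_nonneg_right ?_ (Real.exp_pos _).le)
    · simpa only [hE _ ⟨q, hq⟩] using hle ⟨q, hq⟩
    · rw [div_le_iff₀ (by positivity)]
      nlinarith [show K ^ 2 = M ^ 2 + 4 * M + 4 by simp only [K]; ring]
  obtain ⟨f, hf⟩ := exists_fixed_of_weighted_contraction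
    ⟨fun p : triangle => Real.exp (K * (p.1.1 + p.1.2)), by fun_prop⟩
    (fun _ => Real.exp_pos _) A contraction
  exact ⟨E f, cE f, fun p hp =>
    (hE f ⟨p, hp⟩).trans (congrArg (fun h => h ⟨p, hp⟩) hf).symm⟩

theorem exists_contDiff_goursat_solution (cm : ContDiff ℝ 1 (uncurry m))
    (cg : ContDiff ℝ 2 (uncurry g)) :
    ∃ u k : ℝ → ℝ → ℝ, ContDiff ℝ 2 (uncurry u) ∧ ContDiff ℝ 1 (uncurry k) ∧
      (u = g + goursatIntegral k) ∧ ∀ p ∈ triangle, k p.1 p.2 = m p.1 p.2 * u p.1 p.2 := by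
  -- Each pass through the integral equation gains one derivative.
  obtain ⟨u₀, cu₀, hu₀⟩ := exists_goursat_solution cm.continuous cg.continuous
  set u₁ := g + goursatIntegral (m * u₀)
  have cu₁ : ContDiff ℝ 1 (uncurry u₁) := (cg.of_le one_le_two).add
    (contDiff_goursatIntegral (n := 0) (contDiff_zero.2 (cm.continuous.mul cu₀)))
  have ck : ContDiff ℝ 1 (uncurry (m * u₁)) := cm.mul cu₁
  refine ⟨g + goursatIntegral (m * u₁), m * u₁, ?_, ck, rfl, fun p hp => ?_⟩
  · exact cg.add (contDiff_goursatIntegral (n := 1) ck)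
  · simp only [Pi.mul_apply, Pi.add_apply]
    rw [goursatIntegral_congr hp (h' := m * u₀) fun q hq => by
      simp only [Pi.mul_apply]; rw [hu₀ q hq]; rfl]
    rfl

end Goursat

/-! ### Existence of the observer kernel -/

theorem deriv_deriv_comp_of_hasDerivAt_const {E : Type*} [NormedAddCommGroup E] [NormedSpace ℝ E]
    {F : E → ℝ} (cF : ContDiff ℝ 2 F) {γ : ℝ → E} {v : E} (hγ : ∀ z, HasDerivAt γ v z) (z : ℝ) :
    deriv (fun z => deriv (fun w => F (γ w)) z) z = fderiv ℝ (fderiv ℝ F) (γ z) v v := by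
  have first : (fun z => deriv (fun w => F (γ w)) z) = fun z => fderiv ℝ F (γ z) v :=
    funext fun z => ((cF.differentiable two_ne_zero _).hasFDerivAt.comp_hasDerivAt z (hγ z)).deriv
  have c' : Differentiable ℝ (fderiv ℝ F) :=
    (cF.fderiv_right (m := 1) le_rfl).differentiable one_ne_zero
  rw [first]
  simpa using (((c' (γ z)).hasFDerivAt.comp_hasDerivAt z (hγ z)).clm_apply
    (hasDerivAt_const z v)).deriv

theorem fderiv_fderiv_eq_of_hasDerivAt_mixed {F F₁ : ℝ → ℝ → ℝ} (cF : ContDiff ℝ 2 (uncurry F))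
    (h₁ : ∀ x y, HasDerivAt (fun z => F z y) (F₁ x y) x) {x y k : ℝ}
    (h₁₂ : HasDerivAt (F₁ x) k y) :
    fderiv ℝ (fderiv ℝ (uncurry F)) (x, y) (0, 1) (1, 0) = k := by
  have first : F₁ x = fun z => fderiv ℝ (uncurry F) (x, z) (1, 0) := funext fun z =>
    (h₁ x z).unique (hasDerivAt_fst_of_differentiableAt (cF.differentiable two_ne_zero _))
  have c' : Differentiable ℝ (fderiv ℝ (uncurry F)) :=
    (cF.fderiv_right (m := 1) le_rfl).differentiable one_ne_zero
  rw [first] at h₁₂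
  refine HasDerivAt.unique ?_ h₁₂
  simpa using ((c' (x, y)).hasFDerivAt.comp_hasDerivAt (f := fun z : ℝ => (x, z)) y
    ((hasDerivAt_const y x).prodMk (hasDerivAt_id' y))).clm_apply (hasDerivAt_const y (1, 0))

theorem wave_characteristic {G : ℝ → ℝ → ℝ} (cG : ContDiff ℝ 2 (uncurry G)) (x y : ℝ) :
    deriv (fun z => deriv (fun w => G (1 - (w + y) / 2) ((w - y) / 2)) z) x
        - deriv (fun z => deriv (fun w => G (1 - (x + w) / 2) ((x - w) / 2)) z) y
      = -fderiv ℝ (fderiv ℝ (uncurry G)) (1 - (x + y) / 2, (x - y) / 2) (0, 1) (1, 0) := by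
  set p : ℝ × ℝ := (1 - (x + y) / 2, (x - y) / 2) with hp
  have line_x : ∀ z : ℝ, HasDerivAt (fun w : ℝ => (1 - (w + y) / 2, (w - y) / 2))
      (-(1 / 2), 1 / 2) z := fun z =>
    ((((hasDerivAt_id' z).add_const y).div_const 2).const_sub 1).prodMk
      (((hasDerivAt_id' z).sub_const y).div_const 2)
  have line_y : ∀ z : ℝ, HasDerivAt (fun w : ℝ => (1 - (x + w) / 2, (x - w) / 2))
      (-(1 / 2), -1 / 2) z := fun z =>
    ((((hasDerivAt_id' z).const_add x).div_const 2).const_sub 1).prodMk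
      (((hasDerivAt_id' z).const_sub x).div_const 2)
  have symm : fderiv ℝ (fderiv ℝ (uncurry G)) p (1, 0) (0, 1)
      = fderiv ℝ (fderiv ℝ (uncurry G)) p (0, 1) (1, 0) :=
    (cG.contDiffAt.isSymmSndFDerivAt (by simp)).eq _ _
  have expand : ∀ v₁ v₂ : ℝ, fderiv ℝ (fderiv ℝ (uncurry G)) p (v₁, v₂) (v₁, v₂)
      = v₁ ^ 2 * fderiv ℝ (fderiv ℝ (uncurry G)) p (1, 0) (1, 0)
        + 2 * v₁ * v₂ * fderiv ℝ (fderiv ℝ (uncurry G)) p (0, 1) (1, 0)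
        + v₂ ^ 2 * fderiv ℝ (fderiv ℝ (uncurry G)) p (0, 1) (0, 1) := fun v₁ v₂ => by
    have basis : ((v₁, v₂) : ℝ × ℝ) = v₁ • ((1, 0) : ℝ × ℝ) + v₂ • ((0, 1) : ℝ × ℝ) := by simp
    rw [basis]
    simp only [map_add, map_smul, add_apply, smul_apply, smul_eq_mul, symm]
    ring
  refine (congrArg₂ (· - ·) (deriv_deriv_comp_of_hasDerivAt_const cG line_x x)
    (deriv_deriv_comp_of_hasDerivAt_const cG line_y y)).trans ?_
  rw [← hp, expand (-(1 / 2)) (1 / 2), expand (-(1 / 2)) (-1 / 2)]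
  ring

/-- In the characteristic coordinates `ξ = 1 - (x + y) / 2`, `η = (x - y) / 2`, which map the
triangle into itself, the kernel equations become the Goursat problem `∂_ξ ∂_η G = a(1 - ξ + η) G`,
`G(ξ,ξ) = 0`, `G(ξ,0) = -∫_{1-ξ}^1 a / 2` with `a = (λ + c) / ε`. -/
theorem exists_observerKernel {ε : ℝ} {lam : ℝ → ℝ} (hlam : ContDiffOn ℝ 1 lam (Icc 0 1)) (c : ℝ) :
    ∃ Φ, IsObserverKernel ε lam c Φ := by
  obtain ⟨a, ca, ha⟩ := exists_contDiff_extension_Icc zero_lt_one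
    (f := fun x => (lam x + c) / ε) ((hlam.add contDiffOn_const).div_const ε)
  let A : ℝ → ℝ := fun x => ∫ z in (0 : ℝ)..x, a z / 2
  have hA : ∀ x, HasDerivAt A (a x / 2) x := hasDerivAt_integral_upper (by fun_prop) 0
  have cA : ContDiff ℝ 2 A := contDiff_succ_iff_deriv (n := 1) |>.2
    ⟨fun x => (hA x).differentiableAt, by simp, by rw [funext fun x => (hA x).deriv]; fun_prop⟩
  let g : ℝ → ℝ → ℝ := fun ξ η => A (1 - ξ) - A (1 - η)
  obtain ⟨G, k, cG, ck, hG, hk⟩ := exists_contDiff_goursat_solution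
    (m := fun ξ η => a (1 - ξ + η)) (g := g) (ca.comp (by fun_prop)) <| by
      simp only [g]; fun_prop
  have hG₁ : ∀ ξ η, HasDerivAt (fun z => G z η) (-(a (1 - ξ) / 2) + ∫ s in 0..η, k ξ s) ξ :=
    fun ξ η => by
      rw [hG]
      exact ((((hA (1 - ξ)).scomp ξ ((hasDerivAt_id' ξ).const_sub 1)).sub_const (A (1 - η))).add
        (hasDerivAt_goursatIntegral_fst ck.continuous ξ η)).congr_deriv (by simp)
  refine ⟨fun x y => G (1 - (x + y) / 2) ((x - y) / 2), ?_, fun x y hy hyx hx => ?_,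
    fun y _ => ?_, fun x hx => ?_⟩
  · exact (cG.comp (f := fun p : ℝ × ℝ => (1 - (p.1 + p.2) / 2, (p.1 - p.2) / 2))
      (by fun_prop)).contDiffOn
  · rw [wave_characteristic cG, fderiv_fderiv_eq_of_hasDerivAt_mixed cG hG₁
      ((hasDerivAt_integral_upper (ck.continuous.uncurry_left _) 0 _).const_add _),
      hk (_, _) ⟨by simp only; linarith, by simp only; linarith, by simp only; linarith⟩]
    have hax : a x = (lam x + c) / ε := ha ⟨by linarith, by linarith⟩
    rw [← hax, show 1 - (1 - (x + y) / 2) + (x - y) / 2 = x by ring, neg_mul]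
  · simp [hG, show 1 - (1 + y) / 2 = (1 - y) / 2 by ring, goursatIntegral_self, g]
  · have integral_eq : ∫ z in x..1, (lam z + c) / (2 * ε) = ∫ z in x..1, a z / 2 :=
      intervalIntegral.integral_congr fun z hz => by
        rw [uIcc_of_le hx.2] at hz
        simp only [ha ⟨hx.1.trans hz.1, hz.2⟩, div_div, mul_comm]
    have int : ∀ u, IntervalIntegrable (fun z => a z / 2) volume 0 u := fun u =>
      Continuous.intervalIntegrable (by fun_prop) _ _
    simp [hG, integral_eq, goursatIntegral_zero_right, g, A,
      ← intervalIntegral.integral_interval_sub_left (int 1) (int x)]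

/-! ### One-sided calculus on the triangle -/

section Triangle

theorem convex_triangle : Convex ℝ triangle := by
  have halfSpaces : triangle
      = {p : ℝ × ℝ | 0 ≤ p.2} ∩ ({p : ℝ × ℝ | p.2 - p.1 ≤ 0} ∩ {p : ℝ × ℝ | p.1 ≤ 1}) := by
    ext p; simp [triangle]
  rw [halfSpaces]
  exact (convex_halfSpace_ge (LinearMap.snd ℝ ℝ ℝ).isLinear 0).inter
    ((convex_halfSpace_le (LinearMap.snd ℝ ℝ ℝ - LinearMap.fst ℝ ℝ ℝ).isLinear 0).inter
      (convex_halfSpace_le (LinearMap.fst ℝ ℝ ℝ).isLinear 1))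

theorem triangle_mem_nhds {x y : ℝ} (hy : 0 < y) (hyx : y < x) (hx : x < 1) :
    triangle ∈ 𝓝 (x, y) := by
  have isOpen : IsOpen {p : ℝ × ℝ | 0 < p.2 ∧ p.2 < p.1 ∧ p.1 < 1} :=
    (isOpen_lt continuous_const continuous_snd).inter
      ((isOpen_lt continuous_snd continuous_fst).inter (isOpen_lt continuous_fst continuous_const))
  exact mem_of_superset (isOpen.mem_nhds ⟨hy, hyx, hx⟩)
    fun p hp => ⟨hp.1.le, hp.2.1.le, hp.2.2.le⟩

theorem uniqueDiffOn_triangle : UniqueDiffOn ℝ triangle :=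
  uniqueDiffOn_convex convex_triangle ⟨(2 / 3, 1 / 3), mem_interior_iff_mem_nhds.2
    (triangle_mem_nhds (by norm_num) (by norm_num) (by norm_num))⟩

/-- The partial derivative in the first variable on the closed triangle, one-sided on its
boundary. -/
noncomputable def pdFst (F : ℝ → ℝ → ℝ) (x y : ℝ) : ℝ :=
  fderivWithin ℝ (uncurry F) triangle (x, y) (1, 0)

/-- The partial derivative in the second variable on the closed triangle, one-sided on its
boundary. -/
noncomputable def pdSnd (F : ℝ → ℝ → ℝ) (x y : ℝ) : ℝ :=
  fderivWithin ℝ (uncurry F) triangle (x, y) (0, 1)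

variable {F D : ℝ → ℝ → ℝ} {x y : ℝ}

theorem contDiffOn_pdFst {n : ℕ} (hF : ContDiffOn ℝ (n + 1) (uncurry F) triangle) :
    ContDiffOn ℝ n (uncurry (pdFst F)) triangle :=
  (hF.fderivWithin uniqueDiffOn_triangle le_rfl).clm_apply contDiffOn_const

theorem contDiffOn_pdSnd {n : ℕ} (hF : ContDiffOn ℝ (n + 1) (uncurry F) triangle) :
    ContDiffOn ℝ n (uncurry (pdSnd F)) triangle :=
  (hF.fderivWithin uniqueDiffOn_triangle le_rfl).clm_apply contDiffOn_const

theorem hasDerivWithinAt_pdFst (hF : DifferentiableOn ℝ (uncurry F) triangle)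
    (h : (x, y) ∈ triangle) : HasDerivWithinAt (fun z => F z y) (pdFst F x y) (Icc y 1) x :=
  (hF _ h).hasFDerivWithinAt.comp_hasDerivWithinAt (f := fun z : ℝ => (z, y)) x
    ((hasDerivAt_id' x).prodMk (hasDerivAt_const x y)).hasDerivWithinAt
    fun _ hz => ⟨h.1, hz.1, hz.2⟩

theorem hasDerivWithinAt_pdSnd (hF : DifferentiableOn ℝ (uncurry F) triangle)
    (h : (x, y) ∈ triangle) : HasDerivWithinAt (F x) (pdSnd F x y) (Icc 0 x) y :=
  (hF _ h).hasFDerivWithinAt.comp_hasDerivWithinAt (f := fun z : ℝ => (x, z)) y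
    ((hasDerivAt_const y x).prodMk (hasDerivAt_id' y)).hasDerivWithinAt
    fun _ hz => ⟨hz.1, hz.2, h.2.2⟩

theorem hasDerivAt_pdFst (hF : DifferentiableOn ℝ (uncurry F) triangle) (hy : 0 ≤ y)
    (hx : x ∈ Ioo y 1) : HasDerivAt (fun z => F z y) (pdFst F x y) x :=
  (hasDerivWithinAt_pdFst hF ⟨hy, hx.1.le, hx.2.le⟩).hasDerivAt (Icc_mem_nhds hx.1 hx.2)

theorem hasDerivAt_pdSnd (hF : DifferentiableOn ℝ (uncurry F) triangle) (hx : x ≤ 1)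
    (hy : y ∈ Ioo 0 x) : HasDerivAt (F x) (pdSnd F x y) y :=
  (hasDerivWithinAt_pdSnd hF ⟨hy.1.le, hy.2.le, hx⟩).hasDerivAt (Icc_mem_nhds hy.1 hy.2)

theorem hasDerivAt_diag_of_differentiableOn_triangle
    (hF : DifferentiableOn ℝ (uncurry F) triangle) (hx : x ∈ Ioo 0 1) :
    HasDerivAt (fun z => F z z) (pdFst F x x + pdSnd F x x) x := by
  have mem : ∀ z ∈ Icc (0 : ℝ) 1, (z, z) ∈ triangle := fun z hz => ⟨hz.1, le_rfl, hz.2⟩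
  have within := (hF _ (mem x (Ioo_subset_Icc_self hx))).hasFDerivWithinAt.comp_hasDerivWithinAt
    (f := fun z : ℝ => (z, z)) (s := Icc 0 1) x
    ((hasDerivAt_id' x).prodMk (hasDerivAt_id' x)).hasDerivWithinAt mem
  refine (within.hasDerivAt (Icc_mem_nhds hx.1 hx.2)).congr_deriv ?_
  rw [pdFst, pdSnd, ← map_add]
  simp

theorem continuousOn_triangle_column (hF : ContinuousOn (uncurry F) triangle)
    (hx : 0 ≤ x) : ContinuousOn (fun y => F y x) (Icc x 1) :=
  hF.comp (f := fun y : ℝ => (y, x)) (by fun_prop) fun _ hy => ⟨hx, hy.1, hy.2⟩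

theorem exists_extension_of_pdSnd (hF : DifferentiableOn ℝ (uncurry F) triangle)
    (cD : Continuous (uncurry D)) (hD : ∀ x y, (x, y) ∈ triangle → D x y = pdSnd F x y) :
    ∃ E : ℝ → ℝ → ℝ, Continuous (uncurry E) ∧ (∀ x y, (x, y) ∈ triangle → E x y = F x y) ∧
      ∀ x y, HasDerivAt (E x) (D x y) y := by
  let f : ℝ → ℝ := fun x => (uncurry F ∘ triangleRetract) (x, x)
  have cf : Continuous f := (continuous_comp_triangleRetract hF.continuousOn).comp
    (by fun_prop : Continuous fun x : ℝ => (x, x))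
  have hf : ∀ x ∈ Icc (0 : ℝ) 1, f x = F x x := fun x hx => by
    simp only [f, Function.comp, triangleRetract_of_mem (p := (x, x)) ⟨hx.1, le_rfl, hx.2⟩, uncurry]
  refine ⟨fun x y => f x + ∫ z in x..y, D x z, (cf.comp continuous_fst).add
    (continuous_integral_of_continuous_ends (X := ℝ × ℝ) (h := fun p => D p.1) (by fun_prop)
      continuous_fst continuous_snd), fun x y ⟨hy, hyx, hx⟩ => ?_,
    fun x y => (hasDerivAt_integral_upper (cD.uncurry_left x) x y).const_add _⟩
  have ftc : ∫ z in y..x, D x z = F x x - F x y :=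
    intervalIntegral.integral_eq_sub_of_hasDerivAt_of_le hyx
      (fun z hz => ((hasDerivWithinAt_pdSnd hF ⟨hy.trans hz.1, hz.2, hx⟩).mono
        (Icc_subset_Icc_left hy)).continuousWithinAt)
      (fun z hz => by
        rw [hD x z ⟨hy.trans hz.1.le, hz.2.le, hx⟩]
        exact hasDerivAt_pdSnd hF hx ⟨hy.trans_lt hz.1, hz.2⟩)
      ((cD.uncurry_left x).intervalIntegrable _ _)
  simp only
  rw [intervalIntegral.integral_symm, ftc, hf x ⟨hy.trans hyx, hx⟩]
  ring

end Triangle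

/-! ### Adjoint eigenfunctions -/

/-- `p`, with derivatives `p'` and `p''`, is an eigenfunction for the eigenvalue `-μ` of the adjoint
of `e ↦ ε e'' + λ e - φ e'(0)`, `e(0) = e(1) = 0`. The nonlocal term `φ e'(0)` turns the boundary
condition of the adjoint at `0` into `ε p(0) + ∫_0^1 φ p = 0`. -/
structure IsAdjointEigenfunction (ε : ℝ) (lam φ : ℝ → ℝ) (μ : ℝ) (p p' p'' : ℝ → ℝ) : Prop where
  cont : Continuous p
  cont_deriv : Continuous p'
  cont_deriv₂ : Continuous p''
  hasDerivAt : ∀ x ∈ Ioo (0 : ℝ) 1, HasDerivAt p (p' x) x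
  hasDerivAt_deriv : ∀ x ∈ Ioo (0 : ℝ) 1, HasDerivAt p' (p'' x) x
  ode : ∀ x ∈ Ioo (0 : ℝ) 1, ε * p'' x + lam x * p x = -μ * p x
  left : ∫ x in 0..1, φ x * p x = -ε * p 0
  right : p 1 = 0

theorem exists_continuous_extension_Icc {f : ℝ → ℝ} {a b : ℝ} (hab : a ≤ b)
    (hf : ContinuousOn f (Icc a b)) : ∃ g : ℝ → ℝ, Continuous g ∧ EqOn g f (Icc a b) :=
  ⟨IccExtend hab ((Icc a b).domRestrict f), hf.domRestrict.Icc_extend',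
    fun x hx => by simp [IccExtend_of_mem, hx, Set.domRestrict]⟩

section VolterraRegularity

variable {k k₁ k₁₁ : ℝ → ℝ → ℝ} {a b : ℝ} {s s' s'' p : ℝ → ℝ} {d x : ℝ}

theorem hasDerivAt_of_backward_volterra (hk : ∀ x y, HasDerivAt (fun z => k z y) (k₁ x y) x)
    (ck : Continuous (uncurry k)) (ck₁ : Continuous (uncurry k₁)) (cp : Continuous p)
    (hs : HasDerivAt s (s' x) x) (hp : ∀ x ∈ Icc a b, p x = s x + ∫ y in x..b, k x y * p y)
    (hx : x ∈ Ioo a b) :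
    HasDerivAt p (s' x - k x x * p x + ∫ y in x..b, k₁ x y * p y) x := by
  have leibniz := hasDerivAt_integral_of_hasDerivAt_ends (h := fun x y => k x y * p y)
    (fun x y => (hk x y).mul_const (p y)) (by fun_prop) (by fun_prop) (hasDerivAt_id x)
    (hasDerivAt_const x b)
  refine ((hs.add leibniz).congr_of_eventuallyEq ?_).congr_deriv (by simp; ring)
  filter_upwards [Icc_mem_nhds hx.1 hx.2] with z hz using hp z hz

theorem hasDerivAt_deriv_of_backward_volterra
    (hk : ∀ x y, HasDerivAt (fun z => k z y) (k₁ x y) x)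
    (hk₁ : ∀ x y, HasDerivAt (fun z => k₁ z y) (k₁₁ x y) x) (ck : Continuous (uncurry k))
    (ck₁ : Continuous (uncurry k₁)) (ck₁₁ : Continuous (uncurry k₁₁)) (cp : Continuous p)
    (hs : ∀ x, HasDerivAt s (s' x) x) (hs' : HasDerivAt s' (s'' x) x)
    (hp : ∀ x ∈ Icc a b, p x = s x + ∫ y in x..b, k x y * p y)
    (hd : HasDerivAt (fun z => k z z) d x) (hx : x ∈ Ioo a b) :
    HasDerivAt (fun x => s' x - k x x * p x + ∫ y in x..b, k₁ x y * p y)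
      (s'' x - (d * p x + k x x * (s' x - k x x * p x + ∫ y in x..b, k₁ x y * p y))
        - k₁ x x * p x + ∫ y in x..b, k₁₁ x y * p y) x := by
  have leibniz := hasDerivAt_integral_of_hasDerivAt_ends (h := fun x y => k₁ x y * p y)
    (fun x y => (hk₁ x y).mul_const (p y)) (by fun_prop) (by fun_prop) (hasDerivAt_id x)
    (hasDerivAt_const x b)
  exact ((hs'.sub (hd.mul (hasDerivAt_of_backward_volterra hk ck ck₁ cp (hs x) hp hx))).add
    leibniz).congr_deriv (by simp; ring)

end VolterraRegularity

namespace IsObserverKernel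

variable {ε c : ℝ} {lam : ℝ → ℝ} {Φ : ℝ → ℝ → ℝ} {x y : ℝ}

theorem differentiableOn (hΦ : IsObserverKernel ε lam c Φ) :
    DifferentiableOn ℝ (uncurry Φ) triangle :=
  hΦ.regular.differentiableOn two_ne_zero

theorem contDiffOn_pdFst (hΦ : IsObserverKernel ε lam c Φ) :
    ContDiffOn ℝ 1 (uncurry (pdFst Φ)) triangle :=
  _root_.contDiffOn_pdFst (n := 1) hΦ.regular

theorem contDiffOn_pdSnd (hΦ : IsObserverKernel ε lam c Φ) :
    ContDiffOn ℝ 1 (uncurry (pdSnd Φ)) triangle :=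
  _root_.contDiffOn_pdSnd (n := 1) hΦ.regular

theorem pdFst_sub_pdSnd (hΦ : IsObserverKernel ε lam c Φ) (hy : 0 < y) (hyx : y < x)
    (hx : x < 1) :
    pdFst (pdFst Φ) x y - pdSnd (pdSnd Φ) x y = -((lam x + c) / ε) * Φ x y := by
  have fst : deriv (fun z => deriv (fun w => Φ w y) z) x = pdFst (pdFst Φ) x y := by
    refine (hasDerivAt_pdFst (hΦ.contDiffOn_pdFst.differentiableOn one_ne_zero) hy.le
      ⟨hyx, hx⟩).congr_of_eventuallyEq ?_ |>.deriv
    filter_upwards [Ioo_mem_nhds hyx hx] with z hz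
      using (hasDerivAt_pdFst hΦ.differentiableOn hy.le hz).deriv
  have snd : deriv (fun z => deriv (Φ x) z) y = pdSnd (pdSnd Φ) x y := by
    refine (hasDerivAt_pdSnd (hΦ.contDiffOn_pdSnd.differentiableOn one_ne_zero) hx.le
      ⟨hy, hyx⟩).congr_of_eventuallyEq ?_ |>.deriv
    filter_upwards [Ioo_mem_nhds hy hyx] with z hz
      using (hasDerivAt_pdSnd hΦ.differentiableOn hx.le hz).deriv
  rw [← fst, ← snd]
  exact hΦ.pde x y hy hyx hx

theorem hasDerivAt_diag (hΦ : IsObserverKernel ε lam c Φ) (hlam : ContinuousOn lam (Icc 0 1))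
    (hx : x ∈ Ioo 0 1) : HasDerivAt (fun z => Φ z z) ((lam x + c) / (2 * ε)) x := by
  have cont : ContinuousOn (fun z => (lam z + c) / (2 * ε)) (Icc 0 1) :=
    (hlam.add continuousOn_const).div_const _
  have int : IntervalIntegrable (fun z => (lam z + c) / (2 * ε)) volume x 1 :=
    (cont.mono (Icc_subset_Icc_left hx.1.le)).intervalIntegrable_of_Icc hx.2.le
  have ftc := (intervalIntegral.integral_hasDerivAt_left int
    ((cont.mono Ioo_subset_Icc_self).stronglyMeasurableAtFilter isOpen_Ioo x hx)
    (cont.continuousAt (Icc_mem_nhds hx.1 hx.2))).neg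
  rw [neg_neg] at ftc
  refine ftc.congr_of_eventuallyEq ?_
  filter_upwards [Icc_mem_nhds hx.1 hx.2] with z hz using hΦ.diag z hz

theorem pdFst_add_pdSnd_diag (hΦ : IsObserverKernel ε lam c Φ)
    (hlam : ContinuousOn lam (Icc 0 1)) (hx : x ∈ Ioo 0 1) :
    pdFst Φ x x + pdSnd Φ x x = (lam x + c) / (2 * ε) :=
  (hasDerivAt_diag_of_differentiableOn_triangle hΦ.differentiableOn hx).unique
    (hΦ.hasDerivAt_diag hlam hx)

theorem exists_extension (hΦ : IsObserverKernel ε lam c Φ) :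
    ∃ E E₂ E₂₂ : ℝ → ℝ → ℝ,
      Continuous (uncurry E) ∧ Continuous (uncurry E₂) ∧ Continuous (uncurry E₂₂) ∧
      (∀ x y, HasDerivAt (E x) (E₂ x y) y) ∧ (∀ x y, HasDerivAt (E₂ x) (E₂₂ x y) y) ∧
      ∀ x y, (x, y) ∈ triangle →
        E x y = Φ x y ∧ E₂ x y = pdSnd Φ x y ∧ E₂₂ x y = pdSnd (pdSnd Φ) x y := by
  let E₂₂ : ℝ → ℝ → ℝ := fun x y => (uncurry (pdSnd (pdSnd Φ)) ∘ triangleRetract) (x, y)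
  have cE₂₂ : Continuous (uncurry E₂₂) := continuous_comp_triangleRetract
    (_root_.contDiffOn_pdSnd (n := 0) hΦ.contDiffOn_pdSnd).continuousOn
  have hE₂₂ : ∀ x y, (x, y) ∈ triangle → E₂₂ x y = pdSnd (pdSnd Φ) x y := fun x y h => by
    simp only [E₂₂, Function.comp, triangleRetract_of_mem h, uncurry]
  obtain ⟨E₂, cE₂, hE₂, hE₂'⟩ := exists_extension_of_pdSnd
    (hΦ.contDiffOn_pdSnd.differentiableOn one_ne_zero) cE₂₂ hE₂₂
  obtain ⟨E, cE, hE, hE'⟩ := exists_extension_of_pdSnd hΦ.differentiableOn cE₂ hE₂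
  exact ⟨E, E₂, E₂₂, cE, cE₂, cE₂₂, hE', hE₂',
    fun x y h => ⟨hE x y h, hE₂ x y h, hE₂₂ x y h⟩⟩

variable {p p' p'' : ℝ → ℝ}

theorem integral_parts (hΦ : IsObserverKernel ε lam c Φ) (cp : ContinuousOn p (Icc 0 1))
    (cp' : ContinuousOn p' (Icc 0 1)) (cp'' : ContinuousOn p'' (Icc 0 1))
    (hp : ∀ x ∈ Ioo (0 : ℝ) 1, HasDerivAt p (p' x) x)
    (hp' : ∀ x ∈ Ioo (0 : ℝ) 1, HasDerivAt p' (p'' x) x) (p_one : p 1 = 0) (hx : x ∈ Icc 0 1) :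
    ∫ y in x..1, (Φ y x * p'' y - pdFst (pdFst Φ) y x * p y)
      = pdFst Φ x x * p x - Φ x x * p' x := by
  have sub : Icc x 1 ⊆ Icc (0 : ℝ) 1 := Icc_subset_Icc_left hx.1
  have cΦ := continuousOn_triangle_column hΦ.regular.continuousOn hx.1
  have cΦ₁ := continuousOn_triangle_column hΦ.contDiffOn_pdFst.continuousOn hx.1
  have cΦ₁₁ := continuousOn_triangle_column
    (_root_.contDiffOn_pdFst (n := 0) hΦ.contDiffOn_pdFst).continuousOn hx.1
  have green := intervalIntegral.integral_eq_sub_of_hasDerivAt_of_le hx.2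
    (f := fun y => Φ y x * p' y - pdFst Φ y x * p y)
    (f' := fun y => Φ y x * p'' y - pdFst (pdFst Φ) y x * p y)
    ((cΦ.mul (cp'.mono sub)).sub (cΦ₁.mul (cp.mono sub)))
    (fun y hy => by
      have hy01 : y ∈ Ioo (0 : ℝ) 1 := ⟨hx.1.trans_lt hy.1, hy.2⟩
      have dΦ := hasDerivAt_pdFst hΦ.differentiableOn hx.1 hy
      have dΦ₁ := hasDerivAt_pdFst (hΦ.contDiffOn_pdFst.differentiableOn one_ne_zero) hx.1 hy
      exact ((dΦ.mul (hp' y hy01)).sub (dΦ₁.mul (hp y hy01))).congr_deriv (by ring))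
    (((cΦ.mul (cp''.mono sub)).sub (cΦ₁₁.mul (cp.mono sub))).intervalIntegrable_of_Icc hx.2)
  rw [green, hΦ.side x hx, p_one]
  ring

theorem integral_pdSnd_pdSnd_mul (hΦ : IsObserverKernel ε lam c Φ) (hε : ε ≠ 0)
    (hlam : ContinuousOn lam (Icc 0 1)) (cp : ContinuousOn p (Icc 0 1))
    (cp' : ContinuousOn p' (Icc 0 1)) (cp'' : ContinuousOn p'' (Icc 0 1))
    (hp : ∀ x ∈ Ioo (0 : ℝ) 1, HasDerivAt p (p' x) x)
    (hp' : ∀ x ∈ Ioo (0 : ℝ) 1, HasDerivAt p' (p'' x) x) (p_one : p 1 = 0) (hx : x ∈ Ioo 0 1) :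
    ε * ∫ y in x..1, pdSnd (pdSnd Φ) y x * p y
      = (∫ y in x..1, Φ y x * (ε * p'' y + (lam y + c) * p y))
        - ε * (pdFst Φ x x * p x - Φ x x * p' x) := by
  have sub : Icc x 1 ⊆ Icc (0 : ℝ) 1 := Icc_subset_Icc_left hx.1.le
  have cΦ := continuousOn_triangle_column hΦ.regular.continuousOn hx.1.le
  have cΦ₁₁ := continuousOn_triangle_column
    (_root_.contDiffOn_pdFst (n := 0) hΦ.contDiffOn_pdFst).continuousOn hx.1.le
  rw [← hΦ.integral_parts cp cp' cp'' hp hp' p_one (Ioo_subset_Icc_self hx),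
    ← intervalIntegral.integral_const_mul, ← intervalIntegral.integral_const_mul,
    ← intervalIntegral.integral_sub]
  · refine intervalIntegral.integral_congr_Ioo_of_le hx.2.le fun y hy => ?_
    have wave : pdSnd (pdSnd Φ) y x = pdFst (pdFst Φ) y x + (lam y + c) / ε * Φ y x := by
      linarith [hΦ.pdFst_sub_pdSnd hx.1 hy.1 hy.2]
    rw [wave]
    field_simp
    ring
  · exact (cΦ.mul ((continuousOn_const.mul (cp''.mono sub)).add
      (((hlam.mono sub).add continuousOn_const).mul (cp.mono sub)))).intervalIntegrable_of_Icc
        hx.2.le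
  · exact (continuousOn_const.mul ((cΦ.mul (cp''.mono sub)).sub
      (cΦ₁₁.mul (cp.mono sub)))).intervalIntegrable_of_Icc hx.2.le

-- The kernel equations say that `T p = p - ∫_x^1 Φ(y,x) p(y) dy` intertwines the operators
-- `ε ∂² + λ + c` and `ε ∂²`.
theorem backstepping_intertwines {s'' : ℝ → ℝ} (hΦ : IsObserverKernel ε lam c Φ) (hε : ε ≠ 0)
    (hlam : ContinuousOn lam (Icc 0 1)) (cp : ContinuousOn p (Icc 0 1))
    (cp' : ContinuousOn p' (Icc 0 1)) (cp'' : ContinuousOn p'' (Icc 0 1))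
    (hp : ∀ x ∈ Ioo (0 : ℝ) 1, HasDerivAt p (p' x) x)
    (hp' : ∀ x ∈ Ioo (0 : ℝ) 1, HasDerivAt p' (p'' x) x) (p_one : p 1 = 0)
    (hp'' : ∀ x ∈ Ioo (0 : ℝ) 1, p'' x = s'' x - ((lam x + c) / (2 * ε) * p x + Φ x x * p' x)
      - pdSnd Φ x x * p x + ∫ y in x..1, pdSnd (pdSnd Φ) y x * p y) (hx : x ∈ Ioo 0 1) :
    ε * s'' x = (ε * p'' x + (lam x + c) * p x)
      - ∫ y in x..1, Φ y x * (ε * p'' y + (lam y + c) * p y) := by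
  have parts := hΦ.integral_pdSnd_pdSnd_mul hε hlam cp cp' cp'' hp hp' p_one hx
  have diag := hΦ.pdFst_add_pdSnd_diag hlam hx
  have diffusion : ε * ((lam x + c) / (2 * ε)) = (lam x + c) / 2 := by field_simp
  linear_combination -ε * hp'' x hx - parts + ε * p x * diag + 2 * p x * diffusion

theorem exists_smooth_backward_volterra_solution (hΦ : IsObserverKernel ε lam c Φ)
    (hlam : ContinuousOn lam (Icc 0 1)) {s s' s'' : ℝ → ℝ} (hs : ∀ x, HasDerivAt s (s' x) x)
    (hs' : ∀ x, HasDerivAt s' (s'' x) x) (cs'' : Continuous s'') :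
    ∃ p p' p'' : ℝ → ℝ, Continuous p ∧ Continuous p' ∧ Continuous p'' ∧
      (∀ x ∈ Ioo (0 : ℝ) 1, HasDerivAt p (p' x) x) ∧
      (∀ x ∈ Ioo (0 : ℝ) 1, HasDerivAt p' (p'' x) x) ∧
      (∀ x ∈ Icc (0 : ℝ) 1, p x = s x + ∫ y in x..1, Φ y x * p y) ∧
      ∀ x ∈ Ioo (0 : ℝ) 1, p'' x = s'' x - ((lam x + c) / (2 * ε) * p x + Φ x x * p' x)
        - pdSnd Φ x x * p x + ∫ y in x..1, pdSnd (pdSnd Φ) y x * p y := by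
  obtain ⟨E, E₂, E₂₂, cE, cE₂, cE₂₂, hE, hE₂, eqE⟩ := hΦ.exists_extension
  obtain ⟨l, cl, hl⟩ := exists_continuous_extension_Icc zero_le_one hlam
  have cs : Continuous s := continuous_iff_continuousAt.2 fun x => (hs x).continuousAt
  have cs' : Continuous s' := continuous_iff_continuousAt.2 fun x => (hs' x).continuousAt
  obtain ⟨p, cp, hp⟩ := exists_backward_volterra_solution (k := fun x y => E y x) (by fun_prop)
    zero_le_one cs.continuousOn
  have integral_eq : ∀ {f g : ℝ → ℝ → ℝ} (x), 0 ≤ x → x ≤ 1 →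
      (∀ y, (y, x) ∈ triangle → f y x = g y x) →
      ∫ y in x..1, f y x * p y = ∫ y in x..1, g y x * p y := fun x h0 h1 hfg =>
    intervalIntegral.integral_congr fun y hy => by
      rw [uIcc_of_le h1] at hy
      simp only [hfg y ⟨h0, hy.1, hy.2⟩]
  have cont_integral : ∀ {f : ℝ → ℝ → ℝ}, Continuous (uncurry f) →
      Continuous fun x => ∫ y in x..1, f y x * p y := fun cf =>
    continuous_integral_of_continuous_ends (by fun_prop) continuous_id continuous_const
  set p' : ℝ → ℝ := fun x => s' x - E x x * p x + ∫ y in x..1, E₂ y x * p y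
  have cp' : Continuous p' := by have := cont_integral cE₂; fun_prop
  refine ⟨p, p', fun x => s'' x - ((l x + c) / (2 * ε) * p x + E x x * p' x)
    - E₂ x x * p x + ∫ y in x..1, E₂₂ y x * p y, cp, cp', ?_, fun x hx => ?_, fun x hx => ?_,
    fun x hx => ?_, fun x hx => ?_⟩
  · have := cont_integral cE₂₂
    fun_prop
  · exact hasDerivAt_of_backward_volterra (k := fun x y => E y x) (fun x y => hE y x) (by fun_prop)
      (by fun_prop) cp (hs x) hp hx
  · have diag : HasDerivAt (fun z => E z z) ((l x + c) / (2 * ε)) x := by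
      rw [hl (Ioo_subset_Icc_self hx)]
      refine (hΦ.hasDerivAt_diag hlam hx).congr_of_eventuallyEq ?_
      filter_upwards [Icc_mem_nhds hx.1 hx.2] with z hz using (eqE z z ⟨hz.1, le_rfl, hz.2⟩).1
    exact hasDerivAt_deriv_of_backward_volterra (k := fun x y => E y x) (fun x y => hE y x)
      (fun x y => hE₂ y x) (by fun_prop) (by fun_prop) (by fun_prop) cp hs (hs' x) hp diag hx
  · rw [hp x hx, integral_eq x hx.1 hx.2 fun y hy => (eqE y x hy).1]
  · obtain ⟨diag, diag₂, -⟩ := eqE x x ⟨hx.1.le, le_rfl, hx.2.le⟩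
    simp only [hl (Ioo_subset_Icc_self hx), diag, diag₂,
      integral_eq x hx.1.le hx.2.le fun y hy => (eqE y x hy).2.2]

theorem eq_zero_of_eq_integral (hΦ : IsObserverKernel ε lam c Φ) {r : ℝ → ℝ}
    (cr : ContinuousOn r (Icc 0 1)) (hr : ∀ x ∈ Ioo (0 : ℝ) 1, r x = ∫ y in x..1, Φ y x * r y) :
    ∀ x ∈ Icc (0 : ℝ) 1, r x = 0 := by
  obtain ⟨E, _, _, cE, _, _, _, _, eqE⟩ := hΦ.exists_extension
  obtain ⟨q, cq, hq⟩ := exists_continuous_extension_Icc zero_le_one cr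
  have interior : EqOn q (fun x => ∫ y in x..1, E y x * q y) (Ioo 0 1) := fun x hx => by
    rw [hq (Ioo_subset_Icc_self hx), hr x hx]
    refine intervalIntegral.integral_congr fun y hy => ?_
    rw [uIcc_of_le hx.2.le] at hy
    simp only [(eqE y x ⟨hx.1.le, hy.1, hy.2⟩).1, hq ⟨hx.1.le.trans hy.1, hy.2⟩]
  have closure := interior.closure cq (continuous_integral_of_continuous_ends (by fun_prop)
    continuous_id continuous_const)
  rw [closure_Ioo zero_ne_one] at closure
  exact fun x hx => (hq hx).symm.trans
    (eq_zero_of_backward_volterra (k := fun x y => E y x) (by fun_prop) cq closure x hx)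

theorem exists_adjointEigenfunction (hΦ : IsObserverKernel ε lam c Φ) (hε : ε ≠ 0)
    (hlam : ContinuousOn lam (Icc 0 1)) {s s' : ℝ → ℝ} {κ : ℝ} (hs : ∀ x, HasDerivAt s (s' x) x)
    (hs' : ∀ x, HasDerivAt s' (-κ * s x) x) (s_zero : s 0 = 0) (s_one : s 1 = 0) :
    ∃ p p' p'' : ℝ → ℝ,
      IsAdjointEigenfunction ε lam (observerGain ε Φ) (c + ε * κ) p p' p'' ∧
      ∀ x ∈ Icc (0 : ℝ) 1, s x = p x - ∫ y in x..1, Φ y x * p y := by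
  have cs : Continuous s := continuous_iff_continuousAt.2 fun x => (hs x).continuousAt
  obtain ⟨p, p', p'', cp, cp', cp'', hp, hp', hps, hp''⟩ :=
    hΦ.exists_smooth_backward_volterra_solution hlam hs hs' (by fun_prop)
  have p_one : p 1 = 0 := by simp [hps 1 (right_mem_Icc.2 zero_le_one), s_one]
  set r : ℝ → ℝ := fun x => ε * p'' x + (lam x + c) * p x + ε * κ * p x
  have hr : ∀ x ∈ Ioo (0 : ℝ) 1, r x = ∫ y in x..1, Φ y x * r y := fun x hx => by
    have cΦ := continuousOn_triangle_column hΦ.regular.continuousOn hx.1.le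
    have clam : ContinuousOn lam (Icc x 1) := hlam.mono (Icc_subset_Icc_left hx.1.le)
    have intertwine := hΦ.backstepping_intertwines (s'' := fun x => -κ * s x) hε hlam
      cp.continuousOn cp'.continuousOn cp''.continuousOn hp hp' p_one hp'' hx
    have split : ∫ y in x..1, Φ y x * r y
        = (∫ y in x..1, Φ y x * (ε * p'' y + (lam y + c) * p y))
          + ε * κ * ∫ y in x..1, Φ y x * p y := by
      rw [← intervalIntegral.integral_const_mul, ← intervalIntegral.integral_add]
      · simp only [r, mul_add, mul_left_comm]
      all_goals exact ContinuousOn.intervalIntegrable_of_Icc hx.2.le (by fun_prop)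
    linear_combination -intertwine - split + ε * κ * hps x (Ioo_subset_Icc_self hx)
  have r_zero := hΦ.eq_zero_of_eq_integral (by fun_prop) hr
  refine ⟨p, p', p'', ⟨cp, cp', cp'', hp, hp', fun x hx => ?_, ?_, p_one⟩,
    fun x hx => by linarith [hps x hx]⟩
  · linear_combination r_zero x (Ioo_subset_Icc_self hx)
  · simp only [observerGain, mul_assoc, intervalIntegral.integral_const_mul,
      hps 0 (left_mem_Icc.2 zero_le_one), s_zero, zero_add]

end IsObserverKernel

/-! ### The error system -/

theorem continuousOn_slice {f : ℝ → ℝ → ℝ} {I T : Set ℝ}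
    (hf : ContinuousOn (fun p : ℝ × ℝ => f p.1 p.2) (I ×ˢ T)) {t : ℝ} (ht : t ∈ T) :
    ContinuousOn (fun x => f x t) I :=
  hf.comp (f := fun x => (x, t)) (by fun_prop) fun _ hx => ⟨hx, ht⟩

/-- Classical solutions `e`, with derivatives `ex`, `exx`, `et`, of the observer error system
`eₜ = ε eₓₓ + λ e - φ eₓ(0,t)`, `e(0,t) = e(1,t) = 0`, on `[0,1]` for `t > t₀`. As for the
estimators, `eₓ` need not extend continuously to `x = 1`. -/
structure IsErrorSystem (ε : ℝ) (lam φ : ℝ → ℝ) (t₀ : ℝ) (e ex exx et : ℝ → ℝ → ℝ) : Prop where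
  cont : ContinuousOn (uncurry e) (Icc 0 1 ×ˢ Ioi t₀)
  cont_x : ContinuousOn (uncurry ex) (Ico 0 1 ×ˢ Ioi t₀)
  cont_xx : ContinuousOn (uncurry exx) (Ioo 0 1 ×ˢ Ioi t₀)
  cont_t : ContinuousOn (uncurry et) (Ioo 0 1 ×ˢ Ioi t₀)
  deriv_x : ∀ x ∈ Ioo (0 : ℝ) 1, ∀ t > t₀, HasDerivAt (fun z => e z t) (ex x t) x
  deriv_xx : ∀ x ∈ Ioo (0 : ℝ) 1, ∀ t > t₀, HasDerivAt (fun z => ex z t) (exx x t) x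
  deriv_t : ∀ x ∈ Ioo (0 : ℝ) 1, ∀ t > t₀, HasDerivAt (fun s => e x s) (et x t) t
  pde : ∀ x ∈ Ioo (0 : ℝ) 1, ∀ t > t₀,
    et x t = ε * exx x t + lam x * e x t - φ x * ex 0 t
  left : ∀ t > t₀, e 0 t = 0
  right : ∀ t > t₀, e 1 t = 0

/-- The time derivative of `∫_a^b e(x,t) (p(x) - p(b)) dx` for an error system `e` and an adjoint
eigenfunction `p`, after integration by parts. Subtracting `p(b)` removes the boundary term with
`eₓ(b,t)`, which may have no limit as `b → 1`. -/
noncomputable def truncatedRate (ε μ : ℝ) (lam φ p p' : ℝ → ℝ) (e ex : ℝ → ℝ → ℝ) (a b t : ℝ) : ℝ :=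
  ε * (e a t * p' a - e b t * p' b - ex a t * (p a - p b)) - μ * (∫ x in a..b, e x t * p x)
    - p b * (∫ x in a..b, lam x * e x t) - ex 0 t * ∫ x in a..b, φ x * (p x - p b)

theorem continuous_truncatedRate {ε μ : ℝ} {lam φ p p' : ℝ → ℝ} {e ex : ℝ → ℝ → ℝ}
    (clam : Continuous lam) (cφ : Continuous φ) (cp : Continuous p) (cp' : Continuous p')
    (ce : Continuous (uncurry e)) (cex : Continuous (uncurry ex)) :
    Continuous fun z : (ℝ × ℝ) × ℝ => truncatedRate ε μ lam φ p p' e ex z.1.1 z.1.2 z.2 := by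
  have integral_e_p : Continuous fun z : (ℝ × ℝ) × ℝ => ∫ x in z.1.1..z.1.2, e x z.2 * p x :=
    continuous_integral_of_continuous_ends (h := fun (z : (ℝ × ℝ) × ℝ) x => e x z.2 * p x)
      (by fun_prop) (by fun_prop) (by fun_prop)
  have integral_lam_e : Continuous fun z : (ℝ × ℝ) × ℝ =>
      ∫ x in z.1.1..z.1.2, lam x * e x z.2 :=
    continuous_integral_of_continuous_ends (h := fun (z : (ℝ × ℝ) × ℝ) x => lam x * e x z.2)
      (by fun_prop) (by fun_prop) (by fun_prop)
  have integral_φ : Continuous fun z : (ℝ × ℝ) × ℝ =>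
      ∫ x in z.1.1..z.1.2, φ x * (p x - p z.1.2) :=
    continuous_integral_of_continuous_ends
      (h := fun (z : (ℝ × ℝ) × ℝ) x => φ x * (p x - p z.1.2))
      (by fun_prop) (by fun_prop) (by fun_prop)
  unfold truncatedRate
  fun_prop

theorem truncatedRate_congr {ε μ a b t : ℝ} {lam φ p p' : ℝ → ℝ} {e ex : ℝ → ℝ → ℝ}
    {lam₁ φ₁ : ℝ → ℝ} {e₁ ex₁ : ℝ → ℝ → ℝ} (hab : a ≤ b) (hlam : EqOn lam lam₁ (Icc a b))
    (hφ : EqOn φ φ₁ (Icc a b)) (he : ∀ x ∈ Icc a b, e x t = e₁ x t) (hexa : ex a t = ex₁ a t)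
    (hex0 : ex 0 t = ex₁ 0 t) :
    truncatedRate ε μ lam φ p p' e ex a b t = truncatedRate ε μ lam₁ φ₁ p p' e₁ ex₁ a b t := by
  have integral_e_p : ∫ x in a..b, e x t * p x = ∫ x in a..b, e₁ x t * p x :=
    intervalIntegral.integral_congr (uIcc_of_le hab ▸ fun x hx => by simp only [he x hx])
  have integral_lam_e : ∫ x in a..b, lam x * e x t = ∫ x in a..b, lam₁ x * e₁ x t :=
    intervalIntegral.integral_congr (uIcc_of_le hab ▸ fun x hx => by simp only [he x hx, hlam hx])
  have integral_φ : ∫ x in a..b, φ x * (p x - p b) = ∫ x in a..b, φ₁ x * (p x - p b) :=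
    intervalIntegral.integral_congr (uIcc_of_le hab ▸ fun x hx => by simp only [hφ hx])
  unfold truncatedRate
  rw [integral_e_p, integral_lam_e, integral_φ, he a (left_mem_Icc.2 hab),
    he b (right_mem_Icc.2 hab), hexa, hex0]

theorem exists_continuous_extension_rect {f : ℝ → ℝ → ℝ} {a b c d : ℝ} (hab : a ≤ b) (hcd : c ≤ d)
    (hf : ContinuousOn (uncurry f) (Icc a b ×ˢ Icc c d)) :
    ∃ g : ℝ → ℝ → ℝ, Continuous (uncurry g) ∧ ∀ x ∈ Icc a b, ∀ t ∈ Icc c d, g x t = f x t := by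
  refine ⟨fun x t => f (projIcc a b hab x) (projIcc c d hcd t), ?_, fun x hx t ht => ?_⟩
  · exact hf.comp_continuous (f := fun z : ℝ × ℝ =>
      ((projIcc a b hab z.1 : ℝ), (projIcc c d hcd z.2 : ℝ))) (by fun_prop)
      fun z => ⟨Subtype.coe_prop _, Subtype.coe_prop _⟩
  · simp only [projIcc_of_mem hab hx, projIcc_of_mem hcd ht]

theorem integral_sub_eq_integral_integral {f f' : ℝ → ℝ → ℝ} {g : ℝ → ℝ} {a b c d : ℝ}
    (hab : a ≤ b) (hcd : c ≤ d) (cg : Continuous g)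
    (cf' : ContinuousOn (uncurry f') (Icc a b ×ˢ Icc c d))
    (hf : ∀ x ∈ Icc a b, ∀ t ∈ Icc c d, HasDerivAt (f x) (f' x t) t) :
    ∫ x in a..b, (f x d - f x c) * g x = ∫ t in c..d, ∫ x in a..b, f' x t * g x := by
  have integrable : IntegrableOn (uncurry fun x t => f' x t * g x) (Icc a b ×ˢ Icc c d) :=
    (cf'.mul (by fun_prop)).integrableOn_compact (isCompact_Icc.prod isCompact_Icc)
  rw [← uIcc_of_le hab, ← uIcc_of_le hcd] at integrable
  rw [← intervalIntegral_intervalIntegral_swap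
    (integrable.mono_set (prod_mono uIoc_subset_uIcc uIoc_subset_uIcc))]
  refine intervalIntegral.integral_congr (uIcc_of_le hab ▸ fun x hx => ?_)
  have cf'x : ContinuousOn (f' x) (Icc c d) :=
    cf'.comp (f := fun t => (x, t)) (by fun_prop) fun t ht => ⟨hx, ht⟩
  have ftc : ∫ t in c..d, f' x t = f x d - f x c :=
    intervalIntegral.integral_eq_sub_of_hasDerivAt (uIcc_of_le hcd ▸ hf x hx)
      (cf'x.intervalIntegrable_of_Icc hcd)
  simp only [intervalIntegral.integral_mul_const, ftc]

theorem eq_zero_one_of_forall_eq_one_sub {F G : ℝ × ℝ → ℝ} (cF : Continuous F) (cG : Continuous G)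
    (h : ∀ δ ∈ Ioo (0 : ℝ) (1 / 2), F (δ, 1 - δ) = G (δ, 1 - δ)) : F (0, 1) = G (0, 1) := by
  have closed := (show EqOn (fun δ => F (δ, 1 - δ)) (fun δ => G (δ, 1 - δ)) (Ioo 0 (1 / 2))
    from h).closure (by fun_prop) (by fun_prop)
  rw [closure_Ioo one_half_pos.ne] at closed
  simpa using closed (left_mem_Icc.2 one_half_pos.le)

theorem eq_exp_mul_of_sub_eq_integral {W : ℝ → ℝ} {μ a b : ℝ} (hab : a ≤ b) (cW : Continuous W)
    (hW : ∀ t ∈ Icc a b, W t - W a = -μ * ∫ s in a..t, W s) :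
    W b = Real.exp (-μ * (b - a)) * W a := by
  set V : ℝ → ℝ := fun t => W a + -μ * ∫ s in a..t, W s
  have V_eq : ∀ t ∈ Icc a b, V t = W t := fun t ht => by linarith [hW t ht]
  have deriv_V : ∀ t, HasDerivAt V (-μ * W t) t := fun t =>
    ((hasDerivAt_integral_upper cW a t).const_mul (-μ)).const_add _
  have deriv_exp : ∀ t, HasDerivAt (fun t => Real.exp (μ * (t - a)))
      (Real.exp (μ * (t - a)) * μ) t := fun t => by
    simpa using! (((hasDerivAt_id t).sub_const a).const_mul μ).exp
  have deriv_prod := fun t => (deriv_exp t).mul (deriv_V t)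
  have const := constant_of_has_deriv_right_zero (a := a) (b := b)
    (fun t _ => (deriv_prod t).continuousAt.continuousWithinAt)
    (fun t ht => (deriv_prod t).hasDerivWithinAt.congr_deriv (by
      rw [V_eq t (Ico_subset_Icc_self ht)]; ring)) b (right_mem_Icc.2 hab)
  simp only [Pi.mul_apply, sub_self, mul_zero, Real.exp_zero, one_mul,
    V_eq a (left_mem_Icc.2 hab), V_eq b (right_mem_Icc.2 hab)] at const
  rw [← const, ← mul_assoc, ← Real.exp_add, neg_mul, neg_add_cancel, Real.exp_zero, one_mul]

namespace IsErrorSystem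

variable {ε μ t₀ : ℝ} {lam φ p p' p'' : ℝ → ℝ} {e ex exx et : ℝ → ℝ → ℝ}

theorem integral_second_deriv_mul (h : IsErrorSystem ε lam φ t₀ e ex exx et)
    (cp : Continuous p) (cp'' : Continuous p'')
    (hp : ∀ x ∈ Ioo (0 : ℝ) 1, HasDerivAt p (p' x) x)
    (hp' : ∀ x ∈ Ioo (0 : ℝ) 1, HasDerivAt p' (p'' x) x)
    {a b t : ℝ} (ha : 0 < a) (hab : a ≤ b) (hb : b < 1) (ht : t₀ < t) :
    ∫ x in a..b, exx x t * (p x - p b)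
      = e a t * p' a - e b t * p' b - ex a t * (p a - p b) + ∫ x in a..b, e x t * p'' x := by
  have sub : Icc a b ⊆ Ioo (0 : ℝ) 1 := fun x hx => ⟨ha.trans_le hx.1, hx.2.trans_lt hb⟩
  have ce : ContinuousOn (fun x => e x t) (Icc a b) :=
    (continuousOn_slice h.cont ht).mono (sub.trans Ioo_subset_Icc_self)
  have cexx : ContinuousOn (fun x => exx x t) (Icc a b) :=
    (continuousOn_slice h.cont_xx ht).mono sub
  have exx_p : IntervalIntegrable (fun x => exx x t * (p x - p b)) volume a b :=
    (cexx.mul (by fun_prop)).intervalIntegrable_of_Icc hab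
  have e_p'' : IntervalIntegrable (fun x => e x t * p'' x) volume a b :=
    (ce.mul cp''.continuousOn).intervalIntegrable_of_Icc hab
  have green : ∀ x ∈ uIcc a b, HasDerivAt (fun x => ex x t * (p x - p b) - e x t * p' x)
      (exx x t * (p x - p b) - e x t * p'' x) x := uIcc_of_le hab ▸ fun x hx =>
    (((h.deriv_xx x (sub hx) t ht).mul ((hp x (sub hx)).sub_const (p b))).sub
      ((h.deriv_x x (sub hx) t ht).mul (hp' x (sub hx)))).congr_deriv (by ring)
  have parts := intervalIntegral.integral_eq_sub_of_hasDerivAt green (exx_p.sub e_p'')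
  rw [intervalIntegral.integral_sub exx_p e_p''] at parts
  linear_combination parts

theorem integral_time_deriv (h : IsErrorSystem ε lam φ t₀ e ex exx et)
    (hlam : ContinuousOn lam (Icc 0 1)) (hφ : ContinuousOn φ (Icc 0 1))
    (hp : IsAdjointEigenfunction ε lam φ μ p p' p'')
    {a b t : ℝ} (ha : 0 < a) (hab : a ≤ b) (hb : b < 1) (ht : t₀ < t) :
    ∫ x in a..b, et x t * (p x - p b) = truncatedRate ε μ lam φ p p' e ex a b t := by
  have sub : Icc a b ⊆ Ioo (0 : ℝ) 1 := fun x hx => ⟨ha.trans_le hx.1, hx.2.trans_lt hb⟩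
  have sub' : Icc a b ⊆ Icc (0 : ℝ) 1 := sub.trans Ioo_subset_Icc_self
  have ce : ContinuousOn (fun x => e x t) (Icc a b) :=
    (continuousOn_slice h.cont ht).mono sub'
  have cexx : ContinuousOn (fun x => exx x t) (Icc a b) :=
    (continuousOn_slice h.cont_xx ht).mono sub
  have cp := hp.cont
  have cp'' := hp.cont_deriv₂
  have integrable : ∀ {f : ℝ → ℝ}, ContinuousOn f (Icc a b) → IntervalIntegrable f volume a b :=
    fun cf => cf.intervalIntegrable_of_Icc hab
  have i_exx : IntervalIntegrable (fun x => ε * (exx x t * (p x - p b))) volume a b :=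
    integrable (by fun_prop)
  have i_e_p'' : IntervalIntegrable (fun x => ε * (e x t * p'' x)) volume a b :=
    integrable (by fun_prop)
  have i_e_p : IntervalIntegrable (fun x => μ * (e x t * p x)) volume a b :=
    integrable (by fun_prop)
  have i_lam_e : IntervalIntegrable (fun x => p b * (lam x * e x t)) volume a b :=
    integrable (continuousOn_const.mul ((hlam.mono sub').mul ce))
  have i_φ : IntervalIntegrable (fun x => ex 0 t * (φ x * (p x - p b))) volume a b :=
    integrable (continuousOn_const.mul ((hφ.mono sub').mul (by fun_prop)))
  have weak_form : ∫ x in a..b, et x t * (p x - p b)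
      = ε * (∫ x in a..b, exx x t * (p x - p b)) - ε * (∫ x in a..b, e x t * p'' x)
        - μ * (∫ x in a..b, e x t * p x) - p b * (∫ x in a..b, lam x * e x t)
        - ex 0 t * ∫ x in a..b, φ x * (p x - p b) := by
    simp only [← intervalIntegral.integral_const_mul]
    rw [← intervalIntegral.integral_sub i_exx i_e_p'',
      ← intervalIntegral.integral_sub (i_exx.sub i_e_p'') i_e_p,
      ← intervalIntegral.integral_sub ((i_exx.sub i_e_p'').sub i_e_p) i_lam_e,
      ← intervalIntegral.integral_sub (((i_exx.sub i_e_p'').sub i_e_p).sub i_lam_e) i_φ]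
    refine intervalIntegral.integral_congr (uIcc_of_le hab ▸ fun x hx => ?_)
    linear_combination (p x - p b) * h.pde x (sub hx) t ht + e x t * hp.ode x (sub hx)
  rw [weak_form,
    h.integral_second_deriv_mul cp cp'' hp.hasDerivAt hp.hasDerivAt_deriv ha hab hb ht]
  unfold truncatedRate
  ring

theorem integral_sub_eq_integral_truncatedRate (h : IsErrorSystem ε lam φ t₀ e ex exx et)
    (hlam : ContinuousOn lam (Icc 0 1)) (hφ : ContinuousOn φ (Icc 0 1))
    (hp : IsAdjointEigenfunction ε lam φ μ p p' p'')
    {a b τ₁ τ₂ : ℝ} (ha : 0 < a) (hab : a ≤ b) (hb : b < 1) (h₁ : t₀ < τ₁) (h₂ : τ₁ ≤ τ₂) :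
    ∫ x in a..b, (e x τ₂ - e x τ₁) * (p x - p b)
      = ∫ t in τ₁..τ₂, truncatedRate ε μ lam φ p p' e ex a b t := by
  have sub : Icc a b ⊆ Ioo (0 : ℝ) 1 := fun x hx => ⟨ha.trans_le hx.1, hx.2.trans_lt hb⟩
  have hI : Icc τ₁ τ₂ ⊆ Ioi t₀ := fun t ht => h₁.trans_le ht.1
  rw [integral_sub_eq_integral_integral hab h₂ (g := fun x => p x - p b)
    (hp.cont.sub continuous_const)
    (h.cont_t.mono (prod_mono sub hI)) fun x hx t ht => h.deriv_t x (sub hx) t (hI ht)]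
  exact intervalIntegral.integral_congr (uIcc_of_le h₂ ▸ fun t ht =>
    h.integral_time_deriv hlam hφ hp ha hab hb (hI ht))

theorem truncatedRate_zero_one (h : IsErrorSystem ε lam φ t₀ e ex exx et)
    (hp : IsAdjointEigenfunction ε lam φ μ p p' p'') {t : ℝ} (ht : t₀ < t) :
    truncatedRate ε μ lam φ p p' e ex 0 1 t = -μ * ∫ x in (0 : ℝ)..1, e x t * p x := by
  simp only [truncatedRate, h.left t ht, h.right t ht, hp.right, sub_zero, hp.left]
  ring

theorem integral_sub_eq_integral_truncatedRate_zero_one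
    (h : IsErrorSystem ε lam φ t₀ e ex exx et)
    (hlam : ContinuousOn lam (Icc 0 1)) (hφ : ContinuousOn φ (Icc 0 1))
    (hp : IsAdjointEigenfunction ε lam φ μ p p' p'')
    {τ₁ τ₂ : ℝ} (h₁ : t₀ < τ₁) (h₂ : τ₁ ≤ τ₂) :
    ∫ x in (0 : ℝ)..1, (e x τ₂ - e x τ₁) * (p x - p 1)
      = ∫ t in τ₁..τ₂, truncatedRate ε μ lam φ p p' e ex 0 1 t := by
  have hI : Icc τ₁ τ₂ ⊆ Ioi t₀ := fun t ht => h₁.trans_le ht.1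
  have cp := hp.cont
  obtain ⟨E, cE, hE⟩ := exists_continuous_extension_rect zero_le_one h₂
    (h.cont.mono (prod_mono_right hI))
  obtain ⟨D, cD, hD⟩ := exists_continuous_extension_rect one_half_pos.le h₂
    (h.cont_x.mono (prod_mono (Icc_subset_Ico_right one_half_lt_one) hI))
  obtain ⟨l, cl, hl⟩ := exists_continuous_extension_Icc zero_le_one hlam
  obtain ⟨f, cf, hf⟩ := exists_continuous_extension_Icc zero_le_one hφ
  set increment : ℝ × ℝ → ℝ := fun z => ∫ x in z.1..z.2, (E x τ₂ - E x τ₁) * (p x - p z.2)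
  set integralRate : ℝ × ℝ → ℝ := fun z =>
    ∫ t in τ₁..τ₂, truncatedRate ε μ l f p p' E D z.1 z.2 t
  have cont_increment : Continuous increment :=
    continuous_integral_of_continuous_ends
      (h := fun (z : ℝ × ℝ) x => (E x τ₂ - E x τ₁) * (p x - p z.2))
      (by fun_prop) (by fun_prop) (by fun_prop)
  have cont_integralRate : Continuous integralRate :=
    continuous_integral_of_continuous_ends
      (h := fun (z : ℝ × ℝ) t => truncatedRate ε μ l f p p' E D z.1 z.2 t)
      (continuous_truncatedRate cl cf cp hp.cont_deriv cE cD) (by fun_prop) (by fun_prop)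
  have increment_eq : ∀ {a b}, 0 ≤ a → a ≤ b → b ≤ 1 →
      increment (a, b) = ∫ x in a..b, (e x τ₂ - e x τ₁) * (p x - p b) := fun h0 hab h1 =>
    intervalIntegral.integral_congr (uIcc_of_le hab ▸ fun x hx => by
      simp only [hE x ⟨h0.trans hx.1, hx.2.trans h1⟩ _ (left_mem_Icc.2 h₂),
        hE x ⟨h0.trans hx.1, hx.2.trans h1⟩ _ (right_mem_Icc.2 h₂)])
  have integralRate_eq : ∀ {a b}, 0 ≤ a → a ≤ 1 / 2 → a ≤ b → b ≤ 1 →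
      integralRate (a, b) = ∫ t in τ₁..τ₂, truncatedRate ε μ lam φ p p' e ex a b t :=
    fun h0 ha hab h1 => intervalIntegral.integral_congr (uIcc_of_le h₂ ▸ fun t ht =>
      truncatedRate_congr hab (hl.mono (Icc_subset_Icc h0 h1)) (hf.mono (Icc_subset_Icc h0 h1))
        (fun x hx => hE x (Icc_subset_Icc h0 h1 hx) t ht) (hD _ ⟨h0, ha⟩ t ht)
        (hD 0 ⟨le_rfl, one_half_pos.le⟩ t ht))
  have inner : ∀ δ ∈ Ioo (0 : ℝ) (1 / 2), increment (δ, 1 - δ) = integralRate (δ, 1 - δ) := by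
    rintro δ ⟨h0, h1⟩
    have hab : δ ≤ 1 - δ := by linarith
    rw [increment_eq h0.le hab (by linarith), integralRate_eq h0.le h1.le hab (by linarith),
      h.integral_sub_eq_integral_truncatedRate hlam hφ hp h0 hab (by linarith) h₁ h₂]
  rw [← increment_eq le_rfl zero_le_one le_rfl,
    eq_zero_one_of_forall_eq_one_sub cont_increment cont_integralRate inner,
    integralRate_eq le_rfl one_half_pos.le zero_le_one le_rfl]

theorem integral_mul_adjointEigenfunction (h : IsErrorSystem ε lam φ t₀ e ex exx et)
    (hlam : ContinuousOn lam (Icc 0 1)) (hφ : ContinuousOn φ (Icc 0 1))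
    (hp : IsAdjointEigenfunction ε lam φ μ p p' p'')
    {τ₁ τ₂ : ℝ} (h₁ : t₀ < τ₁) (h₂ : τ₁ ≤ τ₂) :
    ∫ x in (0 : ℝ)..1, e x τ₂ * p x
      = Real.exp (-μ * (τ₂ - τ₁)) * ∫ x in (0 : ℝ)..1, e x τ₁ * p x := by
  have hI : Icc τ₁ τ₂ ⊆ Ioi t₀ := fun t ht => h₁.trans_le ht.1
  have cp := hp.cont
  obtain ⟨E, cE, hE⟩ := exists_continuous_extension_rect zero_le_one h₂
    (h.cont.mono (prod_mono_right hI))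
  set W : ℝ → ℝ := fun t => ∫ x in (0 : ℝ)..1, E x t * p x
  have cW : Continuous W := continuous_integral_of_continuous_ends (h := fun t x => E x t * p x)
    (by fun_prop) continuous_const continuous_const
  have W_eq : ∀ t ∈ Icc τ₁ τ₂, ∫ x in (0 : ℝ)..1, e x t * p x = W t := fun t ht =>
    intervalIntegral.integral_congr (uIcc_of_le (zero_le_one' ℝ) ▸ fun x hx => by
      simp only [hE x hx t ht])
  rw [W_eq τ₁ (left_mem_Icc.2 h₂), W_eq τ₂ (right_mem_Icc.2 h₂)]
  refine eq_exp_mul_of_sub_eq_integral h₂ cW fun t ht => ?_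
  have increment := h.integral_sub_eq_integral_truncatedRate_zero_one hlam hφ hp h₁ ht.1
  have rate : ∫ s in τ₁..t, truncatedRate ε μ lam φ p p' e ex 0 1 s = -μ * ∫ s in τ₁..t, W s := by
    rw [← intervalIntegral.integral_const_mul]
    refine intervalIntegral.integral_congr (uIcc_of_le ht.1 ▸ fun s hs => ?_)
    simp only [h.truncatedRate_zero_one hp (h₁.trans_le hs.1), W_eq s ⟨hs.1, hs.2.trans ht.2⟩]
  rw [← rate, ← increment]
  simp only [W, hp.right, sub_zero]
  rw [← intervalIntegral.integral_sub (Continuous.intervalIntegrable (by fun_prop) _ _)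
    (Continuous.intervalIntegrable (by fun_prop) _ _)]
  refine intervalIntegral.integral_congr (uIcc_of_le (zero_le_one' ℝ) ▸ fun x hx => ?_)
  simp only [hE x hx t ht, hE x hx τ₁ (left_mem_Icc.2 h₂), sub_mul]

end IsErrorSystem

/-! ### Parseval's identity for sines -/

/-- The odd extension of a function on the positive half-line, through which the sine series on
`[0, 1]` becomes the Fourier series on `[-1, 1]`. -/
noncomputable def oddExtension (w : ℝ → ℝ) (x : ℝ) : ℝ := if 0 < x then w x else -w (-x)

theorem memLp_oddExtension {w : ℝ → ℝ} (cw : Continuous w) :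
    MemLp (fun x => (oddExtension w x : ℂ)) 2 (volume.restrict (Ioc (-1) 1)) := by
  obtain ⟨M, hM⟩ := isCompact_Icc.exists_bound_of_continuousOn (s := Icc (-1 : ℝ) 1) cw.continuousOn
  refine MemLp.of_bound ?_ M ?_
  · have measurable : Measurable (oddExtension w) :=
      Measurable.ite measurableSet_Ioi cw.measurable (cw.comp continuous_neg).neg.measurable
    exact (Complex.measurable_ofReal.comp measurable).aestronglyMeasurable
  · refine (ae_restrict_iff' measurableSet_Ioc).2 (Eventually.of_forall fun x hx => ?_)
    rw [Complex.norm_real, oddExtension]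
    split_ifs
    · exact hM x ⟨hx.1.le, hx.2⟩
    · rw [norm_neg]
      exact hM _ ⟨neg_le_neg hx.2, neg_le.1 hx.1.le⟩

theorem integral_comp_oddExtension {E : Type*} [NormedAddCommGroup E] [NormedSpace ℝ E]
    {F : ℝ → ℝ → E} {w : ℝ → ℝ} (cF : Continuous (uncurry F)) (cw : Continuous w) :
    ∫ x in (-1 : ℝ)..1, F x (oddExtension w x)
      = ∫ x in (0 : ℝ)..1, (F x (w x) + F (-x) (-w x)) := by
  have pos : EqOn (fun x => F x (w x)) (fun x => F x (oddExtension w x)) (uIoo 0 1) :=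
    uIoo_of_le (zero_le_one' ℝ) ▸ fun x hx => by simp only [oddExtension, if_pos hx.1]
  have neg : EqOn (fun x => F x (-w (-x))) (fun x => F x (oddExtension w x)) (uIoo (-1) 0) :=
    uIoo_of_le (neg_one_lt_zero (R := ℝ)).le ▸ fun x hx => by
      simp only [oddExtension, if_neg hx.2.not_gt]
  have integral_neg : ∫ x in (-1 : ℝ)..0, F x (-w (-x)) = ∫ x in (0 : ℝ)..1, F (-x) (-w x) := by
    simpa using intervalIntegral.integral_comp_neg (a := -1) (b := 0) fun x => F (-x) (-w x)
  rw [← intervalIntegral.integral_add_adjacent_intervals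
      ((Continuous.intervalIntegrable (by fun_prop) _ _).congr_uIoo neg)
      ((Continuous.intervalIntegrable (by fun_prop) _ _).congr_uIoo pos),
    ← intervalIntegral.integral_congr_uIoo neg, ← intervalIntegral.integral_congr_uIoo pos,
    integral_neg, add_comm,
    intervalIntegral.integral_add (Continuous.intervalIntegrable (by fun_prop) _ _)
      (Continuous.intervalIntegrable (by fun_prop) _ _)]

theorem fourierCoeffOn_oddExtension {w : ℝ → ℝ} (cw : Continuous w) (n : ℤ) :
    fourierCoeffOn (neg_lt_self (one_pos (α := ℝ))) (fun x => (oddExtension w x : ℂ)) n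
      = -Complex.I * ((∫ x in (0 : ℝ)..1, w x * Real.sin (n * Real.pi * x) : ℝ) : ℂ) := by
  have fourier_eq : ∀ x : ℝ, fourier (-n) (x : AddCircle (1 - (-1 : ℝ)))
      = Complex.exp (-(n * Real.pi * x) * Complex.I) := fun x => by
    rw [fourier_coe_apply]
    congr 1
    push_cast
    ring
  rw [fourierCoeffOn_eq_integral]
  simp_rw [fourier_eq]
  rw [integral_comp_oddExtension
      (F := fun x y => Complex.exp (-(n * Real.pi * x) * Complex.I) • (y : ℂ)) (by fun_prop) cw,
    ← intervalIntegral.integral_smul, ← intervalIntegral.integral_ofReal,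
    ← intervalIntegral.integral_const_mul]
  refine intervalIntegral.integral_congr fun x _ => ?_
  have exp_neg : Complex.exp (-(n * Real.pi * (-x : ℝ)) * Complex.I)
      = Complex.exp (n * Real.pi * x * Complex.I) := by
    push_cast
    ring_nf
  simp only [Complex.real_smul, smul_eq_mul, exp_neg]
  push_cast
  rw [Complex.sin]
  linear_combination (w x : ℂ) / 2 * (Complex.exp (-(n * Real.pi * x) * Complex.I)
    - Complex.exp (n * Real.pi * x * Complex.I)) * Complex.I_sq

theorem hasSum_sq_integral_sin {w : ℝ → ℝ} (cw : Continuous w) :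
    HasSum (fun n : ℤ => (∫ x in (0 : ℝ)..1, w x * Real.sin (n * Real.pi * x)) ^ 2)
      (∫ x in (0 : ℝ)..1, w x ^ 2) := by
  have parseval := hasSum_sq_fourierCoeffOn (neg_lt_self (one_pos (α := ℝ))) (memLp_oddExtension cw)
  rw [integral_comp_oddExtension (F := fun _ y => ‖(y : ℂ)‖ ^ 2) (by fun_prop) cw,
    ← intervalIntegral.integral_smul] at parseval
  simp_rw [fourierCoeffOn_oddExtension cw] at parseval
  convert parseval using 1
  · funext n
    rw [norm_mul, norm_neg, Complex.norm_I, one_mul, Complex.norm_real, Real.norm_eq_abs, sq_abs]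
  · refine intervalIntegral.integral_congr fun x _ => ?_
    simp only [Complex.ofReal_neg, norm_neg, Complex.norm_real, Real.norm_eq_abs, sq_abs,
      smul_eq_mul]
    ring

/-! ### Decay of the error in `L²` -/

theorem integral_mul_sub_volterra_swap {k : ℝ → ℝ → ℝ} {f p : ℝ → ℝ} (ck : Continuous (uncurry k))
    (cf : Continuous f) (cp : Continuous p) (a b : ℝ) :
    ∫ x in a..b, f x * (p x - ∫ y in x..b, k y x * p y)
      = ∫ x in a..b, (f x - ∫ y in a..x, k x y * f y) * p x := by
  have swap := integral_integral_triangle_swap (k := fun x y => f x * (k y x * p y))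
    (by fun_prop) a b
  have inner : ∀ y, ∫ x in a..y, f x * (k y x * p y) = (∫ x in a..y, k y x * f x) * p y := by
    intro y
    rw [← intervalIntegral.integral_mul_const]
    exact intervalIntegral.integral_congr fun x _ => by ring
  have cont_upper : Continuous fun x => f x * ∫ y in x..b, k y x * p y :=
    cf.mul (continuous_integral_of_continuous_ends (h := fun x y => k y x * p y) (by fun_prop)
      continuous_id continuous_const)
  have cont_lower : Continuous fun x => (∫ y in a..x, k x y * f y) * p x :=
    (continuous_integral_of_continuous_ends (h := fun x y => k x y * f y) (by fun_prop)
      continuous_const continuous_id).mul cp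
  have cont_prod : Continuous fun x => f x * p x := cf.mul cp
  simp only [intervalIntegral.integral_const_mul, inner] at swap
  simp only [mul_sub, sub_mul]
  rw [intervalIntegral.integral_sub (cont_prod.intervalIntegrable _ _)
      (cont_upper.intervalIntegrable _ _),
    intervalIntegral.integral_sub (cont_prod.intervalIntegrable _ _)
      (cont_lower.intervalIntegrable _ _), swap]

-- `w` is the solution of the Volterra equation `w(x) - ∫_0^x Φ(x,y) w(y) dy = g(x)`, whose
-- operator is the transpose of the backstepping transformation of the test functions.
theorem exists_backstepping_transform {Φ : ℝ → ℝ → ℝ}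
    (hΦ : ContinuousOn (uncurry Φ) triangle) :
    ∃ D : ℝ, 1 ≤ D ∧ ∀ g : ℝ → ℝ, ContinuousOn g (Icc 0 1) →
      ∃ w : ℝ → ℝ, Continuous w ∧
        (∀ p s : ℝ → ℝ, Continuous p →
          (∀ x ∈ Icc (0 : ℝ) 1, s x = p x - ∫ y in x..1, Φ y x * p y) →
          ∫ x in (0 : ℝ)..1, w x * s x = ∫ x in (0 : ℝ)..1, g x * p x) ∧
        ∫ x in (0 : ℝ)..1, w x ^ 2 ≤ D * ∫ x in (0 : ℝ)..1, g x ^ 2 ∧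
        ∫ x in (0 : ℝ)..1, g x ^ 2 ≤ D * ∫ x in (0 : ℝ)..1, w x ^ 2 := by
  set E : ℝ → ℝ → ℝ := fun x y => uncurry Φ (triangleRetract (x, y))
  have cE : Continuous (uncurry E) := continuous_comp_triangleRetract hΦ
  have E_eq : ∀ x y, (x, y) ∈ triangle → E x y = Φ x y := fun x y h => by
    simp only [E, triangleRetract_of_mem h, uncurry]
  obtain ⟨M, -, hM⟩ := exists_abs_le_of_continuous cE 0 1 0 1
  set r := 2 * M ^ 2 * (1 - 0) ^ 2
  have hr : 0 ≤ r := by positivity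
  have one_add_le_exp : 1 + r ≤ Real.exp r := by linarith [Real.add_one_le_exp r]
  refine ⟨2 * Real.exp r, by linarith, fun g cg => ?_⟩
  obtain ⟨G, cG, hG⟩ := exists_continuous_extension_Icc zero_le_one cg
  obtain ⟨w, cw, hw⟩ := exists_volterra_solution cE zero_le_one cG.continuousOn
  have integral_g : ∫ x in (0 : ℝ)..1, g x ^ 2 = ∫ x in (0 : ℝ)..1, G x ^ 2 :=
    intervalIntegral.integral_congr (uIcc_of_le (zero_le_one' ℝ) ▸ fun x hx => by simp only [hG hx])
  have integral_w_nonneg : 0 ≤ ∫ x in (0 : ℝ)..1, w x ^ 2 :=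
    intervalIntegral.integral_nonneg zero_le_one fun x _ => sq_nonneg _
  rw [integral_g]
  refine ⟨w, cw, fun p s cp hs => ?_, integral_sq_le_of_volterra cw cG zero_le_one fun x hx =>
    abs_le_of_volterra cE cw hM hx (hw x hx),
    (integral_sq_le_integral_sq_volterra_solution cE cw cG zero_le_one hM hw).trans
      (mul_le_mul_of_nonneg_right (by linarith) integral_w_nonneg)⟩
  calc ∫ x in (0 : ℝ)..1, w x * s x
      = ∫ x in (0 : ℝ)..1, w x * (p x - ∫ y in x..1, E y x * p y) := by
        refine intervalIntegral.integral_congr (uIcc_of_le (zero_le_one' ℝ) ▸ fun x hx => ?_)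
        have kernel_eq : ∫ y in x..1, E y x * p y = ∫ y in x..1, Φ y x * p y :=
          intervalIntegral.integral_congr (uIcc_of_le hx.2 ▸ fun y hy => by
            simp only [E_eq y x ⟨hx.1, hy.1, hy.2⟩])
        simp only [hs x hx, kernel_eq]
    _ = ∫ x in (0 : ℝ)..1, (w x - ∫ y in 0..x, E x y * w y) * p x :=
        integral_mul_sub_volterra_swap cE cw cp 0 1
    _ = ∫ x in (0 : ℝ)..1, g x * p x :=
        intervalIntegral.integral_congr (uIcc_of_le (zero_le_one' ℝ) ▸ fun x hx => by
          simp only [hw x hx, hG hx, add_sub_cancel_right])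

namespace IsErrorSystem

variable {ε c t₀ : ℝ} {lam : ℝ → ℝ} {Φ e ex exx et : ℝ → ℝ → ℝ}

theorem exists_test_function_sq_integral_le
    (h : IsErrorSystem ε lam (observerGain ε Φ) t₀ e ex exx et) (hε : 0 < ε)
    (hlam : ContinuousOn lam (Icc 0 1)) (hΦ : IsObserverKernel ε lam c Φ) {γ : ℝ}
    (hγ : γ ≤ ε * Real.pi ^ 2 + c) {τ₁ τ₂ : ℝ} (h₁ : t₀ < τ₁) (h₂ : τ₁ ≤ τ₂) (n : ℤ) :
    ∃ p : ℝ → ℝ, Continuous p ∧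
      (∀ x ∈ Icc (0 : ℝ) 1, Real.sin (n * Real.pi * x) = p x - ∫ y in x..1, Φ y x * p y) ∧
      (∫ x in (0 : ℝ)..1, e x τ₂ * p x) ^ 2
        ≤ Real.exp (-γ * (τ₂ - τ₁)) ^ 2 * (∫ x in (0 : ℝ)..1, e x τ₁ * p x) ^ 2 := by
  rcases eq_or_ne n 0 with rfl | hn
  · exact ⟨0, continuous_const, by simp, by simp⟩
  set k : ℝ := n * Real.pi
  have hk : Real.pi ^ 2 ≤ k ^ 2 := by
    rw [mul_pow]
    refine le_mul_of_one_le_left (sq_nonneg _) ?_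
    exact_mod_cast Int.one_le_abs (pow_ne_zero 2 hn) |>.trans_eq (abs_of_nonneg (sq_nonneg n))
  obtain ⟨p, p', p'', hp, hs⟩ := hΦ.exists_adjointEigenfunction hε.ne' hlam
    (s := fun x => Real.sin (k * x)) (s' := fun x => Real.cos (k * x) * k) (κ := k ^ 2)
    (fun x => by simpa using! ((hasDerivAt_id x).const_mul k).sin)
    (fun x => (((hasDerivAt_id' x).const_mul k).cos.mul_const k).congr_deriv (by ring))
    (by simp) (by simp [k, Real.sin_int_mul_pi])
  have cφ : ContinuousOn (observerGain ε Φ) (Icc 0 1) :=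
    continuousOn_const.mul (hΦ.regular.continuousOn.comp (f := fun x : ℝ => (x, (0 : ℝ)))
      (by fun_prop) fun x hx => ⟨le_rfl, hx.1, hx.2⟩)
  refine ⟨p, hp.cont, hs, ?_⟩
  rw [h.integral_mul_adjointEigenfunction hlam cφ hp h₁ h₂, mul_pow]
  refine mul_le_mul_of_nonneg_right (pow_le_pow_left₀ (Real.exp_nonneg _)
    (Real.exp_le_exp.2 ?_) 2) (sq_nonneg _)
  have rate : γ ≤ c + ε * k ^ 2 := by linarith [mul_le_mul_of_nonneg_left hk hε.le]
  nlinarith [mul_le_mul_of_nonneg_right rate (sub_nonneg.2 h₂)]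

end IsErrorSystem

theorem exists_integral_sq_decay {ε c γ : ℝ} {lam : ℝ → ℝ} {Φ : ℝ → ℝ → ℝ} (hε : 0 < ε)
    (hlam : ContinuousOn lam (Icc 0 1)) (hΦ : IsObserverKernel ε lam c Φ)
    (hγ : γ ≤ ε * Real.pi ^ 2 + c) :
    ∃ D : ℝ, 1 ≤ D ∧ ∀ (t₀ : ℝ) (e ex exx et : ℝ → ℝ → ℝ),
      IsErrorSystem ε lam (observerGain ε Φ) t₀ e ex exx et →
      ∀ τ₁ τ₂, t₀ < τ₁ → τ₁ ≤ τ₂ →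
        ∫ x in (0 : ℝ)..1, e x τ₂ ^ 2
          ≤ (D * Real.exp (-γ * (τ₂ - τ₁))) ^ 2 * ∫ x in (0 : ℝ)..1, e x τ₁ ^ 2 := by
  obtain ⟨D, hD, transform⟩ := exists_backstepping_transform hΦ.regular.continuousOn
  refine ⟨D, hD, fun t₀ e ex exx et h τ₁ τ₂ h₁ h₂ => ?_⟩
  obtain ⟨w₁, cw₁, duality₁, upper₁, -⟩ := transform _ (continuousOn_slice h.cont h₁)
  obtain ⟨w₂, cw₂, duality₂, -, lower₂⟩ := transform _ (continuousOn_slice h.cont (h₁.trans_le h₂))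
  have coefficient_le : ∀ n : ℤ, (∫ x in (0 : ℝ)..1, w₂ x * Real.sin (n * Real.pi * x)) ^ 2
      ≤ Real.exp (-γ * (τ₂ - τ₁)) ^ 2
        * (∫ x in (0 : ℝ)..1, w₁ x * Real.sin (n * Real.pi * x)) ^ 2 := fun n => by
    obtain ⟨p, cp, hs, decay⟩ := h.exists_test_function_sq_integral_le hε hlam hΦ hγ h₁ h₂ n
    rwa [duality₁ p _ cp hs, duality₂ p _ cp hs]
  have parseval : ∫ x in (0 : ℝ)..1, w₂ x ^ 2
      ≤ Real.exp (-γ * (τ₂ - τ₁)) ^ 2 * ∫ x in (0 : ℝ)..1, w₁ x ^ 2 :=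
    hasSum_le coefficient_le (hasSum_sq_integral_sin cw₂) ((hasSum_sq_integral_sin cw₁).mul_left _)
  calc ∫ x in (0 : ℝ)..1, e x τ₂ ^ 2 ≤ D * ∫ x in (0 : ℝ)..1, w₂ x ^ 2 := lower₂
    _ ≤ D * (Real.exp (-γ * (τ₂ - τ₁)) ^ 2 * (D * ∫ x in (0 : ℝ)..1, e x τ₁ ^ 2)) := by
      gcongr
      exact parseval.trans (by gcongr)
    _ = (D * Real.exp (-γ * (τ₂ - τ₁))) ^ 2 * ∫ x in (0 : ℝ)..1, e x τ₁ ^ 2 := by ring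

/-! ### `L²` norms and the initial time -/

theorem eLpNorm_restrict_union_le {α E : Type*} [MeasurableSpace α] [NormedAddCommGroup E]
    {p : ENNReal} (hp : 1 ≤ p) (hp_top : p ≠ ⊤) (f : α → E) (μ : Measure α) (s t : Set α) :
    eLpNorm f p (μ.restrict (s ∪ t)) ≤ eLpNorm f p (μ.restrict s) + eLpNorm f p (μ.restrict t) := by
  have one_le : 1 ≤ p.toReal := by simpa using! ENNReal.toReal_mono hp_top hp
  simp only [eLpNorm_eq_lintegral_rpow_enorm_toReal (zero_lt_one.trans_le hp).ne' hp_top]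
  exact (ENNReal.rpow_le_rpow (lintegral_union_le _ s t) (by positivity)).trans
    (ENNReal.rpow_add_le_add_rpow _ _ (by positivity) (div_le_one_of_le₀ one_le (by positivity)))

theorem aestronglyMeasurable_Ioo_of_continuousOn_Icc {f : ℝ → ℝ} {a b : ℝ}
    (hf : ContinuousOn f (Icc a b)) : AEStronglyMeasurable f (volume.restrict (Ioo a b)) :=
  (hf.mono Ioo_subset_Icc_self).aestronglyMeasurable measurableSet_Ioo

theorem eLpNorm_two_eq_sqrt_integral {f : ℝ → ℝ} {a b : ℝ} (hab : a ≤ b)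
    (hf : ContinuousOn f (Icc a b)) :
    eLpNorm f 2 (volume.restrict (Ioo a b)) = ENNReal.ofReal √(∫ x in a..b, f x ^ 2) := by
  obtain ⟨M, hM⟩ := isCompact_Icc.exists_bound_of_continuousOn hf
  have memLp : MemLp f 2 (volume.restrict (Ioo a b)) :=
    .of_bound (aestronglyMeasurable_Ioo_of_continuousOn_Icc hf) M
      (ae_restrict_of_forall_mem measurableSet_Ioo fun x hx => hM x (Ioo_subset_Icc_self hx))
  rw [memLp.eLpNorm_eq_integral_rpow_norm two_ne_zero ENNReal.ofNat_ne_top,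
    intervalIntegral.integral_of_le hab, integral_Ioc_eq_integral_Ioo, Real.sqrt_eq_rpow]
  simp

theorem eLpNorm_two_le_of_integral_sq_le {f g : ℝ → ℝ} {a b K : ℝ} (hab : a ≤ b)
    (hf : ContinuousOn f (Icc a b)) (hg : ContinuousOn g (Icc a b)) (hK : 0 ≤ K)
    (h : ∫ x in a..b, f x ^ 2 ≤ K ^ 2 * ∫ x in a..b, g x ^ 2) :
    eLpNorm f 2 (volume.restrict (Ioo a b))
      ≤ ENNReal.ofReal K * eLpNorm g 2 (volume.restrict (Ioo a b)) := by
  rw [eLpNorm_two_eq_sqrt_integral hab hf, eLpNorm_two_eq_sqrt_integral hab hg,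
    ← ENNReal.ofReal_mul hK]
  refine ENNReal.ofReal_le_ofReal ((Real.sqrt_le_sqrt h).trans_eq ?_)
  rw [Real.sqrt_mul (sq_nonneg K), Real.sqrt_sq hK]

namespace HasL2InitialValue

variable {f g : ℝ → ℝ → ℝ} {a b t₀ : ℝ}

theorem tendsto_eLpNorm (h : HasL2InitialValue f a b t₀)
    (hf : ∀ t > t₀, AEStronglyMeasurable (fun x => f x t) (volume.restrict (Ioo a b))) :
    Tendsto (fun t => eLpNorm (fun x => f x t) 2 (volume.restrict (Ioo a b))) (𝓝[>] t₀)
      (𝓝 (eLpNorm (fun x => f x t₀) 2 (volume.restrict (Ioo a b)))) := by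
  have lower := ENNReal.Tendsto.sub tendsto_const_nhds h.tendsto (Or.inl h.memLp.2.ne)
  have upper := h.tendsto.add_const (eLpNorm (fun x => f x t₀) 2 (volume.restrict (Ioo a b)))
  rw [tsub_zero] at lower
  rw [zero_add] at upper
  refine tendsto_of_tendsto_of_tendsto_of_le_of_le' lower upper ?_ ?_ <;>
    filter_upwards [self_mem_nhdsWithin] with t ht
  · rw [tsub_le_iff_right]
    simpa [Pi.sub_def] using!
      eLpNorm_sub_le (p := 2) (hf t ht) ((hf t ht).sub h.memLp.1) one_le_two
  · simpa [Pi.add_def] using!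
      eLpNorm_add_le (p := 2) ((hf t ht).sub h.memLp.1) h.memLp.1 one_le_two

theorem of_eLpNorm_sub_le {K : ENNReal} {a' b' : ℝ} (h : HasL2InitialValue f a b t₀) (hK : K ≠ ⊤)
    (hg : MemLp (fun x => g x t₀) 2 (volume.restrict (Ioo a' b')))
    (hfg : ∀ t, eLpNorm (fun x => g x t - g x t₀) 2 (volume.restrict (Ioo a' b'))
      ≤ K * eLpNorm (fun x => f x t - f x t₀) 2 (volume.restrict (Ioo a b))) :
    HasL2InitialValue g a' b' t₀ := by
  have upper := ENNReal.Tendsto.const_mul h.tendsto (Or.inr hK)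
  rw [mul_zero] at upper
  exact ⟨hg, tendsto_of_tendsto_of_tendsto_of_le_of_le tendsto_const_nhds upper
    (fun _ => zero_le) hfg⟩

theorem sub (hf : HasL2InitialValue f a b t₀) (hg : HasL2InitialValue g a b t₀)
    (mf : ∀ t > t₀, AEStronglyMeasurable (fun x => f x t) (volume.restrict (Ioo a b)))
    (mg : ∀ t > t₀, AEStronglyMeasurable (fun x => g x t) (volume.restrict (Ioo a b))) :
    HasL2InitialValue (fun x t => f x t - g x t) a b t₀ := by
  have upper := hf.tendsto.add hg.tendsto
  rw [add_zero] at upper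
  refine ⟨hf.memLp.sub hg.memLp, tendsto_of_tendsto_of_tendsto_of_le_of_le' tendsto_const_nhds
    upper (Eventually.of_forall fun _ => zero_le) ?_⟩
  filter_upwards [self_mem_nhdsWithin] with t ht
  simpa only [Pi.sub_def, sub_sub_sub_comm] using!
    eLpNorm_sub_le (p := 2) ((mf t ht).sub hf.memLp.1) ((mg t ht).sub hg.memLp.1) one_le_two

theorem eLpNorm_decay {D γ : ℝ} (h : HasL2InitialValue f a b t₀) (hab : a ≤ b)
    (cf : ∀ t > t₀, ContinuousOn (fun x => f x t) (Icc a b)) (hD : 1 ≤ D)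
    (decay : ∀ τ₁ τ₂, t₀ < τ₁ → τ₁ ≤ τ₂ → ∫ x in a..b, f x τ₂ ^ 2
      ≤ (D * Real.exp (-γ * (τ₂ - τ₁))) ^ 2 * ∫ x in a..b, f x τ₁ ^ 2) {t : ℝ} (ht : t₀ ≤ t) :
    eLpNorm (fun x => f x t) 2 (volume.restrict (Ioo a b))
      ≤ ENNReal.ofReal (D * Real.exp (-γ * (t - t₀)))
        * eLpNorm (fun x => f x t₀) 2 (volume.restrict (Ioo a b)) := by
  rcases ht.eq_or_lt with rfl | ht
  · simpa using! le_mul_of_one_le_left zero_le (ENNReal.one_le_ofReal.2 hD)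
  have factor : Tendsto (fun τ => ENNReal.ofReal (D * Real.exp (-γ * (t - τ)))) (𝓝[>] t₀)
      (𝓝 (ENNReal.ofReal (D * Real.exp (-γ * (t - t₀))))) :=
    ENNReal.tendsto_ofReal ((Continuous.tendsto (by fun_prop) t₀).mono_left nhdsWithin_le_nhds)
  have limit := ENNReal.Tendsto.mul factor (Or.inr h.memLp.2.ne)
    (h.tendsto_eLpNorm fun τ hτ => aestronglyMeasurable_Ioo_of_continuousOn_Icc (cf τ hτ))
    (Or.inr ENNReal.ofReal_ne_top)
  refine ge_of_tendsto limit ?_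
  filter_upwards [Ioo_mem_nhdsGT ht] with τ hτ
  exact eLpNorm_two_le_of_integral_sq_le hab (cf t ht) (cf τ hτ.1) (by positivity)
    (decay τ t hτ.1 hτ.2.le)

end HasL2InitialValue

theorem eLpNorm_exp_mul_le {α : Type*} [MeasurableSpace α] {μ : Measure α} {g : α → ℝ} {B : ℝ}
    {s : Set α} (hs : MeasurableSet s) (hg : ∀ x ∈ s, g x ≤ B) (f : α → ℝ) (p : ENNReal) :
    eLpNorm (fun x => Real.exp (g x) * f x) p (μ.restrict s)
      ≤ ENNReal.ofReal (Real.exp B) * eLpNorm f p (μ.restrict s) := by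
  refine eLpNorm_le_mul_eLpNorm_of_ae_le_mul (ae_restrict_of_forall_mem hs fun x hx => ?_) p
  rw [norm_mul, Real.norm_of_nonneg (Real.exp_nonneg _)]
  exact mul_le_mul_of_nonneg_right (Real.exp_le_exp.2 (hg x hx)) (norm_nonneg _)

/-! ### Affine changes of variable -/

section Affine

variable {s : ℝ} (a : ℝ)

theorem measurableEmbedding_affine (hs : s ≠ 0) : MeasurableEmbedding fun x : ℝ => a + s * x :=
  (measurableEmbedding_addLeft a).comp (measurableEmbedding_mulLeft₀ hs)

theorem map_affine_restrict_preimage (hs : s ≠ 0) (J : Set ℝ) :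
    (volume.restrict ((fun x => a + s * x) ⁻¹' J)).map (fun x => a + s * x)
      = ENNReal.ofReal |s⁻¹| • volume.restrict J := by
  have map_volume : (volume : Measure ℝ).map (fun x => a + s * x)
      = ENNReal.ofReal |s⁻¹| • volume := by
    have comp : (fun x : ℝ => a + s * x) = (fun x => a + x) ∘ (fun x => s * x) := rfl
    rw [comp, ← Measure.map_map (by fun_prop) (by fun_prop), Real.map_volume_mul_left hs,
      Measure.map_smul, map_add_left_eq_self]
  rw [← (measurableEmbedding_affine a hs).restrict_map, map_volume, Measure.restrict_smul]

theorem eLpNorm_comp_affine (hs : s ≠ 0) (f : ℝ → ℝ) (p : ENNReal) (J : Set ℝ) :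
    eLpNorm (fun x => f (a + s * x)) p (volume.restrict ((fun x => a + s * x) ⁻¹' J))
      = ENNReal.ofReal |s⁻¹| ^ (1 / p).toReal * eLpNorm f p (volume.restrict J) := by
  have scale : ENNReal.ofReal |s⁻¹| ≠ 0 := by simpa using! hs
  rw [← smul_eq_mul, ← eLpNorm_smul_measure_of_ne_zero scale,
    ← map_affine_restrict_preimage a hs, (measurableEmbedding_affine a hs).eLpNorm_map_measure]
  rfl

theorem memLp_comp_affine (hs : s ≠ 0) {f : ℝ → ℝ} {p : ENNReal} {J : Set ℝ}
    (hf : MemLp f p (volume.restrict J)) :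
    MemLp (fun x => f (a + s * x)) p (volume.restrict ((fun x => a + s * x) ⁻¹' J)) :=
  (measurableEmbedding_affine a hs).memLp_map_measure_iff.1 <| by
    rw [map_affine_restrict_preimage a hs]
    exact hf.smul_measure ENNReal.ofReal_ne_top

end Affine

theorem HasL2InitialValue.comp_affine {f : ℝ → ℝ → ℝ} {a b a' b' y s t₀ : ℝ}
    (h : HasL2InitialValue f a b t₀) (hs : s ≠ 0)
    (maps : ∀ x ∈ Ioo a' b', y + s * x ∈ Ioo a b) :
    HasL2InitialValue (fun x t => f (y + s * x) t) a' b' t₀ := by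
  have restrict_le : volume.restrict (Ioo a' b')
      ≤ volume.restrict ((fun x => y + s * x) ⁻¹' Ioo a b) :=
    Measure.restrict_mono_set volume maps
  refine h.of_eLpNorm_sub_le (K := ENNReal.ofReal |s⁻¹| ^ (1 / (2 : ENNReal)).toReal)
    (by finiteness) ((memLp_comp_affine y hs h.memLp).mono_measure restrict_le) fun t => ?_
  rw [← eLpNorm_comp_affine y hs fun x => f x t - f x t₀]
  exact eLpNorm_mono_measure _ restrict_le

/-! ### The gauge transformation -/

section Gauge

variable {ε t₀ : ℝ} {ν : ℝ → ℝ} {f : ℝ → ℝ → ℝ}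

theorem hasDerivAt_gaugeExp (hν : ContinuousOn ν (Icc (-1) 1)) {y : ℝ} (hy : y ∈ Ioo (-1 : ℝ) 1) :
    HasDerivAt (gaugeExp ε ν) (ν y / (2 * ε)) y := by
  have cont : ContinuousOn (fun z => ν z / (2 * ε)) (Icc (-1) 1) := hν.div_const _
  exact intervalIntegral.integral_hasDerivAt_right
    ((cont.mono (Icc_subset_Icc_right hy.2.le)).intervalIntegrable_of_Icc hy.1.le)
    ((cont.mono Ioo_subset_Icc_self).stronglyMeasurableAtFilter isOpen_Ioo y hy)
    (cont.continuousAt (Icc_mem_nhds hy.1 hy.2))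

theorem continuousOn_gaugeExp (hν : ContinuousOn ν (Icc (-1) 1)) :
    ContinuousOn (gaugeExp ε ν) (Icc (-1) 1) := by
  rw [← uIcc_of_le (by norm_num)] at hν ⊢
  exact intervalIntegral.continuousOn_primitive_interval
    (ContinuousOn.integrableOn_uIcc (hν.div_const _))

theorem exists_abs_gaugeExp_le (ε : ℝ) (hν : ContinuousOn ν (Icc (-1) 1)) :
    ∃ B, ∀ y ∈ Icc (-1 : ℝ) 1, |gaugeExp ε ν y| ≤ B :=
  isCompact_Icc.exists_bound_of_continuousOn (continuousOn_gaugeExp hν)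

theorem continuousOn_gauged (hν : ContinuousOn ν (Icc (-1) 1))
    (hf : ContinuousOn (uncurry f) (Icc (-1) 1 ×ˢ Ioi t₀)) :
    ContinuousOn (uncurry (gauged ε ν f)) (Icc (-1) 1 ×ˢ Ioi t₀) :=
  ((continuousOn_gaugeExp hν).comp continuousOn_fst fun _ hp => hp.1).rexp.mul hf

theorem hasL2InitialValue_gauged (hν : ContinuousOn ν (Icc (-1) 1))
    (h : HasL2InitialValue f (-1) 1 t₀) : HasL2InitialValue (gauged ε ν f) (-1) 1 t₀ := by
  obtain ⟨B, hB⟩ := exists_abs_gaugeExp_le ε hν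
  have upper : ∀ y ∈ Ioo (-1 : ℝ) 1, gaugeExp ε ν y ≤ B := fun y hy =>
    (abs_le.1 (hB y (Ioo_subset_Icc_self hy))).2
  have meas : AEStronglyMeasurable (fun y => Real.exp (gaugeExp ε ν y))
      (volume.restrict (Ioo (-1) 1)) :=
    aestronglyMeasurable_Ioo_of_continuousOn_Icc (continuousOn_gaugeExp hν).rexp
  have bound := eLpNorm_exp_mul_le (μ := volume) measurableSet_Ioo upper
  refine h.of_eLpNorm_sub_le (K := ENNReal.ofReal (Real.exp B)) ENNReal.ofReal_ne_top
    ⟨meas.mul h.memLp.1, ?_⟩ fun t => ?_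
  · exact (bound _ 2).trans_lt (ENNReal.mul_lt_top ENNReal.ofReal_lt_top h.memLp.2)
  · simpa only [gauged, mul_sub] using! bound (fun y => f y t - f y t₀) 2

namespace IsC21On

variable {y t : ℝ}

theorem hasDerivAt_gauged (h : IsC21On f (Ioo (-1) 1) t₀) (hν : ContinuousOn ν (Icc (-1) 1))
    (hy : y ∈ Ioo (-1 : ℝ) 1) (ht : t > t₀) :
    HasDerivAt (fun z => gauged ε ν f z t)
      (Real.exp (gaugeExp ε ν y) * (ν y / (2 * ε) * f y t + pdX f y t)) y :=
  ((hasDerivAt_gaugeExp hν hy).exp.mul (h.diff_x y hy t ht).hasDerivAt).congr_deriv (by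
    simp only [pdX]
    ring)

theorem pdX_gauged (h : IsC21On f (Ioo (-1) 1) t₀) (hν : ContinuousOn ν (Icc (-1) 1))
    (hy : y ∈ Ioo (-1 : ℝ) 1) (ht : t > t₀) :
    pdX (gauged ε ν f) y t
      = Real.exp (gaugeExp ε ν y) * (ν y / (2 * ε) * f y t + pdX f y t) :=
  (h.hasDerivAt_gauged hν hy ht).deriv

theorem hasDerivAt_pdX_gauged (h : IsC21On f (Ioo (-1) 1) t₀)
    (hν : ContDiffOn ℝ 1 ν (Icc (-1) 1)) (hy : y ∈ Ioo (-1 : ℝ) 1) (ht : t > t₀) :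
    HasDerivAt (fun z => pdX (gauged ε ν f) z t)
      (Real.exp (gaugeExp ε ν y) * (((ν y / (2 * ε)) ^ 2
        + derivWithin ν (Icc (-1) 1) y / (2 * ε)) * f y t
        + 2 * (ν y / (2 * ε)) * pdX f y t + pdXX f y t)) y := by
  have deriv_ν : HasDerivAt ν (derivWithin ν (Icc (-1) 1) y) y :=
    (hν.differentiableOn one_ne_zero y (Ioo_subset_Icc_self hy)).hasDerivWithinAt.hasDerivAt
      (Icc_mem_nhds hy.1 hy.2)
  have product := (hasDerivAt_gaugeExp (ε := ε) hν.continuousOn hy).exp.mul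
    (((deriv_ν.div_const (2 * ε)).mul (h.diff_x y hy t ht).hasDerivAt).add
      (h.diff_xx y hy t ht).hasDerivAt)
  have pdX_eq : (fun z => pdX (gauged ε ν f) z t) =ᶠ[𝓝 y]
      fun z => Real.exp (gaugeExp ε ν z) * (ν z / (2 * ε) * f z t + pdX f z t) := by
    filter_upwards [Ioo_mem_nhds hy.1 hy.2] with z hz
      using h.pdX_gauged hν.continuousOn hz ht
  refine (product.congr_of_eventuallyEq pdX_eq).congr_deriv ?_
  simp only [Pi.add_apply, Pi.mul_apply, pdXX, pdX]
  ring

theorem pdXX_gauged (h : IsC21On f (Ioo (-1) 1) t₀) (hν : ContDiffOn ℝ 1 ν (Icc (-1) 1))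
    (hy : y ∈ Ioo (-1 : ℝ) 1) (ht : t > t₀) :
    pdXX (gauged ε ν f) y t
      = Real.exp (gaugeExp ε ν y) * (((ν y / (2 * ε)) ^ 2
        + derivWithin ν (Icc (-1) 1) y / (2 * ε)) * f y t
        + 2 * (ν y / (2 * ε)) * pdX f y t + pdXX f y t) :=
  (h.hasDerivAt_pdX_gauged hν hy ht).deriv

theorem hasDerivAt_time_gauged (h : IsC21On f (Ioo (-1) 1) t₀) (hy : y ∈ Ioo (-1 : ℝ) 1)
    (ht : t > t₀) :
    HasDerivAt (fun s => gauged ε ν f y s) (Real.exp (gaugeExp ε ν y) * pdT f y t) t :=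
  (h.diff_t y hy t ht).hasDerivAt.const_mul _

theorem pdT_gauged (h : IsC21On f (Ioo (-1) 1) t₀) (hy : y ∈ Ioo (-1 : ℝ) 1) (ht : t > t₀) :
    pdT (gauged ε ν f) y t = Real.exp (gaugeExp ε ν y) * pdT f y t :=
  (h.hasDerivAt_time_gauged hy ht).deriv

end IsC21On

theorem isC21On_gauged (h : IsC21On f (Ioo (-1) 1) t₀) (hν : ContDiffOn ℝ 1 ν (Icc (-1) 1))
    (hf : ContinuousOn (uncurry f) (Icc (-1) 1 ×ˢ Ioi t₀)) :
    IsC21On (gauged ε ν f) (Ioo (-1) 1) t₀ := by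
  have lift : ∀ {g : ℝ → ℝ}, ContinuousOn g (Icc (-1) 1) →
      ContinuousOn (fun p : ℝ × ℝ => g p.1) (Ioo (-1) 1 ×ˢ Ioi t₀) := fun hg =>
    hg.comp continuousOn_fst fun _ hp => Ioo_subset_Icc_self hp.1
  have cont_exp := (lift (continuousOn_gaugeExp (ε := ε) hν.continuousOn)).rexp
  have cont_ν := (lift hν.continuousOn).div_const (2 * ε)
  have cont_ν' := (lift (hν.continuousOn_derivWithin (uniqueDiffOn_Icc (by norm_num))
    le_rfl)).div_const (2 * ε)
  have cont_f : ContinuousOn (fun p : ℝ × ℝ => f p.1 p.2) (Ioo (-1) 1 ×ˢ Ioi t₀) :=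
    hf.mono (prod_mono_left Ioo_subset_Icc_self)
  have cont_x := h.cont_x
  have cont_xx := h.cont_xx
  refine ⟨fun y hy t ht => (h.hasDerivAt_gauged hν.continuousOn hy ht).differentiableAt,
    fun y hy t ht => (h.hasDerivAt_pdX_gauged hν hy ht).differentiableAt,
    fun y hy t ht => (h.hasDerivAt_time_gauged hy ht).differentiableAt,
    .congr ?_ fun p hp => h.pdX_gauged hν.continuousOn hp.1 hp.2,
    .congr ?_ fun p hp => h.pdXX_gauged hν hp.1 hp.2,
    (cont_exp.mul h.cont_t).congr fun p hp => h.pdT_gauged hp.1 hp.2⟩ <;> fun_prop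

theorem IsPlantSolution.pde_gauged {lamBar : ℝ → ℝ} {Ubar : Fin 2 → ℝ → ℝ}
    (h : IsPlantSolution ε ν lamBar Ubar t₀ f) (hε : ε ≠ 0) (hν : ContDiffOn ℝ 1 ν (Icc (-1) 1))
    {y t : ℝ} (hy : y ∈ Ioo (-1 : ℝ) 1) (ht : t > t₀) :
    pdT (gauged ε ν f) y t = ε * pdXX (gauged ε ν f) y t
      + reaction ε ν lamBar y * gauged ε ν f y t := by
  rw [h.regular.pdT_gauged hy ht, h.regular.pdXX_gauged hν hy ht, h.pde y hy t ht, reaction,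
    gauged]
  field_simp
  ring

end Gauge

/-! ### Folding -/

section Fold

variable {y₀ x : ℝ}

/-- The open pieces `(-1, y₀)` and `(y₀, 1)` into which the sensor position cuts the domain, indexed
like `foldSlope`. -/
def foldPiece (y₀ : ℝ) (i : Fin 2) : Set ℝ := ![Ioo (-1) y₀, Ioo y₀ 1] i

theorem foldSlope_zero : foldSlope y₀ 0 = -(1 + y₀) := rfl

theorem foldSlope_one : foldSlope y₀ 1 = 1 - y₀ := rfl

theorem foldSlope_ne_zero (hy₀ : y₀ ∈ Ioo (-1 : ℝ) 1) : ∀ i, foldSlope y₀ i ≠ 0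
  | 0 => by rw [foldSlope_zero]; linarith [hy₀.1]
  | 1 => by rw [foldSlope_one]; linarith [hy₀.2]

theorem foldDiff_pos {ε : ℝ} (hε : 0 < ε) (hy₀ : y₀ ∈ Ioo (-1 : ℝ) 1) (i : Fin 2) :
    0 < foldDiff ε y₀ i :=
  div_pos hε (sq_pos_of_ne_zero (foldSlope_ne_zero hy₀ i))

theorem fold_one : ∀ i, y₀ + foldSlope y₀ i * 1 = ![-1, 1] i
  | 0 => by simp [foldSlope_zero]
  | 1 => by simp [foldSlope_one]

theorem fold_mem_Icc (hy₀ : y₀ ∈ Ioo (-1 : ℝ) 1) (hx : x ∈ Icc (0 : ℝ) 1) :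
    ∀ i, y₀ + foldSlope y₀ i * x ∈ Icc (-1 : ℝ) 1
  | 0 => by rw [foldSlope_zero]; constructor <;> nlinarith [hy₀.1, hy₀.2, hx.1, hx.2]
  | 1 => by rw [foldSlope_one]; constructor <;> nlinarith [hy₀.1, hy₀.2, hx.1, hx.2]

theorem fold_mem_Ioo (hy₀ : y₀ ∈ Ioo (-1 : ℝ) 1) (hx : x ∈ Ico (0 : ℝ) 1) :
    ∀ i, y₀ + foldSlope y₀ i * x ∈ Ioo (-1 : ℝ) 1
  | 0 => by rw [foldSlope_zero]; constructor <;> nlinarith [hy₀.1, hy₀.2, hx.1, hx.2]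
  | 1 => by rw [foldSlope_one]; constructor <;> nlinarith [hy₀.1, hy₀.2, hx.1, hx.2]

theorem preimage_foldPiece (hy₀ : y₀ ∈ Ioo (-1 : ℝ) 1) :
    ∀ i, (fun x => y₀ + foldSlope y₀ i * x) ⁻¹' foldPiece y₀ i = Ioo 0 1
  | 0 => by
    ext x
    change y₀ + -(1 + y₀) * x ∈ Ioo (-1) y₀ ↔ x ∈ Ioo 0 1
    constructor <;> rintro ⟨h₁, h₂⟩ <;> constructor <;> nlinarith [hy₀.1]
  | 1 => by
    ext x
    change y₀ + (1 - y₀) * x ∈ Ioo y₀ 1 ↔ x ∈ Ioo 0 1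
    constructor <;> rintro ⟨h₁, h₂⟩ <;> constructor <;> nlinarith [hy₀.2]

theorem foldPiece_subset (hy₀ : y₀ ∈ Ioo (-1 : ℝ) 1) : ∀ i, foldPiece y₀ i ⊆ Ioo (-1 : ℝ) 1
  | 0 => Ioo_subset_Ioo_right hy₀.2.le
  | 1 => Ioo_subset_Ioo_left hy₀.1.le

theorem foldPiece_union_ae_eq (hy₀ : y₀ ∈ Ioo (-1 : ℝ) 1) :
    (foldPiece y₀ 0 ∪ foldPiece y₀ 1 : Set ℝ) =ᵐ[volume] Ioo (-1) 1 := by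
  rw [← Ioc_union_Ioo_eq_Ioo hy₀.1.le hy₀.2]
  exact Ioo_ae_eq_Ioc.union (ae_eq_refl _)

theorem contDiffOn_foldReaction {lam : ℝ → ℝ} {n : WithTop ℕ∞} (hy₀ : y₀ ∈ Ioo (-1 : ℝ) 1)
    (hlam : ContDiffOn ℝ n lam (Icc (-1) 1)) (i : Fin 2) :
    ContDiffOn ℝ n (foldReaction lam y₀ i) (Icc 0 1) :=
  hlam.comp (f := fun x => y₀ + foldSlope y₀ i * x) (by fun_prop) fun _ hx => fold_mem_Icc hy₀ hx i

theorem unfolded_fold (hy₀ : y₀ ∈ Ioo (-1 : ℝ) 1) (uhat : Fin 2 → ℝ → ℝ → ℝ)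
    (hx : 0 < x) (t : ℝ) :
    ∀ i, unfolded y₀ uhat (y₀ + foldSlope y₀ i * x) t = uhat i x t
  | 0 => by
    have length_pos : 0 < 1 + y₀ := by linarith [hy₀.1]
    have mem_left : y₀ + -(1 + y₀) * x ≤ y₀ := by nlinarith
    rw [unfolded, foldSlope_zero, if_pos mem_left]
    congr 1
    field_simp
    ring
  | 1 => by
    have length_pos : 0 < 1 - y₀ := by linarith [hy₀.2]
    have mem_right : ¬y₀ + (1 - y₀) * x ≤ y₀ := by nlinarith
    rw [unfolded, foldSlope_one, if_neg mem_right, add_sub_cancel_left,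
      mul_div_cancel_left₀ _ length_pos.ne']

end Fold

/-! ### The folded estimation error -/

theorem hasDerivAt_comp_affine {f : ℝ → ℝ} {f' a s x : ℝ} (h : HasDerivAt f f' (a + s * x)) :
    HasDerivAt (fun z => f (a + s * z)) (s * f') x := by
  have affine : HasDerivAt (fun z => a + s * z) s x := by
    simpa using! ((hasDerivAt_id x).const_mul s).const_add a
  exact (h.comp x affine).congr_deriv (mul_comm _ _)

theorem continuousOn_comp_affine {f : ℝ → ℝ → ℝ} {a s : ℝ} {I J T : Set ℝ}
    (hf : ContinuousOn (fun p : ℝ × ℝ => f p.1 p.2) (I ×ˢ T)) (hJ : ∀ x ∈ J, a + s * x ∈ I) :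
    ContinuousOn (fun p : ℝ × ℝ => f (a + s * p.1) p.2) (J ×ˢ T) :=
  hf.comp (f := fun p : ℝ × ℝ => (a + s * p.1, p.2)) (by fun_prop) fun _ hp => ⟨hJ _ hp.1, hp.2⟩

theorem derivWithin_Icc_eq_pdX {f : ℝ → ℝ → ℝ} {a b x : ℝ} (hx : x ∈ Ioo a b) (t : ℝ) :
    derivWithin (fun z => f z t) (Icc a b) x = pdX f x t :=
  derivWithin_of_mem_nhds (Icc_mem_nhds hx.1 hx.2)

/-- The gauge transformed estimation error `u - û` on `[-1,1]`. -/
noncomputable def gaugedError (ε : ℝ) (ν : ℝ → ℝ) (y₀ : ℝ) (ubar : ℝ → ℝ → ℝ)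
    (uhat : Fin 2 → ℝ → ℝ → ℝ) (y t : ℝ) : ℝ :=
  gauged ε ν ubar y t - unfolded y₀ uhat y t

/-- The gauge transformed estimation error on the `i`-th piece, in the folded variable `x ∈ [0,1]`
of the `i`-th estimator. -/
noncomputable def foldError (ε : ℝ) (ν : ℝ → ℝ) (y₀ : ℝ) (ubar : ℝ → ℝ → ℝ)
    (uhat : Fin 2 → ℝ → ℝ → ℝ) (i : Fin 2) (x t : ℝ) : ℝ :=
  gauged ε ν ubar (y₀ + foldSlope y₀ i * x) t - uhat i x t

section Error

variable {ε y₀ t₀ : ℝ} {ν lamBar : ℝ → ℝ} {Ubar : Fin 2 → ℝ → ℝ} {ubar : ℝ → ℝ → ℝ}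
  {uhat : Fin 2 → ℝ → ℝ → ℝ} {Φ : Fin 2 → ℝ → ℝ → ℝ}

theorem gaugedError_fold (hy₀ : y₀ ∈ Ioo (-1 : ℝ) 1) (i : Fin 2) {x : ℝ} (hx : 0 < x) (t : ℝ) :
    gaugedError ε ν y₀ ubar uhat (y₀ + foldSlope y₀ i * x) t
      = foldError ε ν y₀ ubar uhat i x t := by
  rw [gaugedError, foldError, unfolded_fold hy₀ uhat hx]

theorem gaugedError_eq_exp_mul (y t : ℝ) :
    gaugedError ε ν y₀ ubar uhat y t
      = Real.exp (gaugeExp ε ν y) * (ubar y t - stateEstimate ε ν y₀ uhat y t) := by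
  rw [gaugedError, gauged, stateEstimate, mul_sub, ← mul_assoc, ← Real.exp_add, add_neg_cancel,
    Real.exp_zero, one_mul]

theorem error_eq_exp_neg_mul (y t : ℝ) :
    ubar y t - stateEstimate ε ν y₀ uhat y t
      = Real.exp (-gaugeExp ε ν y) * gaugedError ε ν y₀ ubar uhat y t := by
  rw [gaugedError_eq_exp_mul, ← mul_assoc, ← Real.exp_add, neg_add_cancel, Real.exp_zero, one_mul]

theorem foldError_pde (hε : ε ≠ 0) (hν : ContDiffOn ℝ 1 ν (Icc (-1) 1))
    (hy₀ : y₀ ∈ Ioo (-1 : ℝ) 1) (hu : IsPlantSolution ε ν lamBar Ubar t₀ ubar)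
    (hv : IsObserverSolution ε ν lamBar y₀ Φ Ubar ubar t₀ uhat) (i : Fin 2) {x t : ℝ}
    (hx : x ∈ Ioo (0 : ℝ) 1) (ht : t > t₀) :
    pdT (gauged ε ν ubar) (y₀ + foldSlope y₀ i * x) t - pdT (uhat i) x t
      = foldDiff ε y₀ i * (foldSlope y₀ i * (foldSlope y₀ i *
          pdXX (gauged ε ν ubar) (y₀ + foldSlope y₀ i * x) t) - pdXX (uhat i) x t)
        + foldReaction (reaction ε ν lamBar) y₀ i x * foldError ε ν y₀ ubar uhat i x t
        - observerGain (foldDiff ε y₀ i) (Φ i) x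
          * (foldSlope y₀ i * pdX (gauged ε ν ubar) (y₀ + foldSlope y₀ i * 0) t
            - derivWithin (fun z => uhat i z t) (Icc 0 1) 0) := by
  have slope_ne := foldSlope_ne_zero hy₀ i
  rw [hu.pde_gauged hε hν (fold_mem_Ioo hy₀ (Ioo_subset_Ico_self hx) i) ht, (hv i).pde x hx t ht]
  simp only [foldError, foldReaction, foldDiff, mul_zero, add_zero]
  field_simp
  ring

theorem foldError_zero (hv : IsObserverSolution ε ν lamBar y₀ Φ Ubar ubar t₀ uhat) (i : Fin 2)
    {t : ℝ} (ht : t > t₀) : foldError ε ν y₀ ubar uhat i 0 t = 0 := by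
  rw [foldError, (hv i).left t ht, mul_zero, add_zero, sub_self]

theorem foldError_one (hu : IsPlantSolution ε ν lamBar Ubar t₀ ubar)
    (hv : IsObserverSolution ε ν lamBar y₀ Φ Ubar ubar t₀ uhat) (i : Fin 2) {t : ℝ} (ht : t > t₀) :
    foldError ε ν y₀ ubar uhat i 1 t = 0 := by
  rw [foldError, (hv i).right t ht, fold_one, gauged, gaugedInput]
  match i with
  | 0 => simp [hu.left t ht]
  | 1 => simp [hu.right t ht]

theorem isErrorSystem_foldError (hε : ε ≠ 0) (hν : ContDiffOn ℝ 1 ν (Icc (-1) 1))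
    (hy₀ : y₀ ∈ Ioo (-1 : ℝ) 1) (hu : IsPlantSolution ε ν lamBar Ubar t₀ ubar)
    (hv : IsObserverSolution ε ν lamBar y₀ Φ Ubar ubar t₀ uhat) (i : Fin 2) :
    IsErrorSystem (foldDiff ε y₀ i) (foldReaction (reaction ε ν lamBar) y₀ i)
      (observerGain (foldDiff ε y₀ i) (Φ i)) t₀ (foldError ε ν y₀ ubar uhat i)
      (fun x t => foldSlope y₀ i * pdX (gauged ε ν ubar) (y₀ + foldSlope y₀ i * x) t
        - derivWithin (fun z => uhat i z t) (Icc 0 1) x)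
      (fun x t => foldSlope y₀ i * (foldSlope y₀ i *
        pdXX (gauged ε ν ubar) (y₀ + foldSlope y₀ i * x) t) - pdXX (uhat i) x t)
      (fun x t => pdT (gauged ε ν ubar) (y₀ + foldSlope y₀ i * x) t - pdT (uhat i) x t) where
  cont := (continuousOn_comp_affine (continuousOn_gauged hν.continuousOn hu.cont)
    fun _ hx => fold_mem_Icc hy₀ hx i).sub (hv i).cont
  cont_x := (continuousOn_const.mul
    (continuousOn_comp_affine (isC21On_gauged hu.regular hν hu.cont).cont_x
      fun _ hx => fold_mem_Ioo hy₀ hx i)).sub (hv i).cont_slope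
  cont_xx := (continuousOn_const.mul (continuousOn_const.mul
    (continuousOn_comp_affine (isC21On_gauged hu.regular hν hu.cont).cont_xx
      fun _ hx => fold_mem_Ioo hy₀ (Ioo_subset_Ico_self hx) i))).sub (hv i).regular.cont_xx
  cont_t := (continuousOn_comp_affine (isC21On_gauged hu.regular hν hu.cont).cont_t
    fun _ hx => fold_mem_Ioo hy₀ (Ioo_subset_Ico_self hx) i).sub (hv i).regular.cont_t
  deriv_x x hx t ht := by
    have mem := fold_mem_Ioo hy₀ (Ioo_subset_Ico_self hx) i
    rw [derivWithin_Icc_eq_pdX hx]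
    exact (hasDerivAt_comp_affine
      ((isC21On_gauged hu.regular hν hu.cont).diff_x _ mem t ht).hasDerivAt).sub
        ((hv i).regular.diff_x x hx t ht).hasDerivAt
  deriv_xx x hx t ht := by
    have mem := fold_mem_Ioo hy₀ (Ioo_subset_Ico_self hx) i
    refine (((hasDerivAt_comp_affine
      ((isC21On_gauged hu.regular hν hu.cont).diff_xx _ mem t ht).hasDerivAt).const_mul _).sub
        ((hv i).regular.diff_xx x hx t ht).hasDerivAt).congr_of_eventuallyEq ?_
    filter_upwards [Ioo_mem_nhds hx.1 hx.2] with z hz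
    simp only [derivWithin_Icc_eq_pdX hz, Pi.sub_apply]
  deriv_t x hx t ht :=
    ((isC21On_gauged hu.regular hν hu.cont).diff_t _
      (fold_mem_Ioo hy₀ (Ioo_subset_Ico_self hx) i) t ht).hasDerivAt.sub
        ((hv i).regular.diff_t x hx t ht).hasDerivAt
  pde x hx t ht := foldError_pde hε hν hy₀ hu hv i hx ht
  left t ht := foldError_zero hv i ht
  right t ht := foldError_one hu hv i ht

end Error

/-! ### Transfer of the decay to the original variables -/

section Decay

variable {ε y₀ t₀ : ℝ} {ν lamBar : ℝ → ℝ} {Ubar : Fin 2 → ℝ → ℝ} {ubar : ℝ → ℝ → ℝ}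
  {uhat : Fin 2 → ℝ → ℝ → ℝ} {Φ : Fin 2 → ℝ → ℝ → ℝ}

theorem hasL2InitialValue_foldError (hν : ContinuousOn ν (Icc (-1) 1))
    (hy₀ : y₀ ∈ Ioo (-1 : ℝ) 1) (hu : IsPlantSolution ε ν lamBar Ubar t₀ ubar)
    (hv : IsObserverSolution ε ν lamBar y₀ Φ Ubar ubar t₀ uhat) (i : Fin 2) :
    HasL2InitialValue (foldError ε ν y₀ ubar uhat i) 0 1 t₀ := by
  have cont_fold := continuousOn_comp_affine (continuousOn_gauged (ε := ε) hν hu.cont)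
    fun _ hx => fold_mem_Icc hy₀ hx i
  have initial_fold := (hasL2InitialValue_gauged (ε := ε) hν hu.initial).comp_affine
    (foldSlope_ne_zero hy₀ i) fun _ hx => fold_mem_Ioo hy₀ (Ioo_subset_Ico_self hx) i
  exact initial_fold.sub (hv i).initial
    (fun _ ht => aestronglyMeasurable_Ioo_of_continuousOn_Icc (continuousOn_slice cont_fold ht))
    (fun _ ht => aestronglyMeasurable_Ioo_of_continuousOn_Icc (continuousOn_slice (hv i).cont ht))

theorem eLpNorm_foldError (hy₀ : y₀ ∈ Ioo (-1 : ℝ) 1) (i : Fin 2) (t : ℝ) (p : ENNReal) :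
    eLpNorm (fun x => foldError ε ν y₀ ubar uhat i x t) p (volume.restrict (Ioo 0 1))
      = ENNReal.ofReal |(foldSlope y₀ i)⁻¹| ^ (1 / p).toReal
        * eLpNorm (fun y => gaugedError ε ν y₀ ubar uhat y t) p
            (volume.restrict (foldPiece y₀ i)) := by
  rw [← eLpNorm_comp_affine y₀ (foldSlope_ne_zero hy₀ i), preimage_foldPiece hy₀ i]
  exact eLpNorm_congr_ae (ae_restrict_of_forall_mem measurableSet_Ioo
    fun x hx => (gaugedError_fold hy₀ i hx.1 t).symm)

theorem eLpNorm_gaugedError_foldPiece_le (hy₀ : y₀ ∈ Ioo (-1 : ℝ) 1) (i : Fin 2) {K : ENNReal}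
    {t τ : ℝ} (h : eLpNorm (fun x => foldError ε ν y₀ ubar uhat i x t) 2 (volume.restrict (Ioo 0 1))
      ≤ K * eLpNorm (fun x => foldError ε ν y₀ ubar uhat i x τ) 2 (volume.restrict (Ioo 0 1))) :
    eLpNorm (fun y => gaugedError ε ν y₀ ubar uhat y t) 2 (volume.restrict (foldPiece y₀ i))
      ≤ K * eLpNorm (fun y => gaugedError ε ν y₀ ubar uhat y τ) 2
          (volume.restrict (foldPiece y₀ i)) := by
  rw [eLpNorm_foldError hy₀, eLpNorm_foldError hy₀, mul_left_comm] at h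
  exact (ENNReal.mul_le_mul_iff_right (by simp [foldSlope_ne_zero hy₀ i]) (by finiteness)).1 h

theorem eLpNorm_le_sum_foldPiece (hy₀ : y₀ ∈ Ioo (-1 : ℝ) 1) (f : ℝ → ℝ) :
    eLpNorm f 2 (volume.restrict (Ioo (-1) 1))
      ≤ ∑ i, eLpNorm f 2 (volume.restrict (foldPiece y₀ i)) := by
  rw [← Measure.restrict_congr_set (foldPiece_union_ae_eq hy₀), Fin.sum_univ_two]
  exact eLpNorm_restrict_union_le one_le_two ENNReal.ofNat_ne_top f _ _ _

theorem eLpNorm_gaugedError_le (hy₀ : y₀ ∈ Ioo (-1 : ℝ) 1) {D : Fin 2 → ℝ} (hD : ∀ i, 0 ≤ D i)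
    {r t τ : ℝ} (hr : 0 ≤ r)
    (h : ∀ i, eLpNorm (fun x => foldError ε ν y₀ ubar uhat i x t) 2 (volume.restrict (Ioo 0 1))
      ≤ ENNReal.ofReal (D i * r)
        * eLpNorm (fun x => foldError ε ν y₀ ubar uhat i x τ) 2 (volume.restrict (Ioo 0 1))) :
    eLpNorm (fun y => gaugedError ε ν y₀ ubar uhat y t) 2 (volume.restrict (Ioo (-1) 1))
      ≤ ENNReal.ofReal ((∑ i, D i) * r)
        * eLpNorm (fun y => gaugedError ε ν y₀ ubar uhat y τ) 2 (volume.restrict (Ioo (-1) 1)) := by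
  rw [Finset.sum_mul, ENNReal.ofReal_sum_of_nonneg fun i _ => mul_nonneg (hD i) hr, Finset.sum_mul]
  refine (eLpNorm_le_sum_foldPiece hy₀ _).trans (Finset.sum_le_sum fun i _ => ?_)
  refine (eLpNorm_gaugedError_foldPiece_le hy₀ i (h i)).trans ?_
  gcongr
  exact foldPiece_subset hy₀ i

theorem eLpNorm_error_le {B C r t τ : ℝ} (hB : ∀ y ∈ Icc (-1 : ℝ) 1, |gaugeExp ε ν y| ≤ B)
    (h : eLpNorm (fun y => gaugedError ε ν y₀ ubar uhat y t) 2 (volume.restrict (Ioo (-1) 1))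
      ≤ ENNReal.ofReal (C * r)
        * eLpNorm (fun y => gaugedError ε ν y₀ ubar uhat y τ) 2 (volume.restrict (Ioo (-1) 1))) :
    eLpNorm (fun y => ubar y t - stateEstimate ε ν y₀ uhat y t) 2 (volume.restrict (Ioo (-1) 1))
      ≤ ENNReal.ofReal (Real.exp B ^ 2 * C * r)
        * eLpNorm (fun y => ubar y τ - stateEstimate ε ν y₀ uhat y τ) 2
            (volume.restrict (Ioo (-1) 1)) := by
  have ungauge : eLpNorm (fun y => ubar y t - stateEstimate ε ν y₀ uhat y t) 2
      (volume.restrict (Ioo (-1) 1)) ≤ ENNReal.ofReal (Real.exp B)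
        * eLpNorm (fun y => gaugedError ε ν y₀ ubar uhat y t) 2 (volume.restrict (Ioo (-1) 1)) := by
    simp only [error_eq_exp_neg_mul]
    exact eLpNorm_exp_mul_le (μ := volume) measurableSet_Ioo
      (fun y hy => (neg_le_abs _).trans (hB y (Ioo_subset_Icc_self hy))) _ 2
  have gauge : eLpNorm (fun y => gaugedError ε ν y₀ ubar uhat y τ) 2
      (volume.restrict (Ioo (-1) 1)) ≤ ENNReal.ofReal (Real.exp B)
        * eLpNorm (fun y => ubar y τ - stateEstimate ε ν y₀ uhat y τ) 2
            (volume.restrict (Ioo (-1) 1)) := by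
    simp only [gaugedError_eq_exp_mul]
    exact eLpNorm_exp_mul_le (μ := volume) measurableSet_Ioo
      (fun y hy => (le_abs_self _).trans (hB y (Ioo_subset_Icc_self hy))) _ 2
  refine (ungauge.trans (mul_le_mul_right (h.trans (mul_le_mul_right gauge _)) _)).trans_eq ?_
  have exp_nonneg := Real.exp_nonneg B
  rw [sq, mul_assoc, mul_assoc, ENNReal.ofReal_mul exp_nonneg, ENNReal.ofReal_mul exp_nonneg]
  ring

end Decay

theorem theorem2_general {ε : ℝ} (hε : 0 < ε) {ν lamBar : ℝ → ℝ}
    (hν : ContDiffOn ℝ 1 ν (Icc (-1) 1))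
    (hlam : ContDiffOn ℝ 1 (reaction ε ν lamBar) (Icc (-1) 1))
    {y₀ : ℝ} (hy₀ : y₀ ∈ Ioo (-1 : ℝ) 1) (c : Fin 2 → ℝ) {γ : ℝ}
    (hγ : ∀ i, γ ≤ foldDiff ε y₀ i * Real.pi ^ 2 + c i) :
    (∀ i, ∃ Φ : ℝ → ℝ → ℝ, IsObserverKernel (foldDiff ε y₀ i)
      (foldReaction (reaction ε ν lamBar) y₀ i) (c i) Φ) ∧
    ∀ Φ : Fin 2 → ℝ → ℝ → ℝ,
      (∀ i, IsObserverKernel (foldDiff ε y₀ i)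
        (foldReaction (reaction ε ν lamBar) y₀ i) (c i) (Φ i)) →
      ∃ C : ℝ, 0 < C ∧
        ∀ (t₀ : ℝ) (Ubar : Fin 2 → ℝ → ℝ) (ubar : ℝ → ℝ → ℝ) (uhat : Fin 2 → ℝ → ℝ → ℝ),
          IsPlantSolution ε ν lamBar Ubar t₀ ubar →
          IsObserverSolution ε ν lamBar y₀ Φ Ubar ubar t₀ uhat →
          ∀ t ≥ t₀,
            eLpNorm (fun y => ubar y t - stateEstimate ε ν y₀ uhat y t) 2
                (volume.restrict (Ioo (-1) 1))
              ≤ ENNReal.ofReal (C * Real.exp (-γ * (t - t₀))) *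
                eLpNorm (fun y => ubar y t₀ - stateEstimate ε ν y₀ uhat y t₀) 2
                  (volume.restrict (Ioo (-1) 1)) := by
  have smooth := contDiffOn_foldReaction hy₀ hlam
  refine ⟨fun i => exists_observerKernel (smooth i) (c i), fun Φ hΦ => ?_⟩
  choose D one_le_D decay using fun i => exists_integral_sq_decay (foldDiff_pos hε hy₀ i)
    (smooth i).continuousOn (hΦ i) (hγ i)
  have D_pos : ∀ i, 0 < D i := fun i => one_pos.trans_le (one_le_D i)
  obtain ⟨B, hB⟩ := exists_abs_gaugeExp_le ε hν.continuousOn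
  refine ⟨Real.exp B ^ 2 * ∑ i, D i, mul_pos (by positivity)
    (Finset.sum_pos (fun i _ => D_pos i) Finset.univ_nonempty),
    fun t₀ Ubar ubar uhat hu hv t ht => ?_⟩
  have system := isErrorSystem_foldError hε.ne' hν hy₀ hu hv
  refine eLpNorm_error_le hB (eLpNorm_gaugedError_le hy₀ (fun i => (D_pos i).le)
    (Real.exp_nonneg _) fun i => ?_)
  exact (hasL2InitialValue_foldError hν.continuousOn hy₀ hu hv i).eLpNorm_decay zero_le_one
    (fun τ hτ => continuousOn_slice (system i).cont hτ) (one_le_D i)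
    (decay i t₀ _ _ _ _ (system i)) ht

theorem theorem2 (ε : ℝ) (hε : 0 < ε) (ν lamBar : ℝ → ℝ)
    (hν : ContDiffOn ℝ 1 ν (Icc (-1) 1))
    (hlam : ContDiffOn ℝ 1 (reaction ε ν lamBar) (Icc (-1) 1))
    (y₀ : ℝ) (hy₀ : y₀ ∈ Ioo (-1 : ℝ) 1) (c : Fin 2 → ℝ) (hc : ∀ i, 0 < c i) :
    (∀ i, ∃ Φ : ℝ → ℝ → ℝ, IsObserverKernel (foldDiff ε y₀ i)
      (foldReaction (reaction ε ν lamBar) y₀ i) (c i) Φ) ∧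
    ∀ Φ : Fin 2 → ℝ → ℝ → ℝ,
      (∀ i, IsObserverKernel (foldDiff ε y₀ i)
        (foldReaction (reaction ε ν lamBar) y₀ i) (c i) (Φ i)) →
      ∃ C γ : ℝ, 0 < C ∧ 0 < γ ∧
        ∀ (t₀ : ℝ) (Ubar : Fin 2 → ℝ → ℝ) (ubar : ℝ → ℝ → ℝ) (uhat : Fin 2 → ℝ → ℝ → ℝ),
          IsPlantSolution ε ν lamBar Ubar t₀ ubar →
          IsObserverSolution ε ν lamBar y₀ Φ Ubar ubar t₀ uhat →
          ∀ t ≥ t₀,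
            eLpNorm (fun y => ubar y t - stateEstimate ε ν y₀ uhat y t) 2
                (volume.restrict (Ioo (-1) 1))
              ≤ ENNReal.ofReal (C * Real.exp (-γ * (t - t₀))) *
                eLpNorm (fun y => ubar y t₀ - stateEstimate ε ν y₀ uhat y t₀) 2
                  (volume.restrict (Ioo (-1) 1)) := by
  have rate_pos : ∀ i, 0 < foldDiff ε y₀ i * Real.pi ^ 2 + c i := fun i =>
    add_pos (mul_pos (foldDiff_pos hε hy₀ i) (by positivity)) (hc i)
  obtain ⟨existence, decay⟩ := theorem2_general hε hν hlam hy₀ c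
    (Fin.forall_fin_two.2 ⟨min_le_left _ _, min_le_right _ _⟩)
  exact ⟨existence, fun Φ hΦ => have ⟨C, hC, h⟩ := decay Φ hΦ
    ⟨C, _, hC, lt_min (rate_pos 0) (rate_pos 1), h⟩⟩
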